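/- A set of lines through the origin of a Euclidean space $\mathbb{R}^d$ is equiangular with common angle $\theta$ if any two distinct lines of the set form the angle $\theta$. The rank of a set of lines is the smallest dimension of a Euclidean space into which the lines can be isometrically embedded. Let $N^*_{1/3}(r)$ be the maximum cardinality of a set of equiangular lines with common angle $\arccos(1/3)$ and of rank $r$ (in Euclidean spaces of any dimension). For a finite simple graph $G$ with adjacency matrix $A(G)$, the Seidel matrix is $S(G)=J-I-2A(G)$, where $J$ is the all-ones matrix. A set of lines is induced by $S(G)$ if it consists of the lines spanned by vectors $u_v$ ($v\in V(G)$) with Gram matrix $\lambda I-S(G)$, where $\lambda$ is the largest eigenvalue of $S(G)$. Two graphs on a vertex set $V$ are switching equivalent if one is obtained from the other by choosing a subset $U\subseteq V$ and exchanging adjacency and non-adjacency between $U$ and $V\setminus U$. Write $L(G)$ for the line graph of $G$, $+$ for the disjoint union of graphs, $K_n$ for the complete graph and $K_{m,n}$ for the complete bipartite graph. Let $r\ge 3$ be an integer. Then the maximum $N^*_{1/3}(r)$ exists and $$N^*_{1/3}(r)=\begin{cases}10 & \text{if } r=5,\\ 16 & \text{if } r=6,\\ 28 & \text{if } r=7,\\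 2(r-1) & \text{otherwise.}\end{cases}$$ Moreover, every set of equiangular lines with common angle $\arccos(1/3)$, of rank $r$ and of cardinality $N^*_{1/3}(r)$, is induced by the Seidel matrix of a graph switching equivalent to $L(K_5)$ if $r=5$, to $L(K_6)+K_1$ if $r=6$, to $L(K_8)$ if $r=7$, and to $L(K_{2,r-1})$ otherwise. -/

import Mathlib

/-! ## Sets of equiangular lines

Lines are lines through the origin, that is, one-dimensional linear subspaces. -/

/-- A set `L` of lines of a Euclidean space is equiangular with common angle `θ` if any two
distinct lines of `L` form the angle `θ`.  The angle of two lines is the smaller one of the two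
supplementary angles formed by vectors that span them. -/
def IsEquiangular {E : Type*} [NormedAddCommGroup E] [InnerProductSpace ℝ E]
    (L : Set (Submodule ℝ E)) (θ : ℝ) : Prop :=
  (∀ l ∈ L, Module.finrank ℝ l = 1) ∧
    ∀ l ∈ L, ∀ m ∈ L, l ≠ m → ∀ x ∈ l, ∀ y ∈ m, x ≠ 0 → y ≠ 0 →
      min (InnerProductGeometry.angle x y) (Real.pi - InnerProductGeometry.angle x y) = θ

/-- The rank of a set of lines: the smallest dimension of a Euclidean space into which the lines
(that is, their union, as a metric space) can be isometrically embedded. -/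
noncomputable def lineRank {E : Type*} [NormedAddCommGroup E] [InnerProductSpace ℝ E]
    (L : Set (Submodule ℝ E)) : ℕ :=
  sInf {k : ℕ | ∃ f : (⋃ l ∈ L, (l : Set E) : Set E) → EuclideanSpace ℝ (Fin k), Isometry f}

/-- The cardinalities of the sets of equiangular lines with common angle `arccos α` and of rank
`r` in Euclidean spaces of arbitrary dimension.  (Infinite sets would contribute `⊤`.) -/
def equiangularCards (α : ℝ) (r : ℕ) : Set ℕ∞ :=
  {c | ∃ (d : ℕ) (L : Set (Submodule ℝ (EuclideanSpace ℝ (Fin d)))),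
    IsEquiangular L (Real.arccos α) ∧ lineRank L = r ∧ L.encard = c}

/-- `N*_α(r)`, the maximum cardinality of a set of equiangular lines with common angle `arccos α`
and of rank `r`. -/
noncomputable def maxEquiangular (α : ℝ) (r : ℕ) : ℕ∞ :=
  sSup (equiangularCards α r)

/-! ## Seidel matrices and switching -/

open Classical in
/-- The Seidel matrix `J - I - 2 A(G)` of a graph `G`. -/
noncomputable def seidelMatrix {V : Type*} (G : SimpleGraph V) : Matrix V V ℝ :=
  Matrix.of (fun _ _ => (1 : ℝ)) - 1 - (2 : ℝ) • G.adjMatrix ℝ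

/-- The graph `G^U` obtained from `G` by switching with respect to `U`: adjacency is kept inside
`U` and inside its complement, and it is reversed between `U` and its complement. -/
def switching {V : Type*} (G : SimpleGraph V) (U : Set V) : SimpleGraph V where
  Adj x y := ((x ∈ U ↔ y ∈ U) ∧ G.Adj x y) ∨ (¬(x ∈ U ↔ y ∈ U) ∧ ¬G.Adj x y)
  symm := ⟨fun x y h => by
    rcases h with ⟨h, h'⟩ | ⟨h, h'⟩
    · exact Or.inl ⟨h.symm, h'.symm⟩
    · exact Or.inr ⟨fun k => h k.symm, fun k => h' k.symm⟩⟩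
  loopless := ⟨fun x h => by
    rcases h with ⟨_, h'⟩ | ⟨h, _⟩
    · exact G.loopless.irrefl x h'
    · exact h Iff.rfl⟩

/-- Two graphs on the same vertex set are switching equivalent if one is obtained from the other
by switching with respect to a set of vertices. -/
def SwitchingEquivalent {V : Type*} (G H : SimpleGraph V) : Prop :=
  ∃ U : Set V, H = switching G U

/-- The set of lines `L` is induced by the square matrix `S`: if `t` is the largest eigenvalue of
`S`, then the lines in `L` are those spanned by vectors with Gram matrix `t I - S`. -/
def IsInducedBy {V : Type*} [Fintype V] [DecidableEq V]
    {E : Type*} [NormedAddCommGroup E] [InnerProductSpace ℝ E]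
    (L : Set (Submodule ℝ E)) (S : Matrix V V ℝ) : Prop :=
  ∃ t : ℝ, IsGreatest {μ : ℝ | Module.End.HasEigenvalue (Matrix.toLin' S) μ} t ∧
    ∃ u : V → E, Matrix.gram ℝ u = t • (1 : Matrix V V ℝ) - S ∧
      L = Set.range (fun v => Submodule.span ℝ {u v})

open Classical in
/-- The set of lines `L` is induced by the Seidel matrix of a graph that is switching equivalent
to `H`. -/
def IsInducedBySwitchingClass {V : Type*} [Finite V]
    {E : Type*} [NormedAddCommGroup E] [InnerProductSpace ℝ E]
    (L : Set (Submodule ℝ E)) (H : SimpleGraph V) : Prop :=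
  let _ : Fintype V := Fintype.ofFinite V
  ∃ G : SimpleGraph V, SwitchingEquivalent G H ∧ IsInducedBy L (seidelMatrix G)

/-! ## The graphs in the classification -/

/-- The complete graph on `n` vertices. -/
abbrev completeK (n : ℕ) : SimpleGraph (Fin n) := SimpleGraph.completeGraph (Fin n)

/-- The complete bipartite graph with parts of sizes `m` and `n`. -/
abbrev completeBipartiteK (m n : ℕ) : SimpleGraph (Fin m ⊕ Fin n) :=
  completeBipartiteGraph (Fin m) (Fin n)

/-! Scale the spanning vectors to norm `√3`, so that vectors on distinct lines have inner product
`±1`, and keep both signs (`lineVectors`). The rank is the dimension of the span of these vectors.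

If no three of them have pairwise inner products `-1`, signs can be chosen so that all inner
products are `1`. The Gram matrix `2I + J` is then nonsingular and there are at most `r` lines,
fewer than claimed. Otherwise three vectors with inner products `-1` are diagonals of a cube with
orthonormal axes `e 0, e 1, e 2`. Every further vector is, up to sign, the fourth diagonal or `e i +
y` with `y` orthogonal to the cube (`eq_diagonal_or_mem_pillar`). The possible `y` form three
pillars of vectors of squared norm 2. Inner products are `0, ±2` inside a pillar and `±1` between
different pillars (`isRootTriple_pillar`).

Let `s = r - 3` be the dimension spanned by the pillars. A pillar spanning dimension `k` lies in an
orthogonal frame and its negatives, so it has at most `2k` vectors. A single nonempty pillar gives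
at most `4 + 2s = 2(r - 1)` lines. If two pillars are nonempty, then `s ≤ 4` (`finrank_le_four`),
and for `s = 2, 3, 4` each pillar spans dimension at most `1, 2, 4` (`dichotomy`). This gives at
most `4 + 6`, `4 + 12`, `4 + 24` lines.

At equality all four diagonals occur and the pillars are full. In the three exceptional ranks they
contain the roots of `A₂`, `D₃`, `D₄`, split into three classes (`exists_structure_of_two`,
`exists_structure_of_three`, `exists_structure_of_four`). The lines are then spanned by sums `φ i +
φ j` of vectors with Gram matrix `2I - J/4`, which represent `L(Kₙ)`, together with one isolated
vertex in rank 6. With one pillar the lines are spanned by `±e + g` for an orthogonal frame of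
vectors `g`, which represents `L(K_{2,r-1})`. Since there are more lines than dimensions, `3I - S`
is singular as well as positive semidefinite, so 3 is the largest Seidel eigenvalue. -/

open scoped InnerProductSpace

/-! ### Gram matrices, rank as dimension, and Seidel matrices. -/

section Basics

variable {E : Type*} [NormedAddCommGroup E] [InnerProductSpace ℝ E]

/-- Linear independence only depends on the Gram matrix. -/
theorem LinearIndependent.of_gram_eq {F : Type*} [NormedAddCommGroup F] [InnerProductSpace ℝ F]
    {n : Type*} [Finite n] {v : n → E} {w : n → F} (h : Matrix.gram ℝ v = Matrix.gram ℝ w)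
    (hv : LinearIndependent ℝ v) : LinearIndependent ℝ w := by
  rw [← Matrix.posDef_gram_iff_linearIndependent] at *
  rwa [← h]

/-- A vector of the span of `S` that is orthogonal to `S` vanishes. -/
theorem eq_zero_of_mem_span_of_inner_eq_zero {S : Set E} {x : E} (hx : x ∈ Submodule.span ℝ S)
    (h : ∀ s ∈ S, ⟪s, x⟫_ℝ = 0) : x = 0 := by
  have h1 : ∀ y ∈ Submodule.span ℝ S, ⟪y, x⟫_ℝ = 0 := by
    intro y hy
    induction hy using Submodule.span_induction with
    | mem y hy => exact h y hy
    | zero => simp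
    | add y z _ _ hy hz => rw [inner_add_left, hy, hz, add_zero]
    | smul c y _ hy => rw [real_inner_smul_left, hy, mul_zero]
  exact inner_self_eq_zero.1 (h1 x hx)

/-- Here `‖x - y‖² = q - 2q + q = 0`, the equality case of Cauchy–Schwarz. This and its negative
turn values of inner products into identities of vectors. -/
theorem eq_of_inner_eq {x y : E} {q : ℝ} (hx : ⟪x, x⟫_ℝ = q) (hy : ⟪y, y⟫_ℝ = q)
    (hxy : ⟪x, y⟫_ℝ = q) : y = x := by
  rw [← sub_eq_zero, ← inner_self_eq_zero (𝕜 := ℝ), inner_sub_left, inner_sub_right,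
    inner_sub_right]
  have := real_inner_comm x y
  linarith

theorem eq_neg_of_inner_eq {x y : E} {q : ℝ} (hx : ⟪x, x⟫_ℝ = q) (hy : ⟪y, y⟫_ℝ = q)
    (hxy : ⟪x, y⟫_ℝ = -q) : y = -x := by
  have := eq_of_inner_eq (x := x) (y := -y) hx (by simpa using hy) (by simp [hxy])
  rw [← this, neg_neg]

theorem abs_inner_le_of_inner_self {x y : E} {q : ℝ} (hx : ⟪x, x⟫_ℝ = q) (hy : ⟪y, y⟫_ℝ = q) :
    -q ≤ ⟪x, y⟫_ℝ ∧ ⟪x, y⟫_ℝ ≤ q := by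
  have h1 : 0 ≤ ⟪x - y, x - y⟫_ℝ := real_inner_self_nonneg
  have h2 : 0 ≤ ⟪x + y, x + y⟫_ℝ := real_inner_self_nonneg
  simp only [inner_sub_left, inner_sub_right, inner_add_left, inner_add_right, hx, hy,
    real_inner_comm x y] at h1 h2
  constructor <;> linarith

theorem eq_or_eq_neg_of_span_eq {x y : E} {q : ℝ} (hq : q ≠ 0) (hx : ⟪x, x⟫_ℝ = q)
    (hy : ⟪y, y⟫_ℝ = q) (h : Submodule.span ℝ {x} = Submodule.span ℝ {y}) : y = x ∨ y = -x := by
  have hm : y ∈ Submodule.span ℝ {x} := h ▸ Submodule.mem_span_singleton_self y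
  obtain ⟨c, rfl⟩ := Submodule.mem_span_singleton.1 hm
  rw [real_inner_smul_left, real_inner_smul_right, hx] at hy
  have : c * c = 1 := by
    have : (c * c - 1) * q = 0 := by linarith
    rcases mul_eq_zero.1 this with h | h
    · linarith
    · exact absurd h hq
  rcases mul_self_eq_one_iff.1 this with rfl | rfl <;> simp

/-- The rank of a set of lines is the dimension of its span. -/
theorem lineRank_eq_finrank_span [FiniteDimensional ℝ E] (L : Set (Submodule ℝ E)) :
    lineRank L = Module.finrank ℝ (Submodule.span ℝ (⋃ l ∈ L, (l : Set E))) := by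
  set U : Set E := ⋃ l ∈ L, (l : Set E) with hU
  have hmem : Module.finrank ℝ (Submodule.span ℝ U) ∈
      {k : ℕ | ∃ f : U → EuclideanSpace ℝ (Fin k), Isometry f} := by
    refine ⟨fun x => (stdOrthonormalBasis ℝ (Submodule.span ℝ U)).repr
      ⟨x, Submodule.subset_span x.2⟩, ?_⟩
    refine (LinearIsometryEquiv.isometry _).comp ?_
    exact fun x y => rfl
  apply le_antisymm (Nat.sInf_le hmem)
  refine le_csInf ⟨_, hmem⟩ ?_
  rintro k ⟨f, hf⟩
  -- Without lines the union is empty and does not contain the origin, which the argument below uses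
  -- as base point.
  rcases Set.eq_empty_or_nonempty U with h0 | ⟨x0, hx0⟩
  · rw [h0, Submodule.span_empty, finrank_bot]
    exact Nat.zero_le k
  have hz : (0 : E) ∈ U := by
    rw [hU] at hx0 ⊢
    simp only [Set.mem_iUnion] at hx0 ⊢
    obtain ⟨l, hl, _⟩ := hx0
    exact ⟨l, hl, l.zero_mem⟩
  obtain ⟨b, hbU, hbs, hbl⟩ := exists_linearIndependent ℝ U
  have := hbl.finite
  -- The isometry need not be the restriction of a linear map. Distances to the image of the origin
  -- and between images still determine inner products, so a basis taken inside the union keeps its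
  -- Gram matrix and hence its independence.
  have hg : LinearIndependent ℝ (fun x : b => f ⟨x, hbU x.2⟩ - f ⟨0, hz⟩) := by
    refine hbl.of_gram_eq ?_
    ext x y
    have hd : ∀ u v : U, ‖f u - f v‖ = ‖(u : E) - v‖ := by
      intro u v
      rw [← dist_eq_norm, hf.dist_eq, ← dist_eq_norm]
      rfl
    rw [Matrix.gram_apply, Matrix.gram_apply,
      real_inner_eq_norm_mul_self_add_norm_mul_self_sub_norm_sub_mul_self_div_two,
      real_inner_eq_norm_mul_self_add_norm_mul_self_sub_norm_sub_mul_self_div_two,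
      sub_sub_sub_cancel_right, hd, hd, hd]
    simp
  have := Fintype.ofFinite b
  rw [← hbs, finrank_span_set_eq_card hbl, Set.toFinset_card]
  simpa using hg.fintype_card_le_finrank

/-- A set of lines is induced by the Seidel matrix of `H` as soon as it has the right cardinality
and contains the lines spanned by a linearly dependent family with the right Gram matrix. -/
theorem isInducedBySwitchingClass_of_gram {V : Type*} [Finite V] {H : SimpleGraph V}
    {L : Set (Submodule ℝ E)} (u : V → E) (hself : ∀ v, ⟪u v, u v⟫_ℝ = 3)
    (hadj : ∀ v w, H.Adj v w → ⟪u v, u w⟫_ℝ = 1)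
    (hnadj : ∀ v w, v ≠ w → ¬ H.Adj v w → ⟪u v, u w⟫_ℝ = -1)
    (hmem : ∀ v, Submodule.span ℝ {u v} ∈ L) (hcard : L.encard = Nat.card V)
    (hdep : ¬ LinearIndependent ℝ u) : IsInducedBySwitchingClass L H := by
  classical
  let _ : Fintype V := Fintype.ofFinite V
  have hS : ∀ v w, seidelMatrix H v w = 3 * (1 : Matrix V V ℝ) v w - ⟪u v, u w⟫_ℝ := by
    intro v w
    simp only [seidelMatrix, Matrix.sub_apply, Matrix.of_apply, Matrix.smul_apply,
      SimpleGraph.adjMatrix_apply, smul_eq_mul, Matrix.one_apply]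
    by_cases h : v = w
    · subst h
      rw [hself]
      simp
    · by_cases h' : H.Adj v w
      · simp [h, h', hadj v w h']
        norm_num
      · simp [h, h', hnadj v w h h']
  have hmul : ∀ (c : V → ℝ) v,
      (Matrix.toLin' (seidelMatrix H) c) v = 3 * c v - ⟪u v, ∑ w, c w • u w⟫_ℝ := by
    intro c v
    simp only [Matrix.toLin'_apply, Matrix.mulVec, dotProduct, hS, sub_mul,
      Finset.sum_sub_distrib, inner_sum, real_inner_smul_right, Matrix.one_apply]
    simp [mul_comm]
  -- No switching is needed: the freedom of the switching class is the choice of sign of each `u v`,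
  -- already made in the hypotheses.
  refine ⟨H, ⟨∅, ?_⟩, 3, ⟨?_, ?_⟩, u, ?_, ?_⟩
  · ext x y
    simp [switching]
  -- As `S = 3I - Gram`, the coefficients of a linear relation between the `u v` form an eigenvector
  -- for 3.
  · obtain ⟨c, hc, i, hi⟩ := Fintype.not_linearIndependent_iff.1 hdep
    refine Module.End.hasEigenvalue_of_hasEigenvector (x := c) ⟨?_, ?_⟩
    · rw [Module.End.mem_eigenspace_iff]
      ext v
      rw [hmul, hc]
      simp
    · rintro rfl
      exact hi rfl
  -- For an eigenvector `c` the square `‖∑ c w • u w‖²` equals `(3 - μ) ∑ c v²`, so `μ ≤ 3`.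
  · rintro μ hμ
    obtain ⟨c, hc, hc0⟩ := hμ.exists_hasEigenvector
    rw [Module.End.mem_eigenspace_iff] at hc
    have h1 : ∀ v, ⟪u v, ∑ w, c w • u w⟫_ℝ = (3 - μ) * c v := by
      intro v
      have := hmul c v
      rw [hc, Pi.smul_apply, smul_eq_mul] at this
      linarith
    have h2 : 0 ≤ ⟪∑ w, c w • u w, ∑ w, c w • u w⟫_ℝ := real_inner_self_nonneg
    rw [sum_inner] at h2
    simp only [real_inner_smul_left, h1] at h2
    have h3 : ∑ v, c v * ((3 - μ) * c v) = (3 - μ) * ∑ v, c v * c v := by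
      rw [Finset.mul_sum]
      exact Finset.sum_congr rfl fun _ _ => by ring
    rw [h3] at h2
    have h4 : 0 < ∑ v, c v * c v := by
      obtain ⟨i, hi⟩ := Function.ne_iff.1 hc0
      exact Finset.sum_pos' (fun _ _ => mul_self_nonneg _)
        ⟨i, Finset.mem_univ _, mul_self_pos.2 hi⟩
    by_contra hlt
    push Not at hlt
    nlinarith
  · ext v w
    rw [Matrix.gram_apply, Matrix.sub_apply, Matrix.smul_apply, hS, smul_eq_mul]
    ring
  · have hinj : Function.Injective (fun v => Submodule.span ℝ {u v}) := by
      intro v w hvw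
      by_contra hne
      have h1 : ⟪u v, u w⟫_ℝ = 1 ∨ ⟪u v, u w⟫_ℝ = -1 := by
        by_cases h' : H.Adj v w
        · exact Or.inl (hadj v w h')
        · exact Or.inr (hnadj v w hne h')
      rcases eq_or_eq_neg_of_span_eq (by norm_num) (hself v) (hself w) hvw with h | h <;>
      · rw [h] at h1
        simp only [inner_neg_right, hself] at h1
        norm_num at h1
    have hsub : Set.range (fun v => Submodule.span ℝ {u v}) ⊆ L := by
      rintro _ ⟨v, rfl⟩
      exact hmem v
    symm
    refine Set.Finite.eq_of_subset_of_encard_le (Set.finite_range _) hsub ?_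
    rw [hcard, ← Set.image_univ, hinj.encard_image, Set.encard_univ, ENat.card_eq_coe_natCard]

/-! ### Equiangular lines as systems of vectors with inner products `±1`. -/

/-- The set of vectors of norm `√3` on the lines of `L`. -/
def lineVectors (L : Set (Submodule ℝ E)) : Set E :=
  {x | ⟪x, x⟫_ℝ = 3 ∧ Submodule.span ℝ {x} ∈ L}

theorem neg_mem_lineVectors {L : Set (Submodule ℝ E)} {x : E} (hx : x ∈ lineVectors L) :
    -x ∈ lineVectors L := by
  refine ⟨by simpa using hx.1, ?_⟩
  rw [← Set.neg_singleton, Submodule.span_neg]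
  exact hx.2

theorem ne_zero_of_inner_self {x : E} {q : ℝ} (hq : q ≠ 0) (hx : ⟪x, x⟫_ℝ = q) : x ≠ 0 := by
  rintro rfl
  simp at hx
  exact hq hx.symm

theorem angle_eq_arccos_of_inner {x y : E} {c : ℝ} (hx : ⟪x, x⟫_ℝ = 3) (hy : ⟪y, y⟫_ℝ = 3)
    (h : ⟪x, y⟫_ℝ = c) : InnerProductGeometry.angle x y = Real.arccos (c / 3) := by
  have hx' : ‖x‖ * ‖x‖ = 3 := by rw [← real_inner_self_eq_norm_mul_norm, hx]
  have hy' : ‖y‖ * ‖y‖ = 3 := by rw [← real_inner_self_eq_norm_mul_norm, hy]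
  have : ‖x‖ * ‖y‖ = 3 := by
    have h1 : ‖x‖ = ‖y‖ := by nlinarith [norm_nonneg x, norm_nonneg y]
    rw [← h1, hx']
  rw [InnerProductGeometry.angle, this, h]

theorem arccos_third_le : Real.arccos (1 / 3) ≤ Real.pi / 2 := by
  rw [Real.arccos_le_pi_div_two]
  norm_num

theorem min_angle_of_inner {x y : E} (hx : ⟪x, x⟫_ℝ = 3) (hy : ⟪y, y⟫_ℝ = 3)
    (h : ⟪x, y⟫_ℝ = 1 ∨ ⟪x, y⟫_ℝ = -1) :
    min (InnerProductGeometry.angle x y) (Real.pi - InnerProductGeometry.angle x y) =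
      Real.arccos (1 / 3) := by
  have := arccos_third_le
  rcases h with h | h
  · rw [angle_eq_arccos_of_inner hx hy h, min_eq_left (by linarith)]
  · rw [angle_eq_arccos_of_inner hx hy h, neg_div, Real.arccos_neg, sub_sub_cancel,
      min_eq_right (by linarith)]

theorem inner_of_min_angle {x y : E} (hx : ⟪x, x⟫_ℝ = 3) (hy : ⟪y, y⟫_ℝ = 3)
    (h : min (InnerProductGeometry.angle x y) (Real.pi - InnerProductGeometry.angle x y) =
      Real.arccos (1 / 3)) : ⟪x, y⟫_ℝ = 1 ∨ ⟪x, y⟫_ℝ = -1 := by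
  have hb := abs_inner_le_of_inner_self hx hy
  have h1 : Real.cos (InnerProductGeometry.angle x y) = ⟪x, y⟫_ℝ / 3 := by
    rw [angle_eq_arccos_of_inner hx hy rfl, Real.cos_arccos] <;> linarith
  have h2 : Real.cos (Real.arccos (1 / 3)) = 1 / 3 := by
    rw [Real.cos_arccos] <;> norm_num
  rcases min_choice (InnerProductGeometry.angle x y)
    (Real.pi - InnerProductGeometry.angle x y) with h' | h' <;> rw [h'] at h
  · rw [h, h2] at h1
    left
    linarith
  · rw [← h, Real.cos_pi_sub, h1] at h2
    right
    linarith

theorem IsEquiangular.inner_lineVectors {L : Set (Submodule ℝ E)}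
    (hL : IsEquiangular L (Real.arccos (1 / 3))) {x y : E} (hx : x ∈ lineVectors L)
    (hy : y ∈ lineVectors L) : y = x ∨ y = -x ∨ ⟪x, y⟫_ℝ = 1 ∨ ⟪x, y⟫_ℝ = -1 := by
  by_cases h : Submodule.span ℝ {x} = Submodule.span ℝ {y}
  · rcases eq_or_eq_neg_of_span_eq (by norm_num) hx.1 hy.1 h with h | h
    · exact Or.inl h
    · exact Or.inr (Or.inl h)
  · exact Or.inr (Or.inr (inner_of_min_angle hx.1 hy.1 (hL.2 _ hx.2 _ hy.2 h x
      (Submodule.mem_span_singleton_self x) y (Submodule.mem_span_singleton_self y)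
      (ne_zero_of_inner_self (by norm_num) hx.1) (ne_zero_of_inner_self (by norm_num) hy.1))))

theorem IsEquiangular.exists_lineVector {L : Set (Submodule ℝ E)} {θ : ℝ}
    (hL : IsEquiangular L θ) {l : Submodule ℝ E} (hl : l ∈ L) :
    ∃ x ∈ lineVectors L, Submodule.span ℝ {x} = l := by
  obtain ⟨v, hv0, hv⟩ := finrank_eq_one_iff'.1 (hL.1 l hl)
  have hv0' : (v : E) ≠ 0 := by simpa using hv0
  have hl' : Submodule.span ℝ {(v : E)} = l := by
    refine le_antisymm (by simp) ?_
    intro x hx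
    obtain ⟨c, hc⟩ := hv ⟨x, hx⟩
    exact Submodule.mem_span_singleton.2 ⟨c, congrArg Subtype.val hc⟩
  have hn : ‖(v : E)‖ ≠ 0 := norm_ne_zero_iff.2 hv0'
  have hs : Submodule.span ℝ {(Real.sqrt 3 / ‖(v : E)‖) • (v : E)} = l := by
    rw [Submodule.span_singleton_smul_eq (IsUnit.mk0 _ (div_ne_zero (by positivity) hn)), hl']
  refine ⟨(Real.sqrt 3 / ‖(v : E)‖) • (v : E), ⟨?_, ?_⟩, hs⟩
  · rw [real_inner_smul_left, real_inner_smul_right, real_inner_self_eq_norm_mul_norm]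
    field_simp
    exact Real.sq_sqrt (by norm_num)
  · rwa [hs]

theorem IsEquiangular.span_lineVectors {L : Set (Submodule ℝ E)} {θ : ℝ}
    (hL : IsEquiangular L θ) :
    Submodule.span ℝ (lineVectors L) = Submodule.span ℝ (⋃ l ∈ L, (l : Set E)) := by
  apply le_antisymm
  · rw [Submodule.span_le]
    intro x hx
    refine Submodule.subset_span ?_
    simp only [Set.mem_iUnion]
    exact ⟨_, hx.2, Submodule.mem_span_singleton_self x⟩
  · rw [Submodule.span_le]
    intro x hx
    simp only [Set.mem_iUnion] at hx
    obtain ⟨l, hl, hx⟩ := hx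
    obtain ⟨y, hy, rfl⟩ := hL.exists_lineVector hl
    exact Submodule.span_mono (Set.singleton_subset_iff.2 hy) hx

theorem isEquiangular_range {V : Type*} (u : V → E) (hself : ∀ v, ⟪u v, u v⟫_ℝ = 3)
    (hne : ∀ v w, v ≠ w → ⟪u v, u w⟫_ℝ = 1 ∨ ⟪u v, u w⟫_ℝ = -1) :
    IsEquiangular (Set.range fun v => Submodule.span ℝ {u v}) (Real.arccos (1 / 3)) := by
  constructor
  · rintro _ ⟨v, rfl⟩
    exact finrank_span_singleton (ne_zero_of_inner_self (by norm_num) (hself v))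
  · rintro _ ⟨v, rfl⟩ _ ⟨w, rfl⟩ hvw x hx y hy hx0 hy0
    have h := hne v w (by rintro rfl; exact hvw rfl)
    obtain ⟨a, rfl⟩ := Submodule.mem_span_singleton.1 hx
    obtain ⟨b, rfl⟩ := Submodule.mem_span_singleton.1 hy
    have ha : a ≠ 0 := by rintro rfl; simp at hx0
    have hb : b ≠ 0 := by rintro rfl; simp at hy0
    -- A scalar acts on the angle only through its sign, and a negative one exchanges the two
    -- supplementary angles.
    have key : ∀ s t : E, ⟪s, s⟫_ℝ = 3 → ⟪t, t⟫_ℝ = 3 → (⟪s, t⟫_ℝ = 1 ∨ ⟪s, t⟫_ℝ = -1) →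
        ∀ b : ℝ, b ≠ 0 → min (InnerProductGeometry.angle s (b • t))
          (Real.pi - InnerProductGeometry.angle s (b • t)) = Real.arccos (1 / 3) := by
      intro s t hs ht hst b hb
      rcases lt_or_gt_of_ne hb with hb | hb
      · rw [InnerProductGeometry.angle_smul_right_of_neg _ _ hb]
        exact min_angle_of_inner hs (by simpa using ht) (by
          rw [inner_neg_right]
          rcases hst with h | h <;> simp [h])
      · rw [InnerProductGeometry.angle_smul_right_of_pos _ _ hb]
        exact min_angle_of_inner hs ht hst
    rcases lt_or_gt_of_ne ha with ha | ha
    · rw [InnerProductGeometry.angle_smul_left_of_neg _ _ ha]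
      refine key _ _ (by simpa using hself v) (hself w) ?_ b hb
      rw [inner_neg_left]
      rcases h with h | h <;> simp [h]
    · rw [InnerProductGeometry.angle_smul_left_of_pos _ _ ha]
      exact key _ _ (hself v) (hself w) h b hb

theorem encard_range_span {V : Type*} (u : V → E) (hself : ∀ v, ⟪u v, u v⟫_ℝ = 3)
    (hne : ∀ v w, v ≠ w → ⟪u v, u w⟫_ℝ = 1 ∨ ⟪u v, u w⟫_ℝ = -1) :
    (Set.range fun v => Submodule.span ℝ {u v}).encard = ENat.card V := by
  have hinj : Function.Injective (fun v => Submodule.span ℝ {u v}) := by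
    intro v w hvw
    by_contra h
    have h1 := hne v w h
    rcases eq_or_eq_neg_of_span_eq (by norm_num) (hself v) (hself w) hvw with h | h <;>
    · rw [h] at h1
      simp only [inner_neg_right, hself] at h1
      norm_num at h1
  rw [← Set.image_univ, hinj.encard_image, Set.encard_univ]

theorem lineRank_range_span [FiniteDimensional ℝ E] {V : Type*} (u : V → E) :
    lineRank (Set.range fun v => Submodule.span ℝ {u v}) =
      Module.finrank ℝ (Submodule.span ℝ (Set.range u)) := by
  rw [lineRank_eq_finrank_span]
  refine congrArg (fun W : Submodule ℝ E => Module.finrank ℝ W) ?_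
  apply le_antisymm
  · rw [Submodule.span_le]
    intro x hx
    simp only [Set.mem_iUnion] at hx
    obtain ⟨_, ⟨v, rfl⟩, hx⟩ := hx
    exact Submodule.span_mono (Set.singleton_subset_iff.2 (Set.mem_range_self v)) hx
  · rw [Submodule.span_le]
    rintro _ ⟨v, rfl⟩
    refine Submodule.subset_span ?_
    simp only [Set.mem_iUnion]
    exact ⟨Submodule.span ℝ {u v}, Set.mem_range_self v, Submodule.mem_span_singleton_self _⟩

end Basics

/-! ### Dimension bounds for three mutually non-orthogonal classes of roots. -/

section RootTriples

variable {E : Type*} [NormedAddCommGroup E] [InnerProductSpace ℝ E]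

/-- Three sets of vectors of norm `√2` such that vectors of the same set are proportional or
orthogonal, and vectors of different sets are at 60 or 120 degrees. -/
structure IsRootTriple (Y : Fin 3 → Set E) : Prop where
  norm : ∀ i, ∀ y ∈ Y i, ⟪y, y⟫_ℝ = 2
  same : ∀ i, ∀ y ∈ Y i, ∀ z ∈ Y i, z = y ∨ z = -y ∨ ⟪y, z⟫_ℝ = 0
  diff : ∀ i j, i ≠ j → ∀ y ∈ Y i, ∀ z ∈ Y j, ⟪y, z⟫_ℝ = 1 ∨ ⟪y, z⟫_ℝ = -1

theorem finrank_span_of_orthogonal {F : Finset E} (hn : ∀ f ∈ F, ⟪f, f⟫_ℝ = 2)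
    (ho : ∀ f ∈ F, ∀ g ∈ F, f ≠ g → ⟪f, g⟫_ℝ = 0) :
    Module.finrank ℝ (Submodule.span ℝ (F : Set E)) = F.card := by
  refine finrank_span_finset_eq_card ?_
  refine linearIndependent_of_ne_zero_of_inner_eq_zero ?_ ?_
  · intro f
    exact ne_zero_of_inner_self two_ne_zero (hn f f.2)
  · intro f g hfg
    exact ho f f.2 g g.2 (fun h => hfg (Subtype.ext h))

/-- Orthogonal subfamilies are bounded in size by the dimension, so a largest one `F` exists. A
vector of `Y` outside `F ∪ -F` would be orthogonal to all of `F` and could be added to it. -/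
theorem exists_orthogonal_frame [FiniteDimensional ℝ E] {Y : Set E}
    (hn : ∀ y ∈ Y, ⟪y, y⟫_ℝ = 2)
    (hs : ∀ y ∈ Y, ∀ z ∈ Y, z = y ∨ z = -y ∨ ⟪y, z⟫_ℝ = 0) :
    ∃ F : Finset E, (F : Set E) ⊆ Y ∧ (∀ f ∈ F, ∀ g ∈ F, f ≠ g → ⟪f, g⟫_ℝ = 0) ∧
      (∀ y ∈ Y, y ∈ F ∨ -y ∈ F) ∧ Submodule.span ℝ (F : Set E) = Submodule.span ℝ Y ∧
      F.card = Module.finrank ℝ (Submodule.span ℝ Y) := by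
  classical
  set S : Set ℕ := {n | ∃ F : Finset E, (F : Set E) ⊆ Y ∧
    (∀ f ∈ F, ∀ g ∈ F, f ≠ g → ⟪f, g⟫_ℝ = 0) ∧ F.card = n} with hS
  have hb : BddAbove S := by
    refine ⟨Module.finrank ℝ E, ?_⟩
    rintro n ⟨F, hF, ho, rfl⟩
    rw [← finrank_span_of_orthogonal (fun f hf => hn f (hF hf)) ho]
    exact Submodule.finrank_le _
  have hne : S.Nonempty := ⟨0, ∅, by simp⟩
  obtain ⟨F, hF, ho, hc⟩ := Nat.sSup_mem hne hb
  have hcov : ∀ y ∈ Y, y ∈ F ∨ -y ∈ F := by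
    intro y hy
    by_contra hcon
    push Not at hcon
    have h0 : ∀ f ∈ F, ⟪f, y⟫_ℝ = 0 := by
      intro f hf
      rcases hs f (hF hf) y hy with h | h | h
      · exact absurd (h ▸ hf) hcon.1
      · exact absurd (by rw [h, neg_neg]; exact hf) hcon.2
      · exact h
    have hmem : (insert y F).card ∈ S := by
      refine ⟨insert y F, ?_, ?_, rfl⟩
      · rw [Finset.coe_insert]
        exact Set.insert_subset hy hF
      · intro f hf g hg hfg
        rcases Finset.mem_insert.1 hf with hf' | hf' <;>
          rcases Finset.mem_insert.1 hg with hg' | hg'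
        · exact absurd (hf'.trans hg'.symm) hfg
        · rw [real_inner_comm, hf']
          exact h0 g hg'
        · rw [hg']
          exact h0 f hf'
        · exact ho f hf' g hg' hfg
    have := le_csSup hb hmem
    rw [Finset.card_insert_of_notMem hcon.1] at this
    omega
  have hspan : Submodule.span ℝ (F : Set E) = Submodule.span ℝ Y := by
    refine le_antisymm (Submodule.span_mono hF) (Submodule.span_le.2 fun y hy => ?_)
    rcases hcov y hy with h | h
    · exact Submodule.subset_span h
    · rw [← neg_neg y]
      exact Submodule.neg_mem _ (Submodule.subset_span h)
  refine ⟨F, hF, ho, hcov, hspan, ?_⟩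
  rw [← hspan, finrank_span_of_orthogonal (fun f hf => hn f (hF hf)) ho]

namespace IsRootTriple

variable {Y : Fin 3 → Set E} (hY : IsRootTriple Y)
include hY

theorem encard_le [FiniteDimensional ℝ E] (i : Fin 3) :
    (Y i).encard ≤ (2 * Module.finrank ℝ (Submodule.span ℝ (Y i)) : ℕ) := by
  classical
  obtain ⟨F, -, -, hcov, -, hc⟩ := exists_orthogonal_frame (hY.norm i) (hY.same i)
  have h1 : Y i ⊆ ((F ∪ F.image (fun x => -x) : Finset E) : Set E) := by
    intro y hy
    rcases hcov y hy with h | h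
    · simp [h]
    · simp [h]
  calc (Y i).encard ≤ _ := Set.encard_le_encard h1
    _ = ((F ∪ F.image (fun x => -x)).card : ℕ∞) := Set.encard_coe_eq_coe_finsetCard _
    _ ≤ _ := by
      have := Finset.card_union_le F (F.image (fun x => -x))
      have := Finset.card_image_le (s := F) (f := fun x => -x)
      exact_mod_cast (by omega)

theorem sq_inner {i j : Fin 3} (hij : i ≠ j) {y z : E} (hy : y ∈ Y i) (hz : z ∈ Y j) :
    ⟪y, z⟫_ℝ * ⟪y, z⟫_ℝ = 1 := by
  rcases hY.diff i j hij y hy z hz with h | h <;> rw [h] <;> norm_num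

omit hY in
theorem span_le_iUnion (i : Fin 3) :
    Submodule.span ℝ (Y i) ≤ Submodule.span ℝ (⋃ k, Y k) :=
  Submodule.span_mono (Set.subset_iUnion Y i)

/-- If one of the sets spans everything and another one is nonempty, the dimension is four. -/
theorem finrank_eq_four [FiniteDimensional ℝ E] {i j : Fin 3} (hij : i ≠ j)
    (hj : (Y j).Nonempty) (h : Module.finrank ℝ (Submodule.span ℝ (Y i)) =
      Module.finrank ℝ (Submodule.span ℝ (⋃ k, Y k))) :
    Module.finrank ℝ (Submodule.span ℝ (⋃ k, Y k)) = 4 := by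
  classical
  obtain ⟨z, hz⟩ := hj
  obtain ⟨F, hF, ho, -, hs, hc⟩ := exists_orthogonal_frame (hY.norm i) (hY.same i)
  have hse := Submodule.eq_of_le_of_finrank_eq (span_le_iUnion i) h
  have hzF : z ∈ Submodule.span ℝ (F : Set E) := by
    rw [hs, hse]
    exact Submodule.subset_span (Set.mem_iUnion.2 ⟨j, hz⟩)
  -- In the orthogonal frame `z = ½ ∑ ⟪f, z⟫ f` with every `⟪f, z⟫ = ±1`. Taking norms, `2 = |F| /
  -- 2`, hence `|F| = 4`.
  have hz0 : z - (1 / 2 : ℝ) • ∑ f ∈ F, ⟪f, z⟫_ℝ • f = 0 := by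
    refine eq_zero_of_mem_span_of_inner_eq_zero (S := (F : Set E)) ?_ ?_
    · refine Submodule.sub_mem _ hzF (Submodule.smul_mem _ _ (Submodule.sum_mem _ ?_))
      exact fun f hf => Submodule.smul_mem _ _ (Submodule.subset_span hf)
    · intro g hg
      rw [inner_sub_right, real_inner_smul_right, inner_sum, Finset.sum_eq_single g]
      · rw [real_inner_smul_right, hY.norm i g (hF hg)]
        ring
      · intro f hf hfg
        rw [real_inner_smul_right, ho g hg f hf hfg.symm, mul_zero]
      · exact fun h => absurd hg h
  have h2 : ⟪z, z⟫_ℝ = 2 := hY.norm j z hz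
  rw [sub_eq_zero] at hz0
  conv_lhs at h2 => rw [hz0]
  rw [real_inner_smul_left, sum_inner] at h2
  simp only [real_inner_smul_left] at h2
  rw [← hz0, Finset.sum_congr rfl (fun f hf => hY.sq_inner hij (hF hf) hz)] at h2
  simp only [Finset.sum_const, nsmul_eq_mul, mul_one] at h2
  have h3 : (F.card : ℝ) = 4 := by linarith
  rw [← h, ← hc]
  exact_mod_cast h3

end IsRootTriple

theorem exists_mem_span_of_parallel {A : Set E} (h : ∀ x ∈ A, ∀ y ∈ A, y = x ∨ y = -x) :
    ∃ a, ∀ x ∈ A, x ∈ Submodule.span ℝ {a} := by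
  rcases Set.eq_empty_or_nonempty A with rfl | ⟨a, ha⟩
  · exact ⟨0, by simp⟩
  · refine ⟨a, fun x hx => ?_⟩
    rcases h a ha x hx with rfl | rfl
    · exact Submodule.mem_span_singleton_self _
    · exact Submodule.neg_mem _ (Submodule.mem_span_singleton_self _)

theorem finrank_le_four_of_subset {S : Set E} {a b c d : E}
    (h : ∀ x ∈ S, x ∈ Submodule.span ℝ ({a, b, c, d} : Set E)) :
    Module.finrank ℝ (Submodule.span ℝ S) ≤ 4 := by
  classical
  have h1 : Submodule.span ℝ S ≤ Submodule.span ℝ (({a, b, c, d} : Finset E) : Set E) := by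
    rw [Submodule.span_le]
    intro x hx
    simpa using h x hx
  exact (Submodule.finrank_mono h1).trans
    ((finrank_span_finset_le_card _).trans (Finset.card_le_four))

namespace IsRootTriple

variable {Y : Fin 3 → Set E} (hY : IsRootTriple Y)
include hY

/-- Project away from `y₁, y₂, y₃`. A vector outside `Y i` keeps squared norm `2 - 3/2 = 1/2`. Two
such vectors had an integral inner product, from which half an odd integer is subtracted, so by
Cauchy–Schwarz the result is `±1/2` and the projections are parallel. The projections of `Y i` also
lie on this line, so one dimension is added to three. -/
theorem finrank_le_four_of_three {i j : Fin 3} (hij : i ≠ j) {y₁ y₂ y₃ z : E}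
    (h₁ : y₁ ∈ Y i) (h₂ : y₂ ∈ Y i) (h₃ : y₃ ∈ Y i) (hz : z ∈ Y j)
    (h₁₂ : ⟪y₁, y₂⟫_ℝ = 0) (h₁₃ : ⟪y₁, y₃⟫_ℝ = 0) (h₂₃ : ⟪y₂, y₃⟫_ℝ = 0) :
    Module.finrank ℝ (Submodule.span ℝ (⋃ k, Y k)) ≤ 4 := by
  set π : E → E := fun x => x - (1 / 2 : ℝ) • (⟪y₁, x⟫_ℝ • y₁ + ⟪y₂, x⟫_ℝ • y₂ + ⟪y₃, x⟫_ℝ • y₃)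
    with hπ
  have h₂₁ : ⟪y₂, y₁⟫_ℝ = 0 := by rw [real_inner_comm, h₁₂]
  have h₃₁ : ⟪y₃, y₁⟫_ℝ = 0 := by rw [real_inner_comm, h₁₃]
  have h₃₂ : ⟪y₃, y₂⟫_ℝ = 0 := by rw [real_inner_comm, h₂₃]
  have n₁ := hY.norm i _ h₁
  have n₂ := hY.norm i _ h₂
  have n₃ := hY.norm i _ h₃
  have hπi : ∀ x x', ⟪π x, π x'⟫_ℝ = ⟪x, x'⟫_ℝ - (1 / 2) * (⟪y₁, x⟫_ℝ * ⟪y₁, x'⟫_ℝ +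
      ⟪y₂, x⟫_ℝ * ⟪y₂, x'⟫_ℝ + ⟪y₃, x⟫_ℝ * ⟪y₃, x'⟫_ℝ) := by
    intro x x'
    simp only [hπ, inner_sub_left, inner_sub_right, real_inner_smul_left, real_inner_smul_right,
      inner_add_left, inner_add_right, h₁₂, h₁₃, h₂₃, h₂₁, h₃₁, h₃₂, n₁, n₂, n₃,
      real_inner_comm y₁ x, real_inner_comm y₂ x, real_inner_comm y₃ x]
    ring
  have hz2 : ⟪π z, π z⟫_ℝ = 1 / 2 := by
    rw [hπi, hY.norm j z hz, hY.sq_inner hij h₁ hz, hY.sq_inner hij h₂ hz, hY.sq_inner hij h₃ hz]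
    norm_num
  have key : ∀ x ∈ ⋃ k, Y k, π x ∈ Submodule.span ℝ {π z} := by
    intro x hx
    obtain ⟨k, hx⟩ := Set.mem_iUnion.1 hx
    by_cases hk : k = i
    · subst hk
      by_cases h0 : ⟪y₁, x⟫_ℝ = 0 ∧ ⟪y₂, x⟫_ℝ = 0 ∧ ⟪y₃, x⟫_ℝ = 0
      · have hx2 : ⟪π x, π x⟫_ℝ = 2 := by
          rw [hπi, h0.1, h0.2.1, h0.2.2, hY.norm k x hx]
          norm_num
        have hxz : ⟪π z, π x⟫_ℝ = ⟪x, z⟫_ℝ := by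
          rw [hπi, h0.1, h0.2.1, h0.2.2, real_inner_comm]
          norm_num
        -- A vector of `Y i` orthogonal to all three is unchanged by the projection and has inner
        -- product `±1` with `π z`. Since `2 π z` has the same squared norm 2, it must be `±2 π z`.
        have h4 : ⟪(2 : ℝ) • π z, (2 : ℝ) • π z⟫_ℝ = 2 := by
          rw [real_inner_smul_left, real_inner_smul_right, hz2]
          norm_num
        rcases hY.diff k j hij x hx z hz with h | h
        · rw [eq_of_inner_eq h4 hx2 (by rw [real_inner_smul_left, hxz, h, mul_one])]
          exact Submodule.smul_mem _ _ (Submodule.mem_span_singleton_self _)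
        · rw [eq_neg_of_inner_eq h4 hx2 (by rw [real_inner_smul_left, hxz, h]; ring)]
          exact Submodule.neg_mem _ (Submodule.smul_mem _ _ (Submodule.mem_span_singleton_self _))
      -- A vector of `Y i` not orthogonal to one of the three is that vector or its negative.
      · have : π x = 0 := by
          have hx₁ := hY.same k _ h₁ x hx
          have hx₂ := hY.same k _ h₂ x hx
          have hx₃ := hY.same k _ h₃ x hx
          have hself : ⟪π x, π x⟫_ℝ = 0 := by
            rw [hπi, hY.norm k x hx]
            rcases hx₁ with rfl | rfl | hx₁
            · simp only [h₂₁, h₃₁, n₁]; norm_num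
            · simp only [inner_neg_right, h₂₁, h₃₁, n₁]; norm_num
            rcases hx₂ with rfl | rfl | hx₂
            · simp only [h₁₂, h₃₂, n₂]; norm_num
            · simp only [inner_neg_right, h₁₂, h₃₂, n₂]; norm_num
            rcases hx₃ with rfl | rfl | hx₃
            · simp only [h₁₃, h₂₃, n₃]; norm_num
            · simp only [inner_neg_right, h₁₃, h₂₃, n₃]; norm_num
            exact absurd ⟨hx₁, hx₂, hx₃⟩ h0
          exact inner_self_eq_zero.1 hself
        rw [this]
        exact Submodule.zero_mem _
    · have hx2 : ⟪π x, π x⟫_ℝ = 1 / 2 := by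
        rw [hπi, hY.norm k x hx, hY.sq_inner (Ne.symm hk) h₁ hx, hY.sq_inner (Ne.symm hk) h₂ hx,
          hY.sq_inner (Ne.symm hk) h₃ hx]
        norm_num
      have hb := abs_inner_le_of_inner_self hz2 hx2
      have hzx := hπi z x
      have hm : ∀ y ∈ Y i, ⟪y, z⟫_ℝ * ⟪y, x⟫_ℝ = 1 ∨ ⟪y, z⟫_ℝ * ⟪y, x⟫_ℝ = -1 := by
        intro y hy
        rcases hY.diff i j hij y hy z hz with h | h <;>
          rcases hY.diff i k (Ne.symm hk) y hy x hx with h' | h' <;> rw [h, h'] <;> norm_num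
      have hc : ⟪z, x⟫_ℝ = 2 ∨ ⟪z, x⟫_ℝ = -2 ∨ ⟪z, x⟫_ℝ = 0 ∨ ⟪z, x⟫_ℝ = 1 ∨ ⟪z, x⟫_ℝ = -1 := by
        by_cases hjk : j = k
        · subst hjk
          rcases hY.same j z hz x hx with rfl | rfl | h
          · exact Or.inl (hY.norm j _ hz)
          · rw [inner_neg_right, hY.norm j _ hz]
            simp
          · simp [h]
        · have := hY.diff j k hjk z hz x hx
          tauto
      have hv : ⟪π z, π x⟫_ℝ = 1 / 2 ∨ ⟪π z, π x⟫_ℝ = -(1 / 2) := by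
        -- The inner product of the projections is an integer minus half a sum of three signs. The
        -- bounds `hb` leave only `±1/2`.
        rcases hm _ h₁ with h₁ | h₁ <;> rcases hm _ h₂ with h₂ | h₂ <;>
          rcases hm _ h₃ with h₃ | h₃ <;> rw [h₁, h₂, h₃] at hzx <;>
          rcases hc with h | h | h | h | h <;> rw [h] at hzx <;>
          first
            | (left; linarith)
            | (right; linarith)
      rcases hv with h | h
      · rw [eq_of_inner_eq hz2 hx2 h]
        exact Submodule.mem_span_singleton_self _
      · rw [eq_neg_of_inner_eq hz2 hx2 h]
        exact Submodule.neg_mem _ (Submodule.mem_span_singleton_self _)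
  refine finrank_le_four_of_subset (a := y₁) (b := y₂) (c := y₃) (d := π z) ?_
  intro x hx
  have hx' : x = π x + (1 / 2 : ℝ) • (⟪y₁, x⟫_ℝ • y₁ + ⟪y₂, x⟫_ℝ • y₂ + ⟪y₃, x⟫_ℝ • y₃) := by
    simp [hπ]
  have hS : ∀ y ∈ ({y₁, y₂, y₃, π z} : Set E),
      y ∈ Submodule.span ℝ ({y₁, y₂, y₃, π z} : Set E) := fun y hy => Submodule.subset_span hy
  rw [hx']
  refine Submodule.add_mem _ (Submodule.span_mono (by simp) (key x hx)) (Submodule.smul_mem _ _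
    (Submodule.add_mem _ (Submodule.add_mem _ ?_ ?_) ?_))
  · exact Submodule.smul_mem _ _ (hS _ (by simp))
  · exact Submodule.smul_mem _ _ (hS _ (by simp))
  · exact Submodule.smul_mem _ _ (hS _ (by simp))

/-- Project away from `y₁, y₂`. Vectors of `Y j` and `Y k` keep squared norm 1, and each carries the
sign `c = ⟪y₁, x⟫ ⟪y₂, x⟫`. Projections are parallel for equal signs within one set and for opposite
signs across the two sets. So they all lie on two lines, which together with `y₁, y₂` give dimension
at most four. -/
theorem finrank_le_four_of_two {i j k : Fin 3} (hij : i ≠ j) (hik : i ≠ k) (hjk : j ≠ k)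
    {y₁ y₂ : E} (h₁ : y₁ ∈ Y i) (h₂ : y₂ ∈ Y i) (h₁₂ : ⟪y₁, y₂⟫_ℝ = 0)
    (hspan : Y i ⊆ Submodule.span ℝ {y₁, y₂}) :
    Module.finrank ℝ (Submodule.span ℝ (⋃ k, Y k)) ≤ 4 := by
  set π : E → E := fun x => x - (1 / 2 : ℝ) • (⟪y₁, x⟫_ℝ • y₁ + ⟪y₂, x⟫_ℝ • y₂) with hπ
  have h₂₁ : ⟪y₂, y₁⟫_ℝ = 0 := by rw [real_inner_comm, h₁₂]
  have n₁ := hY.norm i _ h₁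
  have n₂ := hY.norm i _ h₂
  have hπi : ∀ x x', ⟪π x, π x'⟫_ℝ = ⟪x, x'⟫_ℝ - (1 / 2) * (⟪y₁, x⟫_ℝ * ⟪y₁, x'⟫_ℝ +
      ⟪y₂, x⟫_ℝ * ⟪y₂, x'⟫_ℝ) := by
    intro x x'
    simp only [hπ, inner_sub_left, inner_sub_right, real_inner_smul_left, real_inner_smul_right,
      inner_add_left, inner_add_right, h₁₂, h₂₁, n₁, n₂,
      real_inner_comm y₁ x, real_inner_comm y₂ x]
    ring
  have hpar : ∀ c : ℝ, ∃ a, ∀ x, (x ∈ Y j ∧ ⟪y₁, x⟫_ℝ * ⟪y₂, x⟫_ℝ = c) ∨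
      (x ∈ Y k ∧ ⟪y₁, x⟫_ℝ * ⟪y₂, x⟫_ℝ = -c) → π x ∈ Submodule.span ℝ {a} := by
    intro c
    have hnorm : ∀ m, i ≠ m → ∀ x ∈ Y m, ⟪π x, π x⟫_ℝ = 1 := by
      intro m hm x hx
      rw [hπi, hY.norm m x hx, hY.sq_inner hm h₁ hx, hY.sq_inner hm h₂ hx]
      norm_num
    have hpm : ∀ m, i ≠ m → ∀ x ∈ Y m, ∀ m', i ≠ m' → ∀ x' ∈ Y m',
        (⟪π x, π x'⟫_ℝ = 1 ∨ ⟪π x, π x'⟫_ℝ = -1) → π x' = π x ∨ π x' = -π x := by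
      intro m hm x hx m' hm' x' hx' h
      exact h.imp (eq_of_inner_eq (hnorm m hm x hx) (hnorm m' hm' x' hx'))
        (eq_neg_of_inner_eq (hnorm m hm x hx) (hnorm m' hm' x' hx'))
    have hsame : ∀ m, i ≠ m → ∀ x ∈ Y m, ∀ x' ∈ Y m,
        ⟪y₁, x⟫_ℝ * ⟪y₂, x⟫_ℝ = ⟪y₁, x'⟫_ℝ * ⟪y₂, x'⟫_ℝ → π x' = π x ∨ π x' = -π x := by
      intro m hm x hx x' hx' hc
      refine hpm m hm x hx m hm x' hx' ?_
      have hb := abs_inner_le_of_inner_self (hnorm m hm x hx) (hnorm m hm x' hx')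
      have hxx := hπi x x'
      rcases hY.same m x hx x' hx' with rfl | rfl | h
      · exact Or.inl (hnorm m hm _ hx)
      · rw [inner_neg_right, inner_neg_right, inner_neg_right, hY.norm m x hx] at hxx
        have e₁ := hY.sq_inner hm h₁ hx
        have e₂ := hY.sq_inner hm h₂ hx
        right
        linarith
      -- For orthogonal `x, x'` with equal signs, the two terms removed by the projection agree and
      -- add up to `±2`. Half of this is the inner product up to sign.
      · rw [h] at hxx
        rcases hY.diff i m hm y₁ h₁ x hx with a₁ | a₁ <;>
          rcases hY.diff i m hm y₂ h₂ x hx with a₂ | a₂ <;>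
          rcases hY.diff i m hm y₁ h₁ x' hx' with b₁ | b₁ <;>
          rcases hY.diff i m hm y₂ h₂ x' hx' with b₂ | b₂ <;>
          rw [a₁, a₂, b₁, b₂] at hc <;> rw [a₁, a₂, b₁, b₂] at hxx <;>
          first
            | (left; linarith)
            | (right; linarith)
    have hdiff : ∀ m, i ≠ m → ∀ x ∈ Y m, ∀ m', i ≠ m' → m ≠ m' → ∀ x' ∈ Y m',
        ⟪y₁, x⟫_ℝ * ⟪y₂, x⟫_ℝ = -(⟪y₁, x'⟫_ℝ * ⟪y₂, x'⟫_ℝ) → π x' = π x ∨ π x' = -π x := by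
      intro m hm x hx m' hm' hmm x' hx' hc
      refine hpm m hm x hx m' hm' x' hx' ?_
      have hxx := hπi x x'
      have h := hY.diff m m' hmm x hx x' hx'
      -- With opposite signs the two terms removed by the projection cancel, so the inner product
      -- remains `±1`.
      have h0 : ⟪y₁, x⟫_ℝ * ⟪y₁, x'⟫_ℝ + ⟪y₂, x⟫_ℝ * ⟪y₂, x'⟫_ℝ = 0 := by
        rcases hY.diff i m hm y₁ h₁ x hx with a₁ | a₁ <;>
          rcases hY.diff i m hm y₂ h₂ x hx with a₂ | a₂ <;>
          rcases hY.diff i m' hm' y₁ h₁ x' hx' with b₁ | b₁ <;>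
          rcases hY.diff i m' hm' y₂ h₂ x' hx' with b₂ | b₂ <;>
          rw [a₁, a₂, b₁, b₂] at hc ⊢ <;> linarith
      rw [h0, mul_zero, sub_zero] at hxx
      rwa [hxx]
    obtain ⟨a, ha⟩ := exists_mem_span_of_parallel
      (A := π '' {x | (x ∈ Y j ∧ ⟪y₁, x⟫_ℝ * ⟪y₂, x⟫_ℝ = c) ∨
        (x ∈ Y k ∧ ⟪y₁, x⟫_ℝ * ⟪y₂, x⟫_ℝ = -c)}) (by
      rintro _ ⟨x, hx | hx, rfl⟩ _ ⟨x', hx' | hx', rfl⟩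
      · exact hsame j hij x hx.1 x' hx'.1 (hx.2.trans hx'.2.symm)
      · exact hdiff j hij x hx.1 k hik hjk x' hx'.1 (by rw [hx.2, hx'.2, neg_neg])
      · exact hdiff k hik x hx.1 j hij hjk.symm x' hx'.1 (by rw [hx.2, hx'.2])
      · exact hsame k hik x hx.1 x' hx'.1 (hx.2.trans hx'.2.symm))
    exact ⟨a, fun x hx => ha _ ⟨x, hx, rfl⟩⟩
  obtain ⟨a, ha⟩ := hpar 1
  obtain ⟨b, hb⟩ := hpar (-1)
  refine finrank_le_four_of_subset (a := y₁) (b := y₂) (c := a) (d := b) ?_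
  intro x hx
  obtain ⟨m, hx⟩ := Set.mem_iUnion.1 hx
  by_cases hm : i = m
  · subst hm
    refine Submodule.span_mono ?_ (hspan hx)
    intro y hy
    rcases hy with rfl | rfl <;> simp
  have hx' : x = π x + (1 / 2 : ℝ) • (⟪y₁, x⟫_ℝ • y₁ + ⟪y₂, x⟫_ℝ • y₂) := by
    simp [hπ]
  have hS : ∀ y ∈ ({y₁, y₂, a, b} : Set E),
      y ∈ Submodule.span ℝ ({y₁, y₂, a, b} : Set E) := fun y hy => Submodule.subset_span hy
  have hm' : m = j ∨ m = k := by omega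
  have ht : ⟪y₁, x⟫_ℝ * ⟪y₂, x⟫_ℝ = 1 ∨ ⟪y₁, x⟫_ℝ * ⟪y₂, x⟫_ℝ = -1 := by
    rcases hY.diff i m hm y₁ h₁ x hx with a₁ | a₁ <;>
      rcases hY.diff i m hm y₂ h₂ x hx with a₂ | a₂ <;> rw [a₁, a₂] <;> norm_num
  have key : π x ∈ Submodule.span ℝ ({y₁, y₂, a, b} : Set E) := by
    have hA : Submodule.span ℝ {a} ≤ Submodule.span ℝ ({y₁, y₂, a, b} : Set E) :=
      Submodule.span_mono (by simp)
    have hB : Submodule.span ℝ {b} ≤ Submodule.span ℝ ({y₁, y₂, a, b} : Set E) :=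
      Submodule.span_mono (by simp)
    rcases hm' with rfl | rfl <;> rcases ht with h | h
    · exact hA (ha x (Or.inl ⟨hx, h⟩))
    · exact hB (hb x (Or.inl ⟨hx, h⟩))
    · exact hB (hb x (Or.inr ⟨hx, by rw [h, neg_neg]⟩))
    · exact hA (ha x (Or.inr ⟨hx, h⟩))
  rw [hx']
  refine Submodule.add_mem _ key (Submodule.smul_mem _ _ (Submodule.add_mem _ ?_ ?_))
  · exact Submodule.smul_mem _ _ (hS _ (by simp))
  · exact Submodule.smul_mem _ _ (hS _ (by simp))

/-- A set containing three orthogonal vectors, or spanning exactly a plane, is handled by the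
projection arguments. If every set spans at most a line, the total dimension is at most three. -/
theorem finrank_le_four [FiniteDimensional ℝ E] {i j : Fin 3} (hij : i ≠ j)
    (hi : (Y i).Nonempty) (hj : (Y j).Nonempty) :
    Module.finrank ℝ (Submodule.span ℝ (⋃ k, Y k)) ≤ 4 := by
  classical
  have hother : ∀ k : Fin 3, ∃ m, k ≠ m ∧ (Y m).Nonempty := by
    intro k
    by_cases h : k = i
    · exact ⟨j, h ▸ hij, hj⟩
    · exact ⟨i, h, hi⟩
  by_cases h : ∃ k, 2 ≤ Module.finrank ℝ (Submodule.span ℝ (Y k))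
  · obtain ⟨k, hk⟩ := h
    obtain ⟨F, hF, ho, hcov, hs, hc⟩ := exists_orthogonal_frame (hY.norm k) (hY.same k)
    rcases hk.lt_or_eq with hk | hk
    · rw [← hc] at hk
      obtain ⟨y₁, y₂, y₃, h₁, h₂, h₃, h₁₂, h₁₃, h₂₃⟩ := Finset.two_lt_card_iff.1 hk
      obtain ⟨m, hm, z, hz⟩ := hother k
      exact hY.finrank_le_four_of_three hm (hF h₁) (hF h₂) (hF h₃) hz (ho _ h₁ _ h₂ h₁₂)
        (ho _ h₁ _ h₃ h₁₃) (ho _ h₂ _ h₃ h₂₃)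
    · obtain ⟨y₁, y₂, h₁₂, rfl⟩ := Finset.card_eq_two.1 (hc.trans hk.symm)
      have h₁ : y₁ ∈ Y k := hF (by simp)
      have h₂ : y₂ ∈ Y k := hF (by simp)
      have h0 : ⟪y₁, y₂⟫_ℝ = 0 := ho _ (by simp) _ (by simp) h₁₂
      have hsub : Y k ⊆ Submodule.span ℝ {y₁, y₂} := by
        intro y hy
        have : y ∈ Submodule.span ℝ (Y k) := Submodule.subset_span hy
        rw [← hs] at this
        simpa using this
      have hex : ∀ k : Fin 3, ∃ a b : Fin 3, k ≠ a ∧ k ≠ b ∧ a ≠ b := by decide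
      obtain ⟨a, b, hka, hkb, hab⟩ := hex k
      exact hY.finrank_le_four_of_two hka hkb hab h₁ h₂ h0 hsub
  · push Not at h
    have h0 := h 0
    have h1 := h 1
    have h2 := h 2
    have : Submodule.span ℝ (⋃ k, Y k) = Submodule.span ℝ (Y 0) ⊔ Submodule.span ℝ (Y 1) ⊔
        Submodule.span ℝ (Y 2) := by
      rw [← Submodule.span_union, ← Submodule.span_union]
      congr 1
      ext x
      simp [Fin.exists_fin_succ, or_assoc]
    rw [this]
    have h3 := Submodule.finrank_add_le_finrank_add_finrank
      (Submodule.span ℝ (Y 0) ⊔ Submodule.span ℝ (Y 1)) (Submodule.span ℝ (Y 2))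
    have h4 := Submodule.finrank_add_le_finrank_add_finrank
      (Submodule.span ℝ (Y 0)) (Submodule.span ℝ (Y 1))
    omega

/-- Either only one of the sets is nonempty, or the dimension is at most four and every set
spans a space of small dimension. -/
theorem dichotomy [FiniteDimensional ℝ E] {s : ℕ}
    (hs : Module.finrank ℝ (Submodule.span ℝ (⋃ k, Y k)) = s) :
    (∃ i, Module.finrank ℝ (Submodule.span ℝ (Y i)) = s ∧ ∀ j, j ≠ i → Y j = ∅) ∨
    (s = 2 ∧ ∀ i, Module.finrank ℝ (Submodule.span ℝ (Y i)) ≤ 1) ∨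
    (s = 3 ∧ ∀ i, Module.finrank ℝ (Submodule.span ℝ (Y i)) ≤ 2) ∨
    (s = 4 ∧ ∀ i, Module.finrank ℝ (Submodule.span ℝ (Y i)) ≤ 4) := by
  by_cases h : ∃ i j, i ≠ j ∧ (Y i).Nonempty ∧ (Y j).Nonempty
  · right
    obtain ⟨i, j, hij, hi, hj⟩ := h
    have h4 := hY.finrank_le_four hij hi hj
    have hle : ∀ k, Module.finrank ℝ (Submodule.span ℝ (Y k)) ≤ s := fun k =>
      hs ▸ Submodule.finrank_mono (span_le_iUnion k)
    -- A set spans the whole space only in dimension four. Below that every set loses a dimension,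
    -- which gives the bounds 1 and 2 and also rules out `s = 1`.
    have heq : ∀ k, Module.finrank ℝ (Submodule.span ℝ (Y k)) = s → s = 4 := by
      intro k hk
      have : ∃ m, k ≠ m ∧ (Y m).Nonempty := by
        by_cases h : k = i
        · exact ⟨j, h ▸ hij, hj⟩
        · exact ⟨i, h, hi⟩
      obtain ⟨m, hm, hne⟩ := this
      rw [← hs]
      exact hY.finrank_eq_four hm hne (hk.trans hs.symm)
    have hpos : 1 ≤ Module.finrank ℝ (Submodule.span ℝ (Y i)) := by
      obtain ⟨y, hy⟩ := hi
      rw [Nat.one_le_iff_ne_zero, Ne, Submodule.finrank_eq_zero, Submodule.span_eq_bot]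
      exact fun h0 => ne_zero_of_inner_self two_ne_zero (hY.norm i y hy) (h0 y hy)
    have h1 := hle i
    have h2 := heq i
    rw [hs] at h4
    have : s = 2 ∨ s = 3 ∨ s = 4 := by omega
    rcases this with h | h | h
    · refine Or.inl ⟨h, fun k => ?_⟩
      have := hle k
      have := heq k
      omega
    · refine Or.inr (Or.inl ⟨h, fun k => ?_⟩)
      have := hle k
      have := heq k
      omega
    · exact Or.inr (Or.inr ⟨h, fun k => h ▸ hle k⟩)
  · left
    push Not at h
    have : ∃ i, ∀ j, j ≠ i → Y j = ∅ := by
      by_cases h0 : ∃ i, (Y i).Nonempty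
      · obtain ⟨i, hi⟩ := h0
        exact ⟨i, fun j hj => h i j hj.symm hi⟩
      · push Not at h0
        exact ⟨0, fun j _ => h0 j⟩
    obtain ⟨i, hi⟩ := this
    refine ⟨i, ?_, hi⟩
    have hU : ⋃ k, Y k = Y i := by
      refine Set.Subset.antisymm (Set.iUnion_subset fun k => ?_) (Set.subset_iUnion Y i)
      by_cases hk : k = i
      · rw [hk]
      · rw [hi k hk]
        exact Set.empty_subset _
    rw [← hs, hU]

end IsRootTriple

end RootTriples

/-! ### Extremal root triples: the systems `A₂`, `D₃` and `D₄`. -/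

section RootTripleStructure

variable {E : Type*} [NormedAddCommGroup E] [InnerProductSpace ℝ E]

/-- The four vectors `±a±b`. -/
def signedSums (a b : E) : Set E := {a + b, a - b, -a + b, -a - b}

omit [InnerProductSpace ℝ E] in
theorem encard_signedSums_le (a b : E) : (signedSums a b).encard ≤ 4 := by
  classical
  have : signedSums a b = (({a + b, a - b, -a + b, -a - b} : Finset E) : Set E) := by
    simp [signedSums]
  rw [this, Set.encard_coe_eq_coe_finsetCard]
  exact_mod_cast Finset.card_le_four

omit [InnerProductSpace ℝ E] in
theorem finite_signedSums (a b : E) : (signedSums a b).Finite := by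
  simp [signedSums]

theorem inner_signedSums_of_common {a b c : E} (ha : ⟪a, a⟫_ℝ = 1) (hab : ⟪a, b⟫_ℝ = 0)
    (hac : ⟪a, c⟫_ℝ = 0) (hbc : ⟪b, c⟫_ℝ = 0) {x y : E} (hx : x ∈ signedSums a b)
    (hy : y ∈ signedSums a c) : ⟪x, y⟫_ℝ = 1 ∨ ⟪x, y⟫_ℝ = -1 := by
  have hba : ⟪b, a⟫_ℝ = 0 := by rw [real_inner_comm, hab]
  simp only [signedSums, Set.mem_insert_iff, Set.mem_singleton_iff] at hx hy
  rcases hx with rfl | rfl | rfl | rfl <;> rcases hy with rfl | rfl | rfl | rfl <;>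
    simp only [inner_add_left, inner_add_right, inner_sub_left, inner_sub_right,
      inner_neg_left, inner_neg_right, ha, hba, hac, hbc] <;> norm_num

omit [InnerProductSpace ℝ E] in
theorem signedSums_comm (a b : E) : signedSums a b = signedSums b a := by
  ext x
  simp only [signedSums, Set.mem_insert_iff, Set.mem_singleton_iff]
  rw [show b + a = a + b by abel, show b - a = -a + b by abel, show -b + a = a - b by abel,
    show -b - a = -a - b by abel]
  tauto

/-- The values are `0` and `±2`. Excluding `±1` keeps vectors of different classes out of the same
coordinate pair. -/
theorem inner_signedSums_self {a b : E} (ha : ⟪a, a⟫_ℝ = 1) (hb : ⟪b, b⟫_ℝ = 1)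
    (hab : ⟪a, b⟫_ℝ = 0) {x y : E} (hx : x ∈ signedSums a b)
    (hy : y ∈ signedSums a b) : ⟪x, y⟫_ℝ ≠ 1 ∧ ⟪x, y⟫_ℝ ≠ -1 := by
  have hba : ⟪b, a⟫_ℝ = 0 := by rw [real_inner_comm, hab]
  simp only [signedSums, Set.mem_insert_iff, Set.mem_singleton_iff] at hx hy
  rcases hx with rfl | rfl | rfl | rfl <;> rcases hy with rfl | rfl | rfl | rfl <;>
    simp only [inner_add_left, inner_add_right, inner_sub_left, inner_sub_right,
      inner_neg_left, inner_neg_right, ha, hb, hba, hab] <;> norm_num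

theorem inner_signedSums_disjoint {a b c d : E} (hac : ⟪a, c⟫_ℝ = 0)
    (had : ⟪a, d⟫_ℝ = 0) (hbc : ⟪b, c⟫_ℝ = 0) (hbd : ⟪b, d⟫_ℝ = 0) {x y : E}
    (hx : x ∈ signedSums a b) (hy : y ∈ signedSums c d) : ⟪x, y⟫_ℝ = 0 := by
  simp only [signedSums, Set.mem_insert_iff, Set.mem_singleton_iff] at hx hy
  rcases hx with rfl | rfl | rfl | rfl <;> rcases hy with rfl | rfl | rfl | rfl <;>
    simp only [inner_add_left, inner_add_right, inner_sub_left, inner_sub_right,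
      inner_neg_left, inner_neg_right, hac, had, hbc, hbd] <;> norm_num

omit [InnerProductSpace ℝ E] in
theorem signedSums_subset {Y : Set E} {a b : E} (h₁ : a + b ∈ Y) (h₂ : a - b ∈ Y)
    (h₃ : -(a + b) ∈ Y) (h₄ : -(a - b) ∈ Y) : signedSums a b ⊆ Y := by
  intro x hx
  simp only [signedSums, Set.mem_insert_iff, Set.mem_singleton_iff] at hx
  rcases hx with rfl | rfl | rfl | rfl
  · exact h₁
  · exact h₂
  · rwa [show -a + b = -(a - b) by abel]
  · rwa [show -a - b = -(a + b) by abel]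

/-- Expansion in an orthonormal family of maximal size in a subspace. -/
theorem eq_sum_inner_smul {n : ℕ} {v : Fin n → E} (hv : Orthonormal ℝ v) {W : Submodule ℝ E}
    [FiniteDimensional ℝ W] (hW : ∀ i, v i ∈ W) (hn : Module.finrank ℝ W = n) {x : E}
    (hx : x ∈ W) : x = ∑ i, ⟪v i, x⟫_ℝ • v i := by
  have hs : Submodule.span ℝ (Set.range v) = W := by
    refine Submodule.eq_of_le_of_finrank_eq (Submodule.span_le.2 ?_) ?_
    · rintro _ ⟨i, rfl⟩
      exact hW i
    · rw [finrank_span_eq_card hv.linearIndependent, hn, Fintype.card_fin]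
  rw [← sub_eq_zero]
  refine eq_zero_of_mem_span_of_inner_eq_zero (S := Set.range v) ?_ ?_
  · rw [hs]
    exact Submodule.sub_mem _ hx (Submodule.sum_mem _ fun i _ => Submodule.smul_mem _ _ (hW i))
  · rintro _ ⟨i, rfl⟩
    rw [inner_sub_right, hv.inner_right_fintype, sub_self]

/-- To be applied to the inner products `p, q` of a root with two orthogonal roots: its coordinates
along their half-sum and half-difference are then `0` and `±1` in some order. -/
theorem half_sum_diff_cases {p q : ℝ} (hp : p = 1 ∨ p = -1) (hq : q = 1 ∨ q = -1) :
    (((p + q) / 2 = 1 ∨ (p + q) / 2 = -1) ∧ (p - q) / 2 = 0) ∨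
    ((p + q) / 2 = 0 ∧ ((p - q) / 2 = 1 ∨ (p - q) / 2 = -1)) := by
  rcases hp with rfl | rfl <;> rcases hq with rfl | rfl <;> norm_num

theorem smul_add_smul_mem_signedSums {a b : E} {c d : ℝ} (hc : c = 1 ∨ c = -1)
    (hd : d = 1 ∨ d = -1) : c • a + d • b ∈ signedSums a b := by
  simp only [signedSums, Set.mem_insert_iff, Set.mem_singleton_iff]
  rcases hc with rfl | rfl <;> rcases hd with rfl | rfl <;>
    simp [sub_eq_add_neg]

namespace IsRootTriple

variable {Y : Fin 3 → Set E} (hY : IsRootTriple Y)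
include hY

/-- If `Y i` is as large as possible, it consists of the vectors of an orthogonal frame and of
their opposites. -/
theorem exists_frame_of_encard [FiniteDimensional ℝ E] {i : Fin 3} {n : ℕ}
    (hn : Module.finrank ℝ (Submodule.span ℝ (Y i)) ≤ n) (hc : (Y i).encard = (2 * n : ℕ)) :
    ∃ F : Finset E, F.card = n ∧ (∀ f ∈ F, f ∈ Y i) ∧ (∀ y ∈ Y i, -y ∈ Y i) ∧
      (∀ f ∈ F, ∀ g ∈ F, f ≠ g → ⟪f, g⟫_ℝ = 0) := by
  classical
  obtain ⟨F, hF, ho, hcov, hs, hcF⟩ := exists_orthogonal_frame (hY.norm i) (hY.same i)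
  have hle := hY.encard_le i
  rw [hc] at hle
  have hle' : 2 * n ≤ 2 * Module.finrank ℝ (Submodule.span ℝ (Y i)) := by exact_mod_cast hle
  have hn' : F.card = n := by omega
  set F' : Finset E := F ∪ F.image (fun x => -x) with hF'
  have h1 : Y i ⊆ (F' : Set E) := by
    intro y hy
    rcases hcov y hy with h | h
    · simp [hF', h]
    · simp [hF', h]
  -- `Y i` has `2n` elements and lies in `F ∪ -F`, which has at most `2n`. Equality makes `Y i`
  -- closed under negation.
  have h2 : Y i = (F' : Set E) := by
    refine Set.Finite.eq_of_subset_of_encard_le (F'.finite_toSet.subset h1) h1 ?_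
    rw [Set.encard_coe_eq_coe_finsetCard, hc, hF']
    have := Finset.card_union_le F (F.image (fun x => -x))
    have := Finset.card_image_le (s := F) (f := fun x => -x)
    exact_mod_cast (by omega)
  refine ⟨F, hn', fun f hf => hF hf, ?_, ho⟩
  intro y hy
  rw [h2]
  rcases hcov y hy with h | h
  · simp [hF', h]
  · simp [hF', h]

/-- Choose `a ∈ Y 0` and `b ∈ Y 2` with inner product 1. A vector `x ∈ Y 1` of their plane is
determined by its inner products `α, β = ±1` with `a, b`. Squared norm 2 reads `α² - αβ + β² = 3`,
which forces `αβ = -1`, so `x = ±(a - b)`. -/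
theorem exists_structure_of_two [FiniteDimensional ℝ E]
    (hs : Module.finrank ℝ (Submodule.span ℝ (⋃ k, Y k)) = 2)
    (hk : ∀ i, Module.finrank ℝ (Submodule.span ℝ (Y i)) ≤ 1)
    (hc : ∀ i, (Y i).encard = 2) :
    ∃ a b : E, ⟪a, a⟫_ℝ = 2 ∧ ⟪b, b⟫_ℝ = 2 ∧ ⟪a, b⟫_ℝ = 1 ∧ a ∈ Y 0 ∧ -a ∈ Y 0 ∧ b ∈ Y 2 ∧
      -b ∈ Y 2 ∧ a - b ∈ Y 1 ∧ b - a ∈ Y 1 := by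
  have hne : ∀ i, ∃ y, y ∈ Y i := by
    intro i
    rw [← Set.Nonempty, Set.nonempty_iff_ne_empty]
    intro h
    have := hc i
    rw [h] at this
    simp at this
  have hneg : ∀ i, ∀ y ∈ Y i, -y ∈ Y i := by
    intro i
    obtain ⟨F, -, -, h, -⟩ := hY.exists_frame_of_encard (hk i) (hc i)
    exact h
  obtain ⟨a, ha⟩ := hne 0
  have : ∃ b ∈ Y 2, ⟪a, b⟫_ℝ = 1 := by
    obtain ⟨b, hb⟩ := hne 2
    rcases hY.diff 0 2 (by decide) a ha b hb with h | h
    · exact ⟨b, hb, h⟩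
    · exact ⟨-b, hneg 2 b hb, by rw [inner_neg_right, h, neg_neg]⟩
  obtain ⟨b, hb, hab⟩ := this
  obtain ⟨x, hx⟩ := hne 1
  have hba : ⟪b, a⟫_ℝ = 1 := by rw [real_inner_comm, hab]
  have naa := hY.norm 0 a ha
  have nbb := hY.norm 2 b hb
  have nxx := hY.norm 1 x hx
  have hW : ∀ i, ∀ y ∈ Y i, y ∈ Submodule.span ℝ (⋃ k, Y k) := fun i y hy =>
    Submodule.subset_span (Set.mem_iUnion.2 ⟨i, hy⟩)
  have hli : LinearIndependent ℝ ![a, b] := by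
    rw [LinearIndependent.pair_iff]
    intro s t hst
    have e1 : ⟪a, s • a + t • b⟫_ℝ = 0 := by rw [hst, inner_zero_right]
    have e2 : ⟪b, s • a + t • b⟫_ℝ = 0 := by rw [hst, inner_zero_right]
    rw [inner_add_right, real_inner_smul_right, real_inner_smul_right] at e1 e2
    rw [naa, hab] at e1
    rw [nbb, hba] at e2
    constructor <;> linarith
  have hspan : Submodule.span ℝ (Set.range ![a, b]) = Submodule.span ℝ (⋃ k, Y k) := by
    refine Submodule.eq_of_le_of_finrank_eq (Submodule.span_le.2 ?_) ?_
    · rintro _ ⟨i, rfl⟩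
      fin_cases i
      · exact hW 0 a ha
      · exact hW 2 b hb
    · rw [finrank_span_eq_card hli, hs, Fintype.card_fin]
  set α := ⟪a, x⟫_ℝ with hα
  set β := ⟪b, x⟫_ℝ with hβ
  -- The coefficients come from inverting the Gram matrix of `a, b`, with diagonal entries 2 and
  -- off-diagonal entries 1.
  have hx0 : x - (((2 * α - β) / 3) • a + ((2 * β - α) / 3) • b) = 0 := by
    refine eq_zero_of_mem_span_of_inner_eq_zero (S := Set.range ![a, b]) ?_ ?_
    · rw [hspan]
      exact Submodule.sub_mem _ (hW 1 x hx) (Submodule.add_mem _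
        (Submodule.smul_mem _ _ (hW 0 a ha)) (Submodule.smul_mem _ _ (hW 2 b hb)))
    · rintro _ ⟨i, rfl⟩
      fin_cases i
      · simp only [Fin.zero_eta, Matrix.cons_val_zero, inner_sub_right, inner_add_right,
          real_inner_smul_right, naa, hab, ← hα]
        ring
      · simp only [Fin.mk_one, Matrix.cons_val_one, Matrix.cons_val_zero, inner_sub_right,
          inner_add_right, real_inner_smul_right, nbb, hba, ← hβ]
        ring
  rw [sub_eq_zero] at hx0
  have hnorm : (2 * α - β) / 3 * α + (2 * β - α) / 3 * β = 2 := by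
    have : ⟪x, x⟫_ℝ = 2 := nxx
    conv_lhs at this => rw [hx0]
    rw [inner_add_left, real_inner_smul_left, real_inner_smul_left, ← hx0, ← hα, ← hβ] at this
    exact this
  have hx1 : x = a - b ∨ x = b - a := by
    rcases hY.diff 0 1 (by decide) a ha x hx with h | h <;>
      rcases hY.diff 2 1 (by decide) b hb x hx with h' | h' <;>
      rw [← hα] at h <;> rw [← hβ] at h' <;> rw [h, h'] at hnorm hx0 <;> norm_num at hnorm
    · left
      rw [hx0]
      norm_num
      abel
    · right
      rw [hx0]
      norm_num
      abel
  refine ⟨a, b, naa, nbb, hab, ha, hneg 0 a ha, hb, hneg 2 b hb, ?_⟩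
  have hx' := hneg 1 x hx
  rcases hx1 with rfl | rfl
  · exact ⟨hx, by rwa [neg_sub] at hx'⟩
  · exact ⟨by rwa [neg_sub] at hx', hx⟩

/-- Half the sum and half the difference of two orthogonal roots of `Y 0` are the first two axes.
The third is what remains of a root `z ∈ Y 1`. Every root of `Y 1` or `Y 2` is `±1` on exactly one
of the first two axes and on the third. Comparison with `z` decides which pair of axes occurs, and
the cardinality 4 makes the inclusions equalities. -/
theorem exists_structure_of_three [FiniteDimensional ℝ E]
    (hs : Module.finrank ℝ (Submodule.span ℝ (⋃ k, Y k)) = 3)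
    (hk : ∀ i, Module.finrank ℝ (Submodule.span ℝ (Y i)) ≤ 2)
    (hc : ∀ i, (Y i).encard = 4) :
    ∃ a : Fin 3 → E, Orthonormal ℝ a ∧ signedSums (a 0) (a 1) ⊆ Y 0 ∧
      signedSums (a 0) (a 2) ⊆ Y 1 ∧ signedSums (a 1) (a 2) ⊆ Y 2 := by
  classical
  obtain ⟨F, hF, hFY, hneg, ho⟩ := hY.exists_frame_of_encard (hk 0) (hc 0)
  obtain ⟨y₁, y₂, h12, rfl⟩ := Finset.card_eq_two.1 hF
  have m₁ : y₁ ∈ Y 0 := hFY _ (by simp)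
  have m₂ : y₂ ∈ Y 0 := hFY _ (by simp)
  have o₁₂ : ⟪y₁, y₂⟫_ℝ = 0 := ho _ (by simp) _ (by simp) h12
  obtain ⟨z, hz⟩ : (Y 1).Nonempty := by
    rw [Set.nonempty_iff_ne_empty]
    intro h
    have := hc 1
    rw [h] at this
    simp at this
  -- Replacing `y₂` by its negative exchanges half-sum and half-difference, so `z` may be taken
  -- orthogonal to the second axis.
  have hWLOG : ∃ y₁ ∈ Y 0, ∃ y₂ ∈ Y 0, ⟪y₁, y₂⟫_ℝ = 0 ∧ ⟪y₁, z⟫_ℝ = ⟪y₂, z⟫_ℝ := by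
    rcases hY.diff 0 1 (by decide) y₁ m₁ z hz with h | h <;>
      rcases hY.diff 0 1 (by decide) y₂ m₂ z hz with h' | h'
    · exact ⟨y₁, m₁, y₂, m₂, o₁₂, by rw [h, h']⟩
    · exact ⟨y₁, m₁, -y₂, hneg _ m₂, by rw [inner_neg_right, o₁₂, neg_zero],
        by rw [inner_neg_left, h, h', neg_neg]⟩
    · exact ⟨y₁, m₁, -y₂, hneg _ m₂, by rw [inner_neg_right, o₁₂, neg_zero],
        by rw [inner_neg_left, h, h']⟩
    · exact ⟨y₁, m₁, y₂, m₂, o₁₂, by rw [h, h']⟩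
  clear! y₁ y₂
  obtain ⟨y₁, m₁, y₂, m₂, o₁₂, hzz⟩ := hWLOG
  have o₂₁ : ⟪y₂, y₁⟫_ℝ = 0 := by rw [real_inner_comm, o₁₂]
  have n₁ := hY.norm 0 _ m₁
  have n₂ := hY.norm 0 _ m₂
  have nz := hY.norm 1 _ hz
  have sz := hY.sq_inner (i := 0) (j := 1) (by decide) m₁ hz
  set a₀ : E := (1 / 2 : ℝ) • (y₁ + y₂) with ha₀
  set a₁ : E := (1 / 2 : ℝ) • (y₁ - y₂) with ha₁
  have hi₀ : ∀ x, ⟪a₀, x⟫_ℝ = (⟪y₁, x⟫_ℝ + ⟪y₂, x⟫_ℝ) / 2 := by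
    intro x
    rw [ha₀, real_inner_smul_left, inner_add_left]
    ring
  have hi₁ : ∀ x, ⟪a₁, x⟫_ℝ = (⟪y₁, x⟫_ℝ - ⟪y₂, x⟫_ℝ) / 2 := by
    intro x
    rw [ha₁, real_inner_smul_left, inner_sub_left]
    ring
  have e₁ : a₀ + a₁ = y₁ := by rw [ha₀, ha₁]; module
  have e₂ : a₀ - a₁ = y₂ := by rw [ha₀, ha₁]; module
  have a00 : ⟪a₀, a₀⟫_ℝ = 1 := by
    rw [hi₀, ha₀, real_inner_smul_right, real_inner_smul_right, inner_add_right, inner_add_right,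
      n₁, n₂, o₁₂, o₂₁]
    norm_num
  have a11 : ⟪a₁, a₁⟫_ℝ = 1 := by
    rw [hi₁, ha₁, real_inner_smul_right, real_inner_smul_right, inner_sub_right, inner_sub_right,
      n₁, n₂, o₁₂, o₂₁]
    norm_num
  have a01 : ⟪a₀, a₁⟫_ℝ = 0 := by
    rw [hi₀, ha₁, real_inner_smul_right, real_inner_smul_right, inner_sub_right, inner_sub_right,
      n₁, n₂, o₁₂, o₂₁]
    norm_num
  have a10 : ⟪a₁, a₀⟫_ℝ = 0 := by rw [real_inner_comm, a01]
  have z0 : ⟪a₀, z⟫_ℝ = ⟪y₁, z⟫_ℝ := by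
    rw [hi₀, ← hzz]
    ring
  have z1 : ⟪a₁, z⟫_ℝ = 0 := by
    rw [hi₁, ← hzz]
    ring
  have hzs := hY.diff 0 1 (by decide) y₁ m₁ z hz
  rw [← z0] at hzs sz
  set a₂ : E := z - ⟪a₀, z⟫_ℝ • a₀ with ha₂
  have a02 : ⟪a₀, a₂⟫_ℝ = 0 := by
    rw [ha₂, inner_sub_right, real_inner_smul_right, a00]
    ring
  have a12 : ⟪a₁, a₂⟫_ℝ = 0 := by
    rw [ha₂, inner_sub_right, real_inner_smul_right, a10, z1]
    ring
  have a22 : ⟪a₂, a₂⟫_ℝ = 1 := by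
    have : ⟪a₂, a₂⟫_ℝ = ⟪z, a₂⟫_ℝ := by
      conv_lhs => rw [ha₂]
      rw [inner_sub_left, ← ha₂, real_inner_smul_left, a02]
      ring
    rw [this, ha₂, inner_sub_right, real_inner_smul_right, nz, real_inner_comm a₀ z, sz]
    norm_num
  have hW : ∀ i, ∀ y ∈ Y i, y ∈ Submodule.span ℝ (⋃ k, Y k) := fun i y hy =>
    Submodule.subset_span (Set.mem_iUnion.2 ⟨i, hy⟩)
  have W0 : a₀ ∈ Submodule.span ℝ (⋃ k, Y k) :=
    Submodule.smul_mem _ _ (Submodule.add_mem _ (hW 0 _ m₁) (hW 0 _ m₂))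
  have W1 : a₁ ∈ Submodule.span ℝ (⋃ k, Y k) :=
    Submodule.smul_mem _ _ (Submodule.sub_mem _ (hW 0 _ m₁) (hW 0 _ m₂))
  have W2 : a₂ ∈ Submodule.span ℝ (⋃ k, Y k) :=
    Submodule.sub_mem _ (hW 1 _ hz) (Submodule.smul_mem _ _ W0)
  have hon : Orthonormal ℝ ![a₀, a₁, a₂] := by
    rw [← Matrix.gram_eq_one_iff_orthonormal]
    have a20 : ⟪a₂, a₀⟫_ℝ = 0 := by rw [real_inner_comm, a02]
    have a21 : ⟪a₂, a₁⟫_ℝ = 0 := by rw [real_inner_comm, a12]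
    ext i j
    rw [Matrix.gram_apply]
    fin_cases i <;> fin_cases j <;>
      simp only [Fin.zero_eta, Fin.mk_one, Fin.reduceFinMk, Matrix.cons_val, a00, a11, a22, a01,
        a10, a02, a20, a12, a21] <;> simp
  clear_value a₂ a₁ a₀
  have hexp : ∀ x ∈ Submodule.span ℝ (⋃ k, Y k),
      x = ⟪a₀, x⟫_ℝ • a₀ + ⟪a₁, x⟫_ℝ • a₁ + ⟪a₂, x⟫_ℝ • a₂ := by
    intro x hx
    have := eq_sum_inner_smul hon (W := Submodule.span ℝ (⋃ k, Y k)) (by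
      intro i
      fin_cases i
      · exact W0
      · exact W1
      · exact W2) hs hx
    simpa [Fin.sum_univ_three] using this
  have hcases : ∀ i, i ≠ 0 → ∀ x ∈ Y i, x ∈ signedSums a₀ a₂ ∨ x ∈ signedSums a₁ a₂ := by
    intro i hi x hx
    have hxx := hY.norm i x hx
    have he := hexp x (hW i x hx)
    have hsq : ⟪a₀, x⟫_ℝ * ⟪a₀, x⟫_ℝ + ⟪a₁, x⟫_ℝ * ⟪a₁, x⟫_ℝ + ⟪a₂, x⟫_ℝ * ⟪a₂, x⟫_ℝ = 2 := by
      rw [← hxx]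
      conv_rhs => rw [he]
      rw [inner_add_left, inner_add_left, real_inner_smul_left, real_inner_smul_left,
        real_inner_smul_left, ← he]
    rcases half_sum_diff_cases (hY.diff 0 i hi.symm y₁ m₁ x hx)
      (hY.diff 0 i hi.symm y₂ m₂ x hx) with ⟨h, h'⟩ | ⟨h, h'⟩ <;>
      rw [← hi₀] at h <;> rw [← hi₁] at h'
    · left
      rw [h', zero_smul, add_zero] at he
      rw [he]
      refine smul_add_smul_mem_signedSums h ?_
      rw [← mul_self_eq_one_iff]
      rcases h with h | h <;> rw [h, h'] at hsq <;> linarith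
    · right
      rw [h, zero_smul, zero_add] at he
      rw [he]
      refine smul_add_smul_mem_signedSums h' ?_
      rw [← mul_self_eq_one_iff]
      rcases h' with h' | h' <;> rw [h, h'] at hsq <;> linarith
  have hz02 : z ∈ signedSums a₀ a₂ := by
    have : z = ⟪a₀, z⟫_ℝ • a₀ + (1 : ℝ) • a₂ := by rw [ha₂]; module
    rw [this]
    exact smul_add_smul_mem_signedSums hzs (Or.inl rfl)
  -- A root on the other pair of axes would share only `a₂` with `z` and have inner product `±1`
  -- with it, which does not happen within one set.
  have hsub1 : Y 1 ⊆ signedSums a₀ a₂ := by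
    intro x hx
    rcases hcases 1 (by decide) x hx with h | h
    · exact h
    · rw [signedSums_comm] at hz02 h
      have h1 := inner_signedSums_of_common a22 (by rw [real_inner_comm, a02])
        (by rw [real_inner_comm, a12]) a01 hz02 h
      rcases hY.same 1 z hz x hx with h2 | h2 | h2
      · rw [h2, nz] at h1; norm_num at h1
      · rw [h2, inner_neg_right, nz] at h1; norm_num at h1
      · rw [h2] at h1; norm_num at h1
  have hsub2 : Y 2 ⊆ signedSums a₁ a₂ := by
    intro x hx
    rcases hcases 2 (by decide) x hx with h | h
    · have h1 := inner_signedSums_self a00 a22 a02 hz02 h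
      rcases hY.diff 1 2 (by decide) z hz x hx with h2 | h2
      · exact absurd h2 h1.1
      · exact absurd h2 h1.2
    · exact h
  refine ⟨![a₀, a₁, a₂], hon, ?_, ?_, ?_⟩
  · refine signedSums_subset ?_ ?_ ?_ ?_ <;> simp only [Matrix.cons_val_zero, Matrix.cons_val_one]
    · rwa [e₁]
    · rwa [e₂]
    · rw [e₁]
      exact hneg _ m₁
    · rw [e₂]
      exact hneg _ m₂
  · exact (Set.Finite.eq_of_subset_of_encard_le' (finite_signedSums _ _) hsub1
      ((encard_signedSums_le _ _).trans (hc 1).ge)).ge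
  · exact (Set.Finite.eq_of_subset_of_encard_le' (finite_signedSums _ _) hsub2
      ((encard_signedSums_le _ _).trans (hc 2).ge)).ge

/-- The frame of `Y 0` has four roots; the half-sums and half-differences of two pairs of them are
the axes. A root of `Y 1` or `Y 2` is supported on one axis of `{a 0, a 1}` and one of `{a 2, a 3}`.
Comparison with `z ∈ Y 1` separates the pairings `02|13` and `03|12`, and the cardinality 8 makes
the inclusions equalities. -/
theorem exists_structure_of_four [FiniteDimensional ℝ E]
    (hs : Module.finrank ℝ (Submodule.span ℝ (⋃ k, Y k)) = 4)
    (hk : ∀ i, Module.finrank ℝ (Submodule.span ℝ (Y i)) ≤ 4)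
    (hc : ∀ i, (Y i).encard = 8) :
    ∃ a : Fin 4 → E, Orthonormal ℝ a ∧
      signedSums (a 0) (a 1) ∪ signedSums (a 2) (a 3) ⊆ Y 0 ∧
      signedSums (a 0) (a 2) ∪ signedSums (a 1) (a 3) ⊆ Y 1 ∧
      signedSums (a 0) (a 3) ∪ signedSums (a 1) (a 2) ⊆ Y 2 := by
  classical
  obtain ⟨F, hF, hFY, hneg, ho⟩ := hY.exists_frame_of_encard (hk 0) (hc 0)
  obtain ⟨z, hz⟩ : (Y 1).Nonempty := by
    rw [Set.nonempty_iff_ne_empty]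
    intro h
    have := hc 1
    rw [h] at this
    simp at this
  -- The product of two of these signs tells whether the half-sum or the half-difference survives.
  -- Equal products put `z` in the pairing `02|13`; if they differ, flipping the last frame vector
  -- corrects this.
  have hWLOG : ∃ y : Fin 4 → E, (∀ i, y i ∈ Y 0) ∧ (∀ i j, i ≠ j → ⟪y i, y j⟫_ℝ = 0) ∧
      ⟪y 0, z⟫_ℝ * ⟪y 1, z⟫_ℝ = ⟪y 2, z⟫_ℝ * ⟪y 3, z⟫_ℝ := by
    set g : Fin 4 ≃ F := (Fin.castOrderIso hF.symm).toEquiv.trans F.equivFin.symm with hg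
    have hgo : ∀ i j, i ≠ j → ⟪(g i : E), g j⟫_ℝ = 0 := fun i j hij =>
      ho _ (g i).2 _ (g j).2 fun h => hij (g.injective (Subtype.ext h))
    have hd : ∀ i, ⟪(g i : E), z⟫_ℝ = 1 ∨ ⟪(g i : E), z⟫_ℝ = -1 := fun i =>
      hY.diff 0 1 (by decide) _ (hFY _ (g i).2) z hz
    by_cases h : ⟪(g 0 : E), z⟫_ℝ * ⟪(g 1 : E), z⟫_ℝ = ⟪(g 2 : E), z⟫_ℝ * ⟪(g 3 : E), z⟫_ℝ
    · exact ⟨fun i => g i, fun i => hFY _ (g i).2, hgo, h⟩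
    · refine ⟨fun i => if i = 3 then -(g i : E) else g i, ?_, ?_, ?_⟩
      · intro i
        dsimp only
        split_ifs
        · exact hneg _ (hFY _ (g i).2)
        · exact hFY _ (g i).2
      · intro i j hij
        dsimp only
        split_ifs <;> simp [hgo i j hij]
      · simp only [Fin.reduceEq, if_false, if_true, inner_neg_left]
        rcases hd 0 with h0 | h0 <;> rcases hd 1 with h1 | h1 <;> rcases hd 2 with h2 | h2 <;>
          rcases hd 3 with h3 | h3 <;> simp only [h0, h1, h2, h3] at h ⊢ <;>
          first | (norm_num at h; done) | norm_num
  obtain ⟨y, hy0, hyo, hzy⟩ := hWLOG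
  have hyn : ∀ i, ⟪y i, y i⟫_ℝ = 2 := fun i => hY.norm 0 _ (hy0 i)
  set a : Fin 4 → E := ![(1 / 2 : ℝ) • (y 0 + y 1), (1 / 2 : ℝ) • (y 0 - y 1),
    (1 / 2 : ℝ) • (y 2 + y 3), (1 / 2 : ℝ) • (y 2 - y 3)] with ha
  have hi : ∀ x, ⟪a 0, x⟫_ℝ = (⟪y 0, x⟫_ℝ + ⟪y 1, x⟫_ℝ) / 2 ∧
      ⟪a 1, x⟫_ℝ = (⟪y 0, x⟫_ℝ - ⟪y 1, x⟫_ℝ) / 2 ∧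
      ⟪a 2, x⟫_ℝ = (⟪y 2, x⟫_ℝ + ⟪y 3, x⟫_ℝ) / 2 ∧
      ⟪a 3, x⟫_ℝ = (⟪y 2, x⟫_ℝ - ⟪y 3, x⟫_ℝ) / 2 := by
    intro x
    simp only [ha, Matrix.cons_val, real_inner_smul_left, inner_add_left, inner_sub_left]
    refine ⟨?_, ?_, ?_, ?_⟩ <;> ring
  have hon : Orthonormal ℝ a := by
    rw [← Matrix.gram_eq_one_iff_orthonormal]
    ext i j
    rw [Matrix.gram_apply]
    fin_cases i <;> fin_cases j <;>
      simp only [Fin.zero_eta, Fin.mk_one, Fin.reduceFinMk, ha, Matrix.cons_val,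
        real_inner_smul_left, real_inner_smul_right, inner_add_left, inner_sub_left,
                inner_add_right, inner_sub_right, hyn, hyo 0 1 (by decide), hyo 0 2 (by
        decide), hyo 0 3 (by decide), hyo 1 0 (by decide), hyo 1 2 (by decide), hyo 1 3 (by
        decide), hyo 2 0 (by decide), hyo 2 1 (by decide), hyo 2 3 (by decide), hyo 3 0 (by
        decide), hyo 3 1 (by decide), hyo 3 2 (by decide)] <;>
      norm_num
  have hW : ∀ i, ∀ y ∈ Y i, y ∈ Submodule.span ℝ (⋃ k, Y k) := fun i y hy =>
    Submodule.subset_span (Set.mem_iUnion.2 ⟨i, hy⟩)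
  have hexp : ∀ x ∈ Submodule.span ℝ (⋃ k, Y k),
      x = ⟪a 0, x⟫_ℝ • a 0 + ⟪a 1, x⟫_ℝ • a 1 + ⟪a 2, x⟫_ℝ • a 2 + ⟪a 3, x⟫_ℝ • a 3 := by
    intro x hx
    have := eq_sum_inner_smul hon (W := Submodule.span ℝ (⋃ k, Y k)) (by
      intro i
      fin_cases i
      · exact Submodule.smul_mem _ _ (Submodule.add_mem _ (hW 0 _ (hy0 0)) (hW 0 _ (hy0 1)))
      · exact Submodule.smul_mem _ _ (Submodule.sub_mem _ (hW 0 _ (hy0 0)) (hW 0 _ (hy0 1)))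
      · exact Submodule.smul_mem _ _ (Submodule.add_mem _ (hW 0 _ (hy0 2)) (hW 0 _ (hy0 3)))
      · exact Submodule.smul_mem _ _ (Submodule.sub_mem _ (hW 0 _ (hy0 2)) (hW 0 _ (hy0 3))))
      hs hx
    simpa only [Fin.sum_univ_four] using this
  have hoa : ∀ i j, i ≠ j → ⟪a i, a j⟫_ℝ = 0 := fun i j hij => hon.2 hij
  have hna : ∀ i, ⟪a i, a i⟫_ℝ = 1 := fun i => by
    rw [real_inner_self_eq_norm_mul_norm, hon.1 i, one_mul]
  have hcases : ∀ i, i ≠ 0 → ∀ x ∈ Y i,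
      (⟪y 0, x⟫_ℝ * ⟪y 1, x⟫_ℝ = ⟪y 2, x⟫_ℝ * ⟪y 3, x⟫_ℝ →
        x ∈ signedSums (a 0) (a 2) ∪ signedSums (a 1) (a 3)) ∧
      (x ∈ signedSums (a 0) (a 2) ∪ signedSums (a 1) (a 3) ∨
        x ∈ signedSums (a 0) (a 3) ∪ signedSums (a 1) (a 2)) := by
    intro i h0 x hx
    have he := hexp x (hW i x hx)
    have hd : ∀ j, ⟪y j, x⟫_ℝ = 1 ∨ ⟪y j, x⟫_ℝ = -1 := fun j =>
      hY.diff 0 i h0.symm _ (hy0 j) x hx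
    obtain ⟨i0, i1, i2, i3⟩ := hi x
    rcases half_sum_diff_cases (hd 0) (hd 1) with ⟨h, h'⟩ | ⟨h, h'⟩ <;>
      rcases half_sum_diff_cases (hd 2) (hd 3) with ⟨k, k'⟩ | ⟨k, k'⟩ <;>
      rw [← i0] at h <;> rw [← i1] at h' <;> rw [← i2] at k <;> rw [← i3] at k'
    · have hm : x ∈ signedSums (a 0) (a 2) := by
        rw [h', k', zero_smul, zero_smul, add_zero, add_zero] at he
        rw [he]
        exact smul_add_smul_mem_signedSums h k
      exact ⟨fun _ => Or.inl hm, Or.inl (Or.inl hm)⟩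
    · have hm : x ∈ signedSums (a 0) (a 3) := by
        rw [h', k, zero_smul, zero_smul, add_zero, add_zero] at he
        rw [he]
        exact smul_add_smul_mem_signedSums h k'
      refine ⟨fun hp => ?_, Or.inr (Or.inl hm)⟩
      exfalso
      rw [h'] at i1
      rw [k] at i2
      have e1 : ⟪y 1, x⟫_ℝ = ⟪y 0, x⟫_ℝ := by linarith
      have e3 : ⟪y 3, x⟫_ℝ = -⟪y 2, x⟫_ℝ := by linarith
      rw [e1, e3] at hp
      rcases hd 0 with q | q <;> rcases hd 2 with q' | q' <;> rw [q, q'] at hp <;> norm_num at hp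
    · have hm : x ∈ signedSums (a 1) (a 2) := by
        rw [h, k', zero_smul, zero_smul, add_zero, zero_add] at he
        rw [he]
        exact smul_add_smul_mem_signedSums h' k
      refine ⟨fun hp => ?_, Or.inr (Or.inr hm)⟩
      exfalso
      rw [h] at i0
      rw [k'] at i3
      have e1 : ⟪y 1, x⟫_ℝ = -⟪y 0, x⟫_ℝ := by linarith
      have e3 : ⟪y 3, x⟫_ℝ = ⟪y 2, x⟫_ℝ := by linarith
      rw [e1, e3] at hp
      rcases hd 0 with q | q <;> rcases hd 2 with q' | q' <;> rw [q, q'] at hp <;> norm_num at hp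
    · have hm : x ∈ signedSums (a 1) (a 3) := by
        rw [h, k, zero_smul, zero_smul, add_zero, zero_add] at he
        rw [he]
        exact smul_add_smul_mem_signedSums h' k'
      exact ⟨fun _ => Or.inr hm, Or.inl (Or.inr hm)⟩
  have hzz := (hcases 1 (by decide) z hz).1 hzy
  have hcommon : ∀ {i j k}, i ≠ j → i ≠ k → j ≠ k → ∀ {x x' : E}, x ∈ signedSums (a i) (a j) →
      x' ∈ signedSums (a i) (a k) → ⟪x, x'⟫_ℝ = 1 ∨ ⟪x, x'⟫_ℝ = -1 := fun hij hik hjk _ _ hx hx' =>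
    inner_signedSums_of_common (hna _) (hoa _ _ hij) (hoa _ _ hik) (hoa _ _ hjk) hx hx'
  have hdis : ∀ {i j k l}, i ≠ k → i ≠ l → j ≠ k → j ≠ l → ∀ {x x' : E},
      x ∈ signedSums (a i) (a j) → x' ∈ signedSums (a k) (a l) → ⟪x, x'⟫_ℝ = 0 :=
    fun hik hil hjk hjl _ _ hx hx' =>
      inner_signedSums_disjoint (hoa _ _ hik) (hoa _ _ hil) (hoa _ _ hjk) (hoa _ _ hjl) hx hx'
  have hsub1 : Y 1 ⊆ signedSums (a 0) (a 2) ∪ signedSums (a 1) (a 3) := by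
    intro x hx
    rcases (hcases 1 (by decide) x hx).2 with h | h
    · exact h
    · have h1 : ⟪z, x⟫_ℝ = 1 ∨ ⟪z, x⟫_ℝ = -1 := by
        rcases hzz with h1 | h1 <;> rcases h with h2 | h2
        · exact hcommon (by decide) (by decide) (by decide) h1 h2
        · rw [signedSums_comm] at h1 h2
          exact hcommon (by decide) (by decide) (by decide) h1 h2
        · rw [signedSums_comm] at h1 h2
          exact hcommon (by decide) (by decide) (by decide) h1 h2
        · exact hcommon (by decide) (by decide) (by decide) h1 h2
      have nz := hY.norm 1 z hz
      rcases hY.same 1 z hz x hx with h2 | h2 | h2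
      · rw [h2, nz] at h1; norm_num at h1
      · rw [h2, inner_neg_right, nz] at h1; norm_num at h1
      · rw [h2] at h1; norm_num at h1
  have hsub2 : Y 2 ⊆ signedSums (a 0) (a 3) ∪ signedSums (a 1) (a 2) := by
    intro x hx
    rcases (hcases 2 (by decide) x hx).2 with h | h
    · exfalso
      have h3 := hY.diff 1 2 (by decide) z hz x hx
      rcases hzz with h1 | h1 <;> rcases h with h2 | h2
      · have := inner_signedSums_self (hna _) (hna _) (hoa _ _ (by decide)) h1 h2
        tauto
      · rw [hdis (by decide) (by decide) (by decide) (by decide) h1 h2] at h3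
        norm_num at h3
      · rw [hdis (by decide) (by decide) (by decide) (by decide) h1 h2] at h3
        norm_num at h3
      · have := inner_signedSums_self (hna _) (hna _) (hoa _ _ (by decide)) h1 h2
        tauto
    · exact h
  have hcard : ∀ b c d e : E, (signedSums b c ∪ signedSums d e).encard ≤ 8 := by
    intro b c d e
    calc _ ≤ _ := Set.encard_union_le _ _
      _ ≤ 4 + 4 := add_le_add (encard_signedSums_le _ _) (encard_signedSums_le _ _)
      _ = 8 := by norm_num
  have e0 : a 0 + a 1 = y 0 := by simp only [ha, Matrix.cons_val]; module
  have e1 : a 0 - a 1 = y 1 := by simp only [ha, Matrix.cons_val]; module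
  have e2 : a 2 + a 3 = y 2 := by simp only [ha, Matrix.cons_val]; module
  have e3 : a 2 - a 3 = y 3 := by simp only [ha, Matrix.cons_val]; module
  refine ⟨a, hon, Set.union_subset ?_ ?_, ?_, ?_⟩
  · refine signedSums_subset ?_ ?_ ?_ ?_
    · exact e0 ▸ hy0 0
    · exact e1 ▸ hy0 1
    · exact e0 ▸ hneg _ (hy0 0)
    · exact e1 ▸ hneg _ (hy0 1)
  · refine signedSums_subset ?_ ?_ ?_ ?_
    · exact e2 ▸ hy0 2
    · exact e3 ▸ hy0 3
    · exact e2 ▸ hneg _ (hy0 2)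
    · exact e3 ▸ hneg _ (hy0 3)
  · exact (Set.Finite.eq_of_subset_of_encard_le' ((finite_signedSums _ _).union
      (finite_signedSums _ _)) hsub1 ((hcard _ _ _ _).trans (hc 1).ge)).ge
  · exact (Set.Finite.eq_of_subset_of_encard_le' ((finite_signedSums _ _).union
      (finite_signedSums _ _)) hsub2 ((hcard _ _ _ _).trans (hc 2).ge)).ge

end IsRootTriple

end RootTripleStructure

/-! ### The cube spanned by three lines, and its pillars. -/

section Pillars

variable {E : Type*} [NormedAddCommGroup E] [InnerProductSpace ℝ E]

/-- Vectors of norm `√3` with pairwise inner products one are linearly independent. -/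
theorem linearIndependent_of_inner_eq_one {n : Type*} [Finite n] {v : n → E}
    (hself : ∀ i, ⟪v i, v i⟫_ℝ = 3) (hne : ∀ i j, i ≠ j → ⟪v i, v j⟫_ℝ = 1) :
    LinearIndependent ℝ v := by
  classical
  have := Fintype.ofFinite n
  rw [Fintype.linearIndependent_iff]
  intro c hc
  -- The Gram matrix is `2I + J`. Summing these equations gives `(2 + n) ∑ c = 0`.
  have hi : ∀ i, 2 * c i + ∑ j, c j = 0 := by
    intro i
    have h0 : ⟪v i, ∑ j, c j • v j⟫_ℝ = 0 := by rw [hc, inner_zero_right]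
    rw [inner_sum] at h0
    rw [← h0]
    have : ∀ j, ⟪v i, c j • v j⟫_ℝ = (if i = j then 2 * c j else 0) + c j := by
      intro j
      rw [real_inner_smul_right]
      split_ifs with h
      · rw [← h, hself]
        ring
      · rw [hne i j h]
        ring
    simp only [this, Finset.sum_add_distrib, Finset.sum_ite_eq, Finset.mem_univ, if_true]
  have hsum : (2 + (Fintype.card n : ℝ)) * ∑ j, c j = 0 := by
    have : ∑ i, (2 * c i + ∑ j, c j) = 0 := Finset.sum_eq_zero fun i _ => hi i
    rw [Finset.sum_add_distrib, ← Finset.mul_sum, Finset.sum_const, nsmul_eq_mul,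
      Finset.card_univ] at this
    linarith
  have h0 : ∑ j, c j = 0 := by
    rcases mul_eq_zero.1 hsum with h | h
    · have : (0 : ℝ) ≤ Fintype.card n := Nat.cast_nonneg _
      linarith
    · exact h
  intro i
  have := hi i
  linarith

/-- Finiteness is not assumed: an infinite set would also contain a finite subset with `n + 1`
elements. -/
theorem encard_le_of_forall_finset {α : Type*} {S : Set α} {n : ℕ}
    (h : ∀ F : Finset α, (F : Set α) ⊆ S → F.card ≤ n) : S.encard ≤ n := by
  by_contra hcon
  push Not at hcon
  obtain ⟨T, hTS, hT⟩ := Set.exists_subset_encard_eq (s := S) (k := (n + 1 : ℕ)) (by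
    rw [Nat.cast_add, Nat.cast_one]
    exact Order.add_one_le_of_lt hcon)
  have hfin : T.Finite := Set.finite_of_encard_eq_coe hT
  have := h hfin.toFinset (by simpa using hTS)
  rw [hfin.encard_eq_coe_toFinset_card] at hT
  have : hfin.toFinset.card = n + 1 := by exact_mod_cast hT
  omega

/-- If no three vectors have pairwise inner products `-1`, the lines are independent. -/
theorem IsEquiangular.encard_le_finrank [FiniteDimensional ℝ E] {L : Set (Submodule ℝ E)}
    (hL : IsEquiangular L (Real.arccos (1 / 3)))
    (h : ∀ x ∈ lineVectors L, ∀ y ∈ lineVectors L, ∀ z ∈ lineVectors L, ⟪x, y⟫_ℝ = -1 →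
      ⟪x, z⟫_ℝ = -1 → ⟪y, z⟫_ℝ = -1 → False) :
    L.encard ≤ Module.finrank ℝ (Submodule.span ℝ (lineVectors L)) := by
  classical
  rcases Set.eq_empty_or_nonempty L with rfl | ⟨l, hl⟩
  · simp
  obtain ⟨x₀, hx₀, -⟩ := hL.exists_lineVector hl
  -- On each line choose the sign that makes the inner product with `x₀` positive. Two chosen
  -- vectors with inner product `-1` would form a forbidden triple with `-x₀`.
  set S : Set E := {x | x ∈ lineVectors L ∧ (x = x₀ ∨ ⟪x₀, x⟫_ℝ = 1)} with hS
  have hsub : L ⊆ (fun x => Submodule.span ℝ {x}) '' S := by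
    intro m hm
    obtain ⟨x, hx, rfl⟩ := hL.exists_lineVector hm
    rcases hL.inner_lineVectors hx₀ hx with h1 | h1 | h1 | h1
    · exact ⟨x, ⟨hx, Or.inl h1⟩, rfl⟩
    · refine ⟨x₀, ⟨hx₀, Or.inl rfl⟩, ?_⟩
      rw [h1, ← Set.neg_singleton, Submodule.span_neg]
    · exact ⟨x, ⟨hx, Or.inr h1⟩, rfl⟩
    · refine ⟨-x, ⟨neg_mem_lineVectors hx, Or.inr (by rw [inner_neg_right, h1, neg_neg])⟩, ?_⟩
      dsimp only
      rw [← Set.neg_singleton, Submodule.span_neg]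
  refine (Set.encard_le_encard hsub).trans ((Set.encard_image_le _ _).trans ?_)
  refine encard_le_of_forall_finset fun F hF => ?_
  have hone : ∀ x ∈ S, ∀ y ∈ S, x ≠ y → ⟪x, y⟫_ℝ = 1 := by
    rintro x ⟨hx, hx'⟩ y ⟨hy, hy'⟩ hxy
    rcases hx' with rfl | hx'
    · exact hy'.resolve_left (Ne.symm hxy)
    · rcases hy' with rfl | hy'
      · rw [real_inner_comm]
        exact hx'
      · rcases hL.inner_lineVectors hx hy with h1 | h1 | h1 | h1
        · exact absurd h1.symm hxy
        · rw [h1, inner_neg_right, hx'] at hy'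
          norm_num at hy'
        · exact h1
        · exact (h (-x₀) (neg_mem_lineVectors hx₀) x hx y hy (by rw [inner_neg_left, hx'])
            (by rw [inner_neg_left, hy']) h1).elim
  have hli : LinearIndependent ℝ (fun x : F => (x : E)) :=
    linearIndependent_of_inner_eq_one (fun x => (hF x.2).1.1)
      (fun x y hxy => hone _ (hF x.2) _ (hF y.2) fun h => hxy (Subtype.ext h))
  rw [← finrank_span_finset_eq_card hli]
  exact Submodule.finrank_mono (Submodule.span_mono fun x hx => (hF hx).1)

/-- The vectors orthogonal to the frame `e` which complete `e i` to a vector on a line of `L`. -/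
def pillar (L : Set (Submodule ℝ E)) (e : Fin 3 → E) (i : Fin 3) : Set E :=
  {y | (∀ j, ⟪e j, y⟫_ℝ = 0) ∧ e i + y ∈ lineVectors L}

/-- Since pillars are orthogonal to the cube, `⟪e i + y, e j + z⟫ = ⟪e i, e j⟫ + ⟪y, z⟫`. For
distinct lines the left side is `±1`, so `⟪y, z⟫` is `0` or `-2` in one pillar and `±1` between two.
-/
theorem IsEquiangular.isRootTriple_pillar {L : Set (Submodule ℝ E)}
    (hL : IsEquiangular L (Real.arccos (1 / 3))) {e : Fin 3 → E} (he : Orthonormal ℝ e) :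
    IsRootTriple (pillar L e) := by
  have hen : ∀ i, ⟪e i, e i⟫_ℝ = 1 := fun i => by
    rw [real_inner_self_eq_norm_mul_norm, he.1 i, one_mul]
  have heo : ∀ i j, i ≠ j → ⟪e i, e j⟫_ℝ = 0 := fun i j hij => he.2 hij
  have hexp : ∀ i j y z, y ∈ pillar L e i → z ∈ pillar L e j →
      ⟪e i + y, e j + z⟫_ℝ = ⟪e i, e j⟫_ℝ + ⟪y, z⟫_ℝ := by
    intro i j y z hy hz
    rw [inner_add_left, inner_add_right, inner_add_right, hz.1 i, real_inner_comm (e j) y, hy.1 j]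
    ring
  have hexp' : ∀ i j z, z ∈ pillar L e j → ⟪e i, e j + z⟫_ℝ = ⟪e i, e j⟫_ℝ := by
    intro i j z hz
    rw [inner_add_right, hz.1 i, add_zero]
  have hnorm : ∀ i, ∀ y ∈ pillar L e i, ⟪y, y⟫_ℝ = 2 := by
    intro i y hy
    have := hexp i i y y hy hy
    rw [hy.2.1, hen] at this
    linarith
  refine ⟨hnorm, ?_, ?_⟩
  · intro i y hy z hz
    rcases hL.inner_lineVectors hy.2 hz.2 with h | h | h | h
    · exact Or.inl (add_left_cancel h)
    · have := hexp' i i z hz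
      rw [h, inner_neg_right, hexp' i i y hy, hen] at this
      norm_num at this
    · rw [hexp i i y z hy hz, hen] at h
      exact Or.inr (Or.inr (by linarith))
    · rw [hexp i i y z hy hz, hen] at h
      exact Or.inr (Or.inl (eq_neg_of_inner_eq (hnorm i y hy) (hnorm i z hz) (by linarith)))
  · intro i j hij y hy z hz
    rcases hL.inner_lineVectors hy.2 hz.2 with h | h | h | h
    · have := hexp' i j z hz
      rw [h, hexp' i i y hy, hen, heo i j hij] at this
      norm_num at this
    · have := hexp' i j z hz
      rw [h, inner_neg_right, hexp' i i y hy, hen, heo i j hij] at this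
      norm_num at this
    · rw [hexp i j y z hy hz, heo i j hij, zero_add] at h
      exact Or.inl h
    · rw [hexp i j y z hy hz, heo i j hij, zero_add] at h
      exact Or.inr h

/-- Three vectors on the lines of `L` whose inner products are `-1` are three of the diagonals of
a cube. -/
theorem exists_cube_frame {L : Set (Submodule ℝ E)} {x y z : E} (hx : x ∈ lineVectors L)
    (hy : y ∈ lineVectors L) (hz : z ∈ lineVectors L) (hxy : ⟪x, y⟫_ℝ = -1)
    (hxz : ⟪x, z⟫_ℝ = -1) (hyz : ⟪y, z⟫_ℝ = -1) :
    ∃ e : Fin 3 → E, Orthonormal ℝ e ∧ e 0 + e 1 + e 2 ∈ lineVectors L ∧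
      e 0 - e 1 - e 2 ∈ lineVectors L ∧ -e 0 + e 1 - e 2 ∈ lineVectors L := by
  have hyx : ⟪y, x⟫_ℝ = -1 := by rw [real_inner_comm, hxy]
  have hzx : ⟪z, x⟫_ℝ = -1 := by rw [real_inner_comm, hxz]
  have hzy : ⟪z, y⟫_ℝ = -1 := by rw [real_inner_comm, hyz]
  -- Obtained by solving `x = e 0 + e 1 + e 2`, `y = e 0 - e 1 - e 2`, `z = -e 0 + e 1 - e 2` for
  -- the axes.
  refine ⟨![(1 / 2 : ℝ) • (x + y), (1 / 2 : ℝ) • (x + z), -((1 / 2 : ℝ) • (y + z))], ?_, ?_, ?_, ?_⟩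
  · rw [← Matrix.gram_eq_one_iff_orthonormal]
    ext i j
    rw [Matrix.gram_apply]
    fin_cases i <;> fin_cases j <;>
      simp only [Fin.zero_eta, Fin.mk_one, Fin.reduceFinMk, Matrix.cons_val, real_inner_smul_left,
        real_inner_smul_right, inner_add_left, inner_add_right, inner_neg_left, inner_neg_right,
        hx.1, hy.1, hz.1, hxy, hxz, hyz, hyx, hzx, hzy] <;> norm_num
  · convert hx using 1
    simp only [Matrix.cons_val]
    module
  · convert hy using 1
    simp only [Matrix.cons_val]
    module
  · convert hz using 1
    simp only [Matrix.cons_val]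
    module

theorem mem_pillar_of_inner {L : Set (Submodule ℝ E)} {e : Fin 3 → E} (he : Orthonormal ℝ e)
    {v : E} (hv : v ∈ lineVectors L) {i : Fin 3} (hi : ⟪e i, v⟫_ℝ = 1 ∨ ⟪e i, v⟫_ℝ = -1)
    (h0 : ∀ j, j ≠ i → ⟪e j, v⟫_ℝ = 0) :
    ∃ y ∈ pillar L e i, v = e i + y ∨ v = -(e i + y) := by
  have hen : ∀ i, ⟪e i, e i⟫_ℝ = 1 := fun i => by
    rw [real_inner_self_eq_norm_mul_norm, he.1 i, one_mul]
  have key : ∀ v ∈ lineVectors L, ⟪e i, v⟫_ℝ = 1 → (∀ j, j ≠ i → ⟪e j, v⟫_ℝ = 0) →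
      v - e i ∈ pillar L e i := by
    intro v hv h1 h0
    refine ⟨fun j => ?_, by rwa [add_sub_cancel]⟩
    by_cases hj : j = i
    · rw [hj, inner_sub_right, h1, hen, sub_self]
    · rw [inner_sub_right, h0 j hj, he.2 hj, sub_self]
  rcases hi with hi | hi
  · exact ⟨v - e i, key v hv hi h0, Or.inl (by abel)⟩
  · refine ⟨-v - e i, key (-v) (neg_mem_lineVectors hv) (by rw [inner_neg_right, hi, neg_neg]) ?_,
      Or.inr (by abel)⟩
    intro j hj
    rw [inner_neg_right, h0 j hj, neg_zero]

/-- Every vector on the lines of `L` is a diagonal of the cube or belongs to a pillar. -/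
theorem IsEquiangular.eq_diagonal_or_mem_pillar {L : Set (Submodule ℝ E)}
    (hL : IsEquiangular L (Real.arccos (1 / 3))) {e : Fin 3 → E} (he : Orthonormal ℝ e)
    (h₁ : e 0 + e 1 + e 2 ∈ lineVectors L) (h₂ : e 0 - e 1 - e 2 ∈ lineVectors L)
    (h₃ : -e 0 + e 1 - e 2 ∈ lineVectors L) {v : E} (hv : v ∈ lineVectors L) :
    (∃ w, (w = e 0 + e 1 + e 2 ∨ w = e 0 - e 1 - e 2 ∨ w = -e 0 + e 1 - e 2 ∨
      w = -e 0 - e 1 + e 2) ∧ (v = w ∨ v = -w)) ∨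
    ∃ i, ∃ y ∈ pillar L e i, v = e i + y ∨ v = -(e i + y) := by
  have hen : ∀ i, ⟪e i, e i⟫_ℝ = 1 := fun i => by
    rw [real_inner_self_eq_norm_mul_norm, he.1 i, one_mul]
  have heo : ∀ i j, i ≠ j → ⟪e i, e j⟫_ℝ = 0 := fun i j hij => he.2 hij
  rcases hL.inner_lineVectors h₁ hv with h | h | h1
  · exact Or.inl ⟨_, Or.inl rfl, Or.inl h⟩
  · exact Or.inl ⟨_, Or.inl rfl, Or.inr h⟩
  rcases hL.inner_lineVectors h₂ hv with h | h | h2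
  · exact Or.inl ⟨_, Or.inr (Or.inl rfl), Or.inl h⟩
  · exact Or.inl ⟨_, Or.inr (Or.inl rfl), Or.inr h⟩
  rcases hL.inner_lineVectors h₃ hv with h | h | h3
  · exact Or.inl ⟨_, Or.inr (Or.inr (Or.inl rfl)), Or.inl h⟩
  · exact Or.inl ⟨_, Or.inr (Or.inr (Or.inl rfl)), Or.inr h⟩
  have h4n : ⟪-e 0 - e 1 + e 2, -e 0 - e 1 + e 2⟫_ℝ = 3 := by
    simp only [inner_add_left, inner_add_right, inner_sub_left, inner_sub_right, inner_neg_left,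
      inner_neg_right, hen, heo 0 1 (by decide), heo 0 2 (by decide), heo 1 0 (by decide),
      heo 1 2 (by decide), heo 2 0 (by decide), heo 2 1 (by decide)]
    norm_num
  -- The fourth diagonal is minus the sum of the other three, so its inner product with `v` is minus
  -- a sum of three signs. The values `±3` are the equality case of Cauchy–Schwarz.
  have h4 : ⟪-e 0 - e 1 + e 2, v⟫_ℝ = 3 ∨ ⟪-e 0 - e 1 + e 2, v⟫_ℝ = -3 →
      ∃ w, (w = e 0 + e 1 + e 2 ∨ w = e 0 - e 1 - e 2 ∨ w = -e 0 + e 1 - e 2 ∨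
      w = -e 0 - e 1 + e 2) ∧ (v = w ∨ v = -w) := by
    rintro (h | h)
    · exact ⟨_, Or.inr (Or.inr (Or.inr rfl)), Or.inl (eq_of_inner_eq h4n hv.1 h)⟩
    · exact ⟨_, Or.inr (Or.inr (Or.inr rfl)), Or.inr (eq_neg_of_inner_eq h4n hv.1 h)⟩
  simp only [inner_add_left, inner_sub_left, inner_neg_left] at h1 h2 h3 h4
  have hp : ∀ i, (⟪e i, v⟫_ℝ = 1 ∨ ⟪e i, v⟫_ℝ = -1) → (∀ j, j ≠ i → ⟪e j, v⟫_ℝ = 0) →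
      ∃ i, ∃ y ∈ pillar L e i, v = e i + y ∨ v = -(e i + y) := fun i h h' =>
    ⟨i, mem_pillar_of_inner he hv h h'⟩
  have hj : ∀ {i : Fin 3} {P : Fin 3 → Prop}, P (i + 1) → P (i + 2) → ∀ j, j ≠ i → P j := by
    intro i P h1 h2 j hj
    have : j = i + 1 ∨ j = i + 2 := by omega
    rcases this with rfl | rfl <;> assumption
  -- Equal signs on the three diagonals give the fourth diagonal. In the six mixed cases `v` has
  -- coordinate `±1` on one axis and 0 on the other two.
  rcases h1 with h1 | h1 <;> rcases h2 with h2 | h2 <;> rcases h3 with h3 | h3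
  · exact Or.inl (h4 (by right; linarith))
  · exact Or.inr (hp 0 (by left; linarith) (hj (show ⟪e 1, v⟫_ℝ = 0 by linarith)
      (show ⟪e 2, v⟫_ℝ = 0 by linarith)))
  · exact Or.inr (hp 1 (by left; linarith) (hj (show ⟪e 2, v⟫_ℝ = 0 by linarith)
      (show ⟪e 0, v⟫_ℝ = 0 by linarith)))
  · exact Or.inr (hp 2 (by left; linarith) (hj (show ⟪e 0, v⟫_ℝ = 0 by linarith)
      (show ⟪e 1, v⟫_ℝ = 0 by linarith)))
  · exact Or.inr (hp 2 (by right; linarith) (hj (show ⟪e 0, v⟫_ℝ = 0 by linarith)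
      (show ⟪e 1, v⟫_ℝ = 0 by linarith)))
  · exact Or.inr (hp 1 (by right; linarith) (hj (show ⟪e 2, v⟫_ℝ = 0 by linarith)
      (show ⟪e 0, v⟫_ℝ = 0 by linarith)))
  · exact Or.inr (hp 0 (by right; linarith) (hj (show ⟪e 1, v⟫_ℝ = 0 by linarith)
      (show ⟪e 2, v⟫_ℝ = 0 by linarith)))
  · exact Or.inl (h4 (by left; linarith))

theorem span_neg_singleton (x : E) : Submodule.span ℝ {-x} = Submodule.span ℝ {x} := by
  rw [← Set.neg_singleton, Submodule.span_neg]

/-- The sharper bound without the fourth diagonal serves the equality case, where it forces that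
diagonal to be present. -/
theorem IsEquiangular.encard_le_pillars {L : Set (Submodule ℝ E)}
    (hL : IsEquiangular L (Real.arccos (1 / 3))) {e : Fin 3 → E} (he : Orthonormal ℝ e)
    (h₁ : e 0 + e 1 + e 2 ∈ lineVectors L) (h₂ : e 0 - e 1 - e 2 ∈ lineVectors L)
    (h₃ : -e 0 + e 1 - e 2 ∈ lineVectors L) :
    L.encard ≤ 4 + ((pillar L e 0).encard + (pillar L e 1).encard + (pillar L e 2).encard) ∧
    (-e 0 - e 1 + e 2 ∉ lineVectors L →
      L.encard ≤ 3 + ((pillar L e 0).encard + (pillar L e 1).encard + (pillar L e 2).encard)) := by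
  classical
  set s : E → Submodule ℝ E := fun x => Submodule.span ℝ {x} with hs
  set Q : Set (Submodule ℝ E) := ((fun y => s (e 0 + y)) '' pillar L e 0 ∪
    (fun y => s (e 1 + y)) '' pillar L e 1) ∪ (fun y => s (e 2 + y)) '' pillar L e 2 with hQ
  have hQc : Q.encard ≤ (pillar L e 0).encard + (pillar L e 1).encard + (pillar L e 2).encard :=
    (Set.encard_union_le _ _).trans (add_le_add ((Set.encard_union_le _ _).trans
      (add_le_add (Set.encard_image_le _ _) (Set.encard_image_le _ _))) (Set.encard_image_le _ _))
  have hcov : ∀ l ∈ L, (l = s (e 0 + e 1 + e 2) ∨ l = s (e 0 - e 1 - e 2) ∨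
      l = s (-e 0 + e 1 - e 2) ∨ l = s (-e 0 - e 1 + e 2)) ∨ l ∈ Q := by
    intro l hl
    obtain ⟨v, hv, rfl⟩ := hL.exists_lineVector hl
    rcases hL.eq_diagonal_or_mem_pillar he h₁ h₂ h₃ hv with ⟨w, hw, hvw⟩ | ⟨i, y, hy, hvy⟩
    · left
      have : Submodule.span ℝ {v} = s w := by
        rcases hvw with rfl | rfl
        · rfl
        · exact span_neg_singleton w
      rw [this]
      rcases hw with rfl | rfl | rfl | rfl <;> simp
    · right
      have : Submodule.span ℝ {v} = s (e i + y) := by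
        rcases hvy with rfl | rfl
        · rfl
        · exact span_neg_singleton _
      rw [this]
      fin_cases i
      · exact Or.inl (Or.inl ⟨y, hy, rfl⟩)
      · exact Or.inl (Or.inr ⟨y, hy, rfl⟩)
      · exact Or.inr ⟨y, hy, rfl⟩
  constructor
  · have hsub : L ⊆ (({s (e 0 + e 1 + e 2), s (e 0 - e 1 - e 2), s (-e 0 + e 1 - e 2),
        s (-e 0 - e 1 + e 2)} : Finset (Submodule ℝ E)) : Set (Submodule ℝ E)) ∪ Q := by
      intro l hl
      rcases hcov l hl with h | h
      · left
        simpa using h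
      · exact Or.inr h
    refine (Set.encard_le_encard hsub).trans ((Set.encard_union_le _ _).trans (add_le_add ?_ hQc))
    rw [Set.encard_coe_eq_coe_finsetCard]
    exact_mod_cast Finset.card_le_four
  · intro h4
    have hsub : L ⊆ (({s (e 0 + e 1 + e 2), s (e 0 - e 1 - e 2), s (-e 0 + e 1 - e 2)} :
        Finset (Submodule ℝ E)) : Set (Submodule ℝ E)) ∪ Q := by
      intro l hl
      rcases hcov l hl with (h | h | h | h) | h
      · left
        simp [h]
      · left
        simp [h]
      · left
        simp [h]
      · exfalso
        refine h4 ⟨?_, show s _ ∈ L from h ▸ hl⟩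
        have hen : ∀ i, ⟪e i, e i⟫_ℝ = 1 := fun i => by
          rw [real_inner_self_eq_norm_mul_norm, he.1 i, one_mul]
        have heo : ∀ i j, i ≠ j → ⟪e i, e j⟫_ℝ = 0 := fun i j hij => he.2 hij
        simp only [inner_add_left, inner_add_right, inner_sub_left, inner_sub_right,
          inner_neg_left, inner_neg_right, hen, heo 0 1 (by decide), heo 0 2 (by decide),
          heo 1 0 (by decide), heo 1 2 (by decide), heo 2 0 (by decide), heo 2 1 (by decide)]
        norm_num
      · exact Or.inr h
    refine (Set.encard_le_encard hsub).trans ((Set.encard_union_le _ _).trans (add_le_add ?_ hQc))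
    rw [Set.encard_coe_eq_coe_finsetCard]
    exact_mod_cast Finset.card_le_three

/-- The axes are, up to sign, half-sums of the three given diagonals, so they lie in the span. The
pillars span a complement orthogonal to them. -/
theorem IsEquiangular.finrank_span_eq_add [FiniteDimensional ℝ E] {L : Set (Submodule ℝ E)}
    (hL : IsEquiangular L (Real.arccos (1 / 3))) {e : Fin 3 → E} (he : Orthonormal ℝ e)
    (h₁ : e 0 + e 1 + e 2 ∈ lineVectors L) (h₂ : e 0 - e 1 - e 2 ∈ lineVectors L)
    (h₃ : -e 0 + e 1 - e 2 ∈ lineVectors L) :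
    Module.finrank ℝ (Submodule.span ℝ (lineVectors L)) =
      3 + Module.finrank ℝ (Submodule.span ℝ (⋃ k, pillar L e k)) := by
  set A := Submodule.span ℝ (Set.range e) with hA
  set B := Submodule.span ℝ (⋃ k, pillar L e k) with hB
  have heA : ∀ i, e i ∈ A := fun i => Submodule.subset_span ⟨i, rfl⟩
  have hX : ∀ x ∈ lineVectors L, x ∈ Submodule.span ℝ (lineVectors L) := fun x hx =>
    Submodule.subset_span hx
  have heX : ∀ i, e i ∈ Submodule.span ℝ (lineVectors L) := by
    intro i
    fin_cases i
    · have : e 0 = (1 / 2 : ℝ) • ((e 0 + e 1 + e 2) + (e 0 - e 1 - e 2)) := by module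
      exact this ▸ Submodule.smul_mem _ _ (Submodule.add_mem _ (hX _ h₁) (hX _ h₂))
    · have : e 1 = (1 / 2 : ℝ) • ((e 0 + e 1 + e 2) + (-e 0 + e 1 - e 2)) := by module
      exact this ▸ Submodule.smul_mem _ _ (Submodule.add_mem _ (hX _ h₁) (hX _ h₃))
    · have : e 2 = (-1 / 2 : ℝ) • ((e 0 - e 1 - e 2) + (-e 0 + e 1 - e 2)) := by module
      exact this ▸ Submodule.smul_mem _ _ (Submodule.add_mem _ (hX _ h₂) (hX _ h₃))
  have hsup : Submodule.span ℝ (lineVectors L) = A ⊔ B := by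
    apply le_antisymm
    · refine Submodule.span_le.2 fun v hv => ?_
      rcases hL.eq_diagonal_or_mem_pillar he h₁ h₂ h₃ hv with ⟨w, hw, hvw⟩ | ⟨i, y, hy, hvy⟩
      · have hwA : w ∈ A := by
          rcases hw with rfl | rfl | rfl | rfl
          · exact Submodule.add_mem _ (Submodule.add_mem _ (heA 0) (heA 1)) (heA 2)
          · exact Submodule.sub_mem _ (Submodule.sub_mem _ (heA 0) (heA 1)) (heA 2)
          · exact Submodule.sub_mem _ (Submodule.add_mem _ (Submodule.neg_mem _ (heA 0)) (heA 1))
              (heA 2)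
          · exact Submodule.add_mem _ (Submodule.sub_mem _ (Submodule.neg_mem _ (heA 0)) (heA 1))
              (heA 2)
        refine Submodule.mem_sup_left ?_
        rcases hvw with rfl | rfl
        · exact hwA
        · exact Submodule.neg_mem _ hwA
      · have hyB : e i + y ∈ A ⊔ B := Submodule.add_mem _ (Submodule.mem_sup_left (heA i))
          (Submodule.mem_sup_right (Submodule.subset_span (Set.mem_iUnion.2 ⟨i, hy⟩)))
        rcases hvy with rfl | rfl
        · exact hyB
        · exact Submodule.neg_mem _ hyB
    · refine sup_le (Submodule.span_le.2 ?_) (Submodule.span_le.2 ?_)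
      · rintro _ ⟨i, rfl⟩
        exact heX i
      · intro y hy
        obtain ⟨i, hy⟩ := Set.mem_iUnion.1 hy
        have := Submodule.sub_mem _ (hX _ hy.2) (heX i)
        rwa [add_sub_cancel_left] at this
  have hdis : A ⊓ B = ⊥ := by
    rw [eq_bot_iff]
    rintro x ⟨hxA, hxB⟩
    rw [Submodule.mem_bot]
    refine eq_zero_of_mem_span_of_inner_eq_zero hxA ?_
    rintro _ ⟨i, rfl⟩
    have hker : B ≤ LinearMap.ker (innerₛₗ ℝ (e i)) := by
      refine Submodule.span_le.2 fun y hy => ?_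
      obtain ⟨k, hy⟩ := Set.mem_iUnion.1 hy
      exact hy.1 i
    exact hker hxB
  have hfin := Submodule.finrank_sup_add_finrank_inf_eq A B
  rw [hdis, finrank_bot, add_zero, hA, finrank_span_eq_card he.linearIndependent,
    Fintype.card_fin] at hfin
  rw [hsup, ← hfin]

end Pillars

/-! ### Vector representations of the line graphs. -/

section LineGraphs

variable {E : Type*} [NormedAddCommGroup E] [InnerProductSpace ℝ E]

/-- The sum of the vectors of the two ends of an edge. -/
def edgeVector {V : Type*} (φ : V → E) : Sym2 V → E :=
  Sym2.lift ⟨fun x y => φ x + φ y, fun _ _ => add_comm _ _⟩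

omit [InnerProductSpace ℝ E] in
@[simp]
theorem edgeVector_mk {V : Type*} (φ : V → E) (x y : V) : edgeVector φ s(x, y) = φ x + φ y := rfl

/-- The inner products of a family of vectors represent a graph if they are `3` on the diagonal,
`1` on the edges and `-1` elsewhere. -/
structure Represents {V : Type*} (H : SimpleGraph V) (u : V → E) : Prop where
  self : ∀ v, ⟪u v, u v⟫_ℝ = 3
  adj : ∀ v w, H.Adj v w → ⟪u v, u w⟫_ℝ = 1
  not_adj : ∀ v w, v ≠ w → ¬ H.Adj v w → ⟪u v, u w⟫_ℝ = -1

theorem Represents.inner_eq {V : Type*} {H : SimpleGraph V} {u : V → E} (hu : Represents H u)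
    {v w : V} (h : v ≠ w) : ⟪u v, u w⟫_ℝ = 1 ∨ ⟪u v, u w⟫_ℝ = -1 := by
  by_cases h' : H.Adj v w
  · exact Or.inl (hu.adj v w h')
  · exact Or.inr (hu.not_adj v w h h')

/-- More lines than dimensions means a linear relation, which makes 3 an eigenvalue and not merely
an upper bound. -/
theorem Represents.isInducedBySwitchingClass [FiniteDimensional ℝ E] {V : Type*} [Finite V]
    {H : SimpleGraph V} {u : V → E} (hu : Represents H u) {L : Set (Submodule ℝ E)}
    (hmem : ∀ v, u v ∈ lineVectors L) (hcard : L.encard = Nat.card V)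
    (hlt : Module.finrank ℝ (Submodule.span ℝ (lineVectors L)) < Nat.card V) :
    IsInducedBySwitchingClass L H := by
  refine isInducedBySwitchingClass_of_gram u hu.self hu.adj hu.not_adj (fun v => (hmem v).2)
    hcard ?_
  intro hli
  have := Fintype.ofFinite V
  have h1 := finrank_span_eq_card hli
  have h2 : Submodule.span ℝ (Set.range u) ≤ Submodule.span ℝ (lineVectors L) := by
    refine Submodule.span_mono ?_
    rintro _ ⟨v, rfl⟩
    exact hmem v
  have := Submodule.finrank_mono h2
  rw [Nat.card_eq_fintype_card] at hlt
  omega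

theorem Represents.mem_equiangularCards {d r : ℕ} {V : Type*} [Finite V] {H : SimpleGraph V}
    {u : V → EuclideanSpace ℝ (Fin d)} (hu : Represents H u)
    (hr : Module.finrank ℝ (Submodule.span ℝ (Set.range u)) = r) :
    (Nat.card V : ℕ∞) ∈ equiangularCards (1 / 3) r := by
  refine ⟨d, Set.range fun v => Submodule.span ℝ {u v},
    isEquiangular_range u hu.self fun v w h => hu.inner_eq h, ?_, ?_⟩
  · rw [lineRank_range_span, hr]
  · rw [encard_range_span u hu.self fun v w h => hu.inner_eq h, ENat.card_eq_coe_natCard]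

theorem card_edgeSet_completeK (n : ℕ) : Nat.card (completeK n).edgeSet = n.choose 2 := by
  classical
  rw [Nat.card_eq_fintype_card, ← SimpleGraph.edgeFinset_card]
  have := SimpleGraph.card_edgeFinset_top_eq_card_choose_two (V := Fin n)
  rw [Fintype.card_fin] at this
  rw [← this]

/-- The inner product of two edge sums is `14/4 - 2/4 = 3` for equal edges, `7/4 - 3/4 = 1` for
edges sharing one end and `-4/4 = -1` for disjoint edges. -/
theorem represents_lineGraph_completeK {n : ℕ} {φ : Fin n → E}
    (hφ : ∀ i j, ⟪φ i, φ j⟫_ℝ = if i = j then 7 / 4 else -1 / 4) :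
    Represents (completeK n).lineGraph
      (fun e : (completeK n).edgeSet => edgeVector φ (e : Sym2 (Fin n))) := by
  refine ⟨?_, ?_, ?_⟩
  · rintro ⟨e, he⟩
    induction e using Sym2.ind with
    | _ x y =>
      have hxy : x ≠ y := he
      simp only [edgeVector_mk, inner_add_left, inner_add_right, hφ, hxy, hxy.symm, if_true,
        if_false]
      norm_num
  · intro e f hef
    obtain ⟨hne, v, hv, hv'⟩ := SimpleGraph.lineGraph_adj_iff_exists.1 hef
    obtain ⟨e, he⟩ := e
    obtain ⟨f, hf⟩ := f
    obtain ⟨x, rfl⟩ := hv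
    obtain ⟨y, rfl⟩ := hv'
    have hvx : v ≠ x := he
    have hvy : v ≠ y := hf
    have hxy : x ≠ y := by
      rintro rfl
      exact hne rfl
    simp only [edgeVector_mk, inner_add_left, inner_add_right, hφ, hxy, hvx.symm, hvy, if_true,
      if_false]
    norm_num
  · rintro ⟨e, he⟩ ⟨f, hf⟩ hne hadj
    induction e using Sym2.ind with
    | _ x y =>
      induction f using Sym2.ind with
      | _ z w =>
        have hno : ∀ v, v ∈ s(x, y) → v ∈ s(z, w) → False := fun v hv hv' =>
          hadj (SimpleGraph.lineGraph_adj_iff_exists.2 ⟨hne, v, hv, hv'⟩)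
        have hxz : x ≠ z := fun h => hno x (by simp) (by simp [h])
        have hxw : x ≠ w := fun h => hno x (by simp) (by simp [h])
        have hyz : y ≠ z := fun h => hno y (by simp) (by simp [h])
        have hyw : y ≠ w := fun h => hno y (by simp) (by simp [h])
        simp only [edgeVector_mk, inner_add_left, inner_add_right, hφ, hxz, hxw, hyz, hyw,
          if_false]
        norm_num

/-- The extra vector has inner product `-1/2 - 1/2 = -1` with every edge sum, so it is an isolated
vertex. -/
theorem represents_lineGraph_completeK_sum {n : ℕ} {φ : Fin n → E} {p : E}
    (hφ : ∀ i j, ⟪φ i, φ j⟫_ℝ = if i = j then 7 / 4 else -1 / 4) (hp : ⟪p, p⟫_ℝ = 3)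
    (hpφ : ∀ i, ⟪p, φ i⟫_ℝ = -1 / 2) :
    Represents ((completeK n).lineGraph ⊕g completeK 1)
      (Sum.elim (fun e : (completeK n).edgeSet => edgeVector φ (e : Sym2 (Fin n)))
        (fun _ => p)) := by
  have hK := represents_lineGraph_completeK hφ
  have hcross : ∀ e : Sym2 (Fin n), ⟪p, edgeVector φ e⟫_ℝ = -1 := by
    intro e
    induction e using Sym2.ind with
    | _ x y =>
      rw [edgeVector_mk, inner_add_right, hpφ, hpφ]
      norm_num
  refine ⟨?_, ?_, ?_⟩
  · rintro (e | i)
    · exact hK.self e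
    · exact hp
  · rintro (e | i) (f | j) h
    · exact hK.adj e f (by simpa using h)
    · simp at h
    · simp at h
    · exact absurd (Subsingleton.elim i j) (by
        rintro rfl
        exact SimpleGraph.irrefl _ h)
  · rintro (e | i) (f | j) hne h
    · exact hK.not_adj e f (fun h' => hne (by rw [h'])) (by simpa using h)
    · simp only [Sum.elim_inl, Sum.elim_inr]
      rw [real_inner_comm]
      exact hcross e
    · exact hcross f
    · exact absurd (congrArg Sum.inr (Subsingleton.elim i j)) hne

/-- The ends of an edge contribute independently: `±1` from the side `±e`, and `2` or `0` from the
frame `g`. -/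
theorem represents_lineGraph_completeBipartiteK {n : ℕ} {e : E} {g : Fin n → E}
    (he : ⟪e, e⟫_ℝ = 1) (heg : ∀ j, ⟪e, g j⟫_ℝ = 0)
    (hg : ∀ i j, ⟪g i, g j⟫_ℝ = if i = j then 2 else 0) :
    Represents (completeBipartiteK 2 n).lineGraph
      (fun x : (completeBipartiteK 2 n).edgeSet =>
        edgeVector (Sum.elim ![e, -e] g) (x : Sym2 (Fin 2 ⊕ Fin n))) := by
  have hge : ∀ j, ⟪g j, e⟫_ℝ = 0 := fun j => by rw [real_inner_comm, heg]
  have hs : ∀ a b : Fin 2, ⟪(![e, -e] : Fin 2 → E) a, (![e, -e] : Fin 2 → E) b⟫_ℝ =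
      if a = b then 1 else -1 := by
    intro a b
    fin_cases a <;> fin_cases b <;>
      simp only [Fin.zero_eta, Fin.mk_one, Matrix.cons_val, inner_neg_left, inner_neg_right, he] <;>
      norm_num
  have hs0 : ∀ (a : Fin 2) (j : Fin n), ⟪(![e, -e] : Fin 2 → E) a, g j⟫_ℝ = 0 := by
    intro a j
    fin_cases a <;>
      simp only [Fin.zero_eta, Fin.mk_one, Matrix.cons_val, inner_neg_left, heg] <;> norm_num
  have hs0' : ∀ (a : Fin 2) (j : Fin n), ⟪g j, (![e, -e] : Fin 2 → E) a⟫_ℝ = 0 := by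
    intro a j
    rw [real_inner_comm, hs0]
  have hform : ∀ x : (completeBipartiteK 2 n).edgeSet, ∃ a j,
      (x : Sym2 (Fin 2 ⊕ Fin n)) = s(Sum.inl a, Sum.inr j) := by
    rintro ⟨x, hx⟩
    rw [SimpleGraph.edgeSet_completeBipartiteGraph] at hx
    obtain ⟨⟨a, j⟩, rfl⟩ := hx
    exact ⟨a, j, rfl⟩
  have hinner : ∀ a b i j, ⟪edgeVector (Sum.elim ![e, -e] g) s(Sum.inl a, Sum.inr i),
      edgeVector (Sum.elim ![e, -e] g) s(Sum.inl b, Sum.inr j)⟫_ℝ =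
      (if a = b then 1 else -1) + (if i = j then 2 else 0) := by
    intro a b i j
    simp only [edgeVector_mk, Sum.elim_inl, Sum.elim_inr, inner_add_left, inner_add_right, hs, hg,
      hs0, hs0']
    ring
  refine ⟨?_, ?_, ?_⟩
  · intro x
    obtain ⟨a, i, hx⟩ := hform x
    rw [hx, hinner, if_pos rfl, if_pos rfl]
    norm_num
  · intro x y hxy
    obtain ⟨hne, v, hv, hv'⟩ := SimpleGraph.lineGraph_adj_iff_exists.1 hxy
    obtain ⟨a, i, hx⟩ := hform x
    obtain ⟨b, j, hy⟩ := hform y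
    have hne' : ¬ (a = b ∧ i = j) := by
      rintro ⟨rfl, rfl⟩
      exact hne (Subtype.ext (hx.trans hy.symm))
    rw [hx, Sym2.mem_iff] at hv
    rw [hy, Sym2.mem_iff] at hv'
    rw [hx, hy, hinner]
    rcases hv with rfl | rfl <;> rcases hv' with h | h
    · have hab := Sum.inl_injective h
      have hij : i ≠ j := fun h => hne' ⟨hab, h⟩
      rw [if_pos hab, if_neg hij]
      norm_num
    · exact absurd h (by simp)
    · exact absurd h (by simp)
    · have hij := Sum.inr_injective h
      have hab : a ≠ b := fun h => hne' ⟨h, hij⟩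
      rw [if_neg hab, if_pos hij]
      norm_num
  · intro x y hne hxy
    obtain ⟨a, i, hx⟩ := hform x
    obtain ⟨b, j, hy⟩ := hform y
    have hno : ∀ v, v ∈ (x : Sym2 (Fin 2 ⊕ Fin n)) → v ∈ (y : Sym2 (Fin 2 ⊕ Fin n)) → False :=
      fun v hv hv' => hxy (SimpleGraph.lineGraph_adj_iff_exists.2 ⟨hne, v, hv, hv'⟩)
    have hab : a ≠ b := by
      rintro rfl
      exact hno (Sum.inl a) (by simp [hx]) (by simp [hy])
    have hij : i ≠ j := by
      rintro rfl
      exact hno (Sum.inr i) (by simp [hx]) (by simp [hy])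
    rw [hx, hy, hinner, if_neg hab, if_neg hij]
    norm_num

theorem card_edgeSet_completeBipartiteK (n : ℕ) :
    Nat.card (completeBipartiteK 2 n).edgeSet = 2 * n := by
  have h := SimpleGraph.encard_edgeSet_completeBipartiteGraph (W₁ := Fin 2) (W₂ := Fin n)
  rw [ENat.card_eq_coe_fintype_card, ENat.card_eq_coe_fintype_card, Fintype.card_fin,
    Fintype.card_fin] at h
  rw [Nat.card_coe_set_eq, Set.ncard, h]
  exact_mod_cast ENat.toNat_natCast (2 * n)

/-- The vectors `p k / 2 ± a k`. -/
noncomputable def halfVector {m : ℕ} (p a : Fin m → E) (x : Fin m × Bool) : E :=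
  (1 / 2 : ℝ) • p x.1 + (if x.2 then (1 : ℝ) else -1) • a x.1

/-- The values are `3/4 ± 1` for equal index and `-1/4` otherwise, exactly the Gram matrix `2I -
J/4`. -/
theorem inner_halfVector {m : ℕ} {p a : Fin m → E}
    (hp : ∀ k l, ⟪p k, p l⟫_ℝ = if k = l then 3 else -1) (ha : Orthonormal ℝ a)
    (hpa : ∀ k l, ⟪p k, a l⟫_ℝ = 0) (x y : Fin m × Bool) :
    ⟪halfVector p a x, halfVector p a y⟫_ℝ = if x = y then 7 / 4 else -1 / 4 := by
  obtain ⟨k, σ⟩ := x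
  obtain ⟨l, τ⟩ := y
  have hap : ⟪a k, p l⟫_ℝ = 0 := by rw [real_inner_comm, hpa]
  simp only [halfVector, inner_add_left, inner_add_right, real_inner_smul_left,
    real_inner_smul_right, hp, hpa, hap, Prod.mk.injEq]
  by_cases hkl : k = l
  · subst hkl
    have haa : ⟪a k, a k⟫_ℝ = 1 := by rw [real_inner_self_eq_norm_mul_norm, ha.1 k, one_mul]
    rw [haa]
    cases σ <;> cases τ <;> simp <;> norm_num
  · rw [ha.2 hkl]
    simp [hkl]
    norm_num

/-- The two half vectors of one index add up to the diagonal `p k`. Those of two indices give half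
the sum of two diagonals plus a signed sum of axes. -/
theorem halfVector_add_mem {m : ℕ} {p a : Fin m → E} {X : Set E} (hp : ∀ k, p k ∈ X)
    (h : ∀ k l, k ≠ l → ∀ σ τ : ℝ, (σ = 1 ∨ σ = -1) → (τ = 1 ∨ τ = -1) →
      (1 / 2 : ℝ) • (p k + p l) + σ • a k + τ • a l ∈ X) {x y : Fin m × Bool} (hxy : x ≠ y) :
    halfVector p a x + halfVector p a y ∈ X := by
  obtain ⟨k, σ⟩ := x
  obtain ⟨l, τ⟩ := y
  by_cases hkl : k = l
  · subst hkl
    have : halfVector p a (k, σ) + halfVector p a (k, τ) = p k := by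
      simp only [halfVector]
      cases σ <;> cases τ
      · exact absurd rfl hxy
      · simp only [Bool.false_eq_true, if_false, if_true]
        module
      · simp only [Bool.false_eq_true, if_false, if_true]
        module
      · exact absurd rfl hxy
    rw [this]
    exact hp k
  · have := h k l hkl (if σ then 1 else -1) (if τ then 1 else -1) (by cases σ <;> simp)
      (by cases τ <;> simp)
    convert this using 1
    simp only [halfVector]
    module

/-- The diagonals of a cube. -/
def cubeDiagonal (e : Fin 3 → E) : Fin 4 → E :=
  ![e 0 + e 1 + e 2, e 0 - e 1 - e 2, -e 0 + e 1 - e 2, -e 0 - e 1 + e 2]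

theorem inner_cubeDiagonal {e : Fin 3 → E} (he : Orthonormal ℝ e) (k l : Fin 4) :
    ⟪cubeDiagonal e k, cubeDiagonal e l⟫_ℝ = if k = l then 3 else -1 := by
  have hen : ∀ i, ⟪e i, e i⟫_ℝ = 1 := fun i => by
    rw [real_inner_self_eq_norm_mul_norm, he.1 i, one_mul]
  have heo : ∀ i j, i ≠ j → ⟪e i, e j⟫_ℝ = 0 := fun i j hij => he.2 hij
  fin_cases k <;> fin_cases l <;>
    simp only [cubeDiagonal, Fin.zero_eta, Fin.mk_one, Fin.reduceFinMk, Matrix.cons_val,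
      inner_add_left, inner_add_right, inner_sub_left, inner_sub_right, inner_neg_left,
      inner_neg_right, hen, heo 0 1 (by decide), heo 0 2 (by decide), heo 1 0 (by decide),
      heo 1 2 (by decide), heo 2 0 (by decide), heo 2 1 (by decide)] <;> norm_num <;> decide

theorem inner_cubeDiagonal_of_orthogonal {e : Fin 3 → E} {x : E} (h : ∀ i, ⟪e i, x⟫_ℝ = 0)
    (k : Fin 4) : ⟪cubeDiagonal e k, x⟫_ℝ = 0 := by
  fin_cases k <;>
    simp [cubeDiagonal, inner_add_left, inner_sub_left, h]

/-- Vectors representing `L(K₅)` as sums of two, from a cube and two roots. -/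
noncomputable def pentadVector (e : Fin 3 → E) (a b : E) : Fin 5 → E :=
  ![(1 / 2 : ℝ) • (e 1 + (a - b)) + e 0, (1 / 2 : ℝ) • (e 1 - (a - b)) + e 2,
    (1 / 2 : ℝ) • (e 1 + (a - b)) - e 0, (1 / 2 : ℝ) • (e 1 - (a - b)) - e 2,
    a - (1 / 2 : ℝ) • (e 1 + (a - b))]

/-- With `u, w = ½(e 1 ± (a - b))` one has `‖u‖² = ‖w‖² = 3/4` and `⟪u, w⟫ = -1/4`, so `u ± e 0` and
`w ± e 2` behave like half vectors. The fifth vector `a - u` works because `⟪a, u⟫ = 1/2` and `⟪a,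
w⟫ = -1/2`. -/
theorem inner_pentadVector {e : Fin 3 → E} (he : Orthonormal ℝ e) {a b : E}
    (hea : ∀ i, ⟪e i, a⟫_ℝ = 0) (heb : ∀ i, ⟪e i, b⟫_ℝ = 0) (haa : ⟪a, a⟫_ℝ = 2)
    (hbb : ⟪b, b⟫_ℝ = 2) (hab : ⟪a, b⟫_ℝ = 1) (k l : Fin 5) :
    ⟪pentadVector e a b k, pentadVector e a b l⟫_ℝ = if k = l then 7 / 4 else -1 / 4 := by
  have hen : ∀ i, ⟪e i, e i⟫_ℝ = 1 := fun i => by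
    rw [real_inner_self_eq_norm_mul_norm, he.1 i, one_mul]
  have heo : ∀ i j, i ≠ j → ⟪e i, e j⟫_ℝ = 0 := fun i j hij => he.2 hij
  have hae : ∀ i, ⟪a, e i⟫_ℝ = 0 := fun i => by rw [real_inner_comm, hea]
  have hbe : ∀ i, ⟪b, e i⟫_ℝ = 0 := fun i => by rw [real_inner_comm, heb]
  have hba : ⟪b, a⟫_ℝ = 1 := by rw [real_inner_comm, hab]
  fin_cases k <;> fin_cases l <;>
    simp only [pentadVector, Fin.zero_eta, Fin.mk_one, Fin.reduceFinMk, Matrix.cons_val,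
      inner_add_left, inner_add_right, inner_sub_left, inner_sub_right, real_inner_smul_left,
      real_inner_smul_right, hen, heo 0 1 (by decide), heo 0 2 (by decide), heo 1 0 (by decide),
      heo 1 2 (by decide), heo 2 0 (by decide), heo 2 1 (by decide), hea, heb, hae, hbe, haa, hbb,
      hab, hba] <;> norm_num <;> decide

theorem forall_ne_fin_five {P : Fin 5 → Fin 5 → Prop} (symm : ∀ i j, P i j → P j i) (h01 : P 0 1)
    (h02 : P 0 2) (h03 : P 0 3) (h04 : P 0 4) (h12 : P 1 2) (h13 : P 1 3) (h14 : P 1 4)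
    (h23 : P 2 3) (h24 : P 2 4) (h34 : P 3 4) (i j : Fin 5) (hij : i ≠ j) : P i j := by
  fin_cases i <;> fin_cases j <;>
    first
      | exact absurd rfl hij
      | assumption
      | (apply symm; assumption)

theorem forall_ne_fin_four {P : Fin 4 → Fin 4 → Prop} (symm : ∀ i j, P i j → P j i) (h01 : P 0 1)
    (h02 : P 0 2) (h03 : P 0 3) (h12 : P 1 2) (h13 : P 1 3) (h23 : P 2 3) (i j : Fin 4)
    (hij : i ≠ j) : P i j := by
  fin_cases i <;> fin_cases j <;>
    first
      | exact absurd rfl hij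
      | assumption
      | (apply symm; assumption)

theorem forall_ne_fin_three {P : Fin 3 → Fin 3 → Prop} (symm : ∀ i j, P i j → P j i) (h01 : P 0 1)
    (h02 : P 0 2) (h12 : P 1 2) (i j : Fin 3) (hij : i ≠ j) : P i j := by
  fin_cases i <;> fin_cases j <;>
    first
      | exact absurd rfl hij
      | assumption
      | (apply symm; assumption)

end LineGraphs

/-! ### Configurations that attain the maximum. -/

section Examples

variable {E : Type*} [NormedAddCommGroup E] [InnerProductSpace ℝ E]

/-- `2I - J/4` has the eigenvalue `2 - n/4` on the all-ones vector and 2 on its complement. It first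
becomes singular at `n = 8`. -/
theorem linearIndependent_of_inner_eq_quarters {n : ℕ} (hn : n < 8) {φ : Fin n → E}
    (hφ : ∀ i j, ⟪φ i, φ j⟫_ℝ = if i = j then 7 / 4 else -1 / 4) : LinearIndependent ℝ φ := by
  rw [Fintype.linearIndependent_iff]
  intro c hc
  have hi : ∀ i, 2 * c i + -(1 / 4) * ∑ j, c j = 0 := by
    intro i
    have h0 : ⟪φ i, ∑ j, c j • φ j⟫_ℝ = 0 := by rw [hc, inner_zero_right]
    rw [inner_sum] at h0
    rw [← h0]
    have : ∀ j, ⟪φ i, c j • φ j⟫_ℝ = (if i = j then 2 * c j else 0) + -(1 / 4) * c j := by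
      intro j
      rw [real_inner_smul_right, hφ]
      split_ifs <;> ring
    simp only [this, Finset.sum_add_distrib, Finset.sum_ite_eq, Finset.mem_univ, if_true,
      Finset.mul_sum]
  have hsum : (2 - (n : ℝ) / 4) * ∑ j, c j = 0 := by
    have : ∑ i, (2 * c i + -(1 / 4) * ∑ j, c j) = 0 := Finset.sum_eq_zero fun i _ => hi i
    rw [Finset.sum_add_distrib, ← Finset.mul_sum, Finset.sum_const, nsmul_eq_mul,
      Finset.card_univ, Fintype.card_fin] at this
    linarith
  have h0 : ∑ j, c j = 0 := by
    rcases mul_eq_zero.1 hsum with h | h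
    · have : (n : ℝ) < 8 := by exact_mod_cast hn
      linarith
    · exact h
  intro i
  have := hi i
  linarith

omit [InnerProductSpace ℝ E] in
theorem edgeVector_mem_of_forall_ne {n : ℕ} {φ : Fin n → E} {X : Set E}
    (h : ∀ i j, i ≠ j → φ i + φ j ∈ X) (e : (completeK n).edgeSet) :
    edgeVector φ (e : Sym2 (Fin n)) ∈ X := by
  obtain ⟨e, he⟩ := e
  induction e using Sym2.ind with
  | _ x y => exact h x y he

/-- The three edges of a triangle recover each of its vertex vectors, which is why three vertices
are needed. -/
theorem span_range_edgeVector_completeK {n : ℕ} (hn : 3 ≤ n) (φ : Fin n → E) :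
    Submodule.span ℝ (Set.range fun e : (completeK n).edgeSet =>
      edgeVector φ (e : Sym2 (Fin n))) = Submodule.span ℝ (Set.range φ) := by
  apply le_antisymm
  · rw [Submodule.span_le]
    rintro _ ⟨e, rfl⟩
    have h : ∀ i j, i ≠ j → φ i + φ j ∈ (Submodule.span ℝ (Set.range φ) : Set E) := fun i j _ =>
      Submodule.add_mem _ (Submodule.subset_span (Set.mem_range_self i))
        (Submodule.subset_span (Set.mem_range_self j))
    exact edgeVector_mem_of_forall_ne h e
  · rw [Submodule.span_le]
    rintro _ ⟨i, rfl⟩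
    have hedge : ∀ x y : Fin n, x ≠ y → φ x + φ y ∈ Submodule.span ℝ
        (Set.range fun e : (completeK n).edgeSet => edgeVector φ (e : Sym2 (Fin n))) :=
      fun x y hxy => Submodule.subset_span ⟨⟨s(x, y), hxy⟩, rfl⟩
    have : 1 < (Finset.univ.erase i).card := by
      rw [Finset.card_erase_of_mem (Finset.mem_univ i), Finset.card_univ, Fintype.card_fin]
      omega
    obtain ⟨j, hj, k, hk, hjk⟩ := Finset.one_lt_card.1 this
    have hij : i ≠ j := (Finset.ne_of_mem_erase hj).symm
    have hik : i ≠ k := (Finset.ne_of_mem_erase hk).symm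
    have h : φ i = (1 / 2 : ℝ) • ((φ i + φ j) + (φ i + φ k) - (φ j + φ k)) := by module
    rw [h]
    exact Submodule.smul_mem _ _ (Submodule.sub_mem _
      (Submodule.add_mem _ (hedge i j hij) (hedge i k hik)) (hedge j k hjk))

theorem exists_orthonormal_pair : ∃ (e : Fin 3 → EuclideanSpace ℝ (Fin 7))
    (a : Fin 4 → EuclideanSpace ℝ (Fin 7)), Orthonormal ℝ e ∧ Orthonormal ℝ a ∧
      ∀ i k, ⟪e i, a k⟫_ℝ = 0 := by
  have hb := (EuclideanSpace.basisFun (Fin 7) ℝ).orthonormal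
  refine ⟨fun i => EuclideanSpace.basisFun (Fin 7) ℝ (Fin.castAdd 4 i),
    fun k => EuclideanSpace.basisFun (Fin 7) ℝ (Fin.natAdd 3 k),
    hb.comp _ (Fin.castAdd_injective 3 4), hb.comp _ (Fin.natAdd_injective 4 3), ?_⟩
  intro i k
  refine hb.2 ?_
  intro h
  have := congrArg Fin.val h
  simp at this
  omega

theorem inner_halfVector_comp {m n : ℕ} (f : Fin n ≃ Fin m × Bool) {p a : Fin m → E}
    (hp : ∀ k l, ⟪p k, p l⟫_ℝ = if k = l then 3 else -1) (ha : Orthonormal ℝ a)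
    (hpa : ∀ k l, ⟪p k, a l⟫_ℝ = 0) (i j : Fin n) :
    ⟪halfVector p a (f i), halfVector p a (f j)⟫_ℝ = if i = j then 7 / 4 else -1 / 4 := by
  rw [inner_halfVector hp ha hpa]
  simp only [f.injective.eq_iff]

theorem halfVector_add_neg {m : ℕ} (p a : Fin m → E) (k : Fin m) :
    halfVector p a (k, true) + halfVector p a (k, false) = p k := by
  simp only [halfVector, Bool.false_eq_true, if_false, if_true]
  module

theorem inner_cubeDiagonal_castSucc {e : Fin 3 → E} (he : Orthonormal ℝ e) (k l : Fin 3) :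
    ⟪cubeDiagonal e k.castSucc, cubeDiagonal e l.castSucc⟫_ℝ = if k = l then 3 else -1 := by
  rw [inner_cubeDiagonal he]
  simp only [Fin.castSucc_inj]

theorem inner_cubeDiagonal_three_halfVector {e : Fin 3 → E} (he : Orthonormal ℝ e)
    {a : Fin 3 → E} (hea : ∀ i k, ⟪e i, a k⟫_ℝ = 0) (x : Fin 3 × Bool) :
    ⟪cubeDiagonal e 3, halfVector (fun k => cubeDiagonal e k.castSucc) a x⟫_ℝ = -1 / 2 := by
  have hne : (3 : Fin 4) ≠ x.1.castSucc := by
    intro h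
    have := congrArg Fin.val h
    simp at this
    omega
  rw [halfVector, inner_add_right, real_inner_smul_right, real_inner_smul_right,
    inner_cubeDiagonal he, inner_cubeDiagonal_of_orthogonal (fun i => hea i x.1), if_neg hne]
  norm_num

theorem ten_mem_equiangularCards : (10 : ℕ∞) ∈ equiangularCards (1 / 3) 5 := by
  obtain ⟨e, a, he, ha, hea⟩ := exists_orthonormal_pair
  have han : ∀ i, ⟪a i, a i⟫_ℝ = 1 := fun i => by
    rw [real_inner_self_eq_norm_mul_norm, ha.1 i, one_mul]
  have hao : ∀ i j, i ≠ j → ⟪a i, a j⟫_ℝ = 0 := fun i j hij => ha.2 hij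
  -- These two differences span an `A₂` plane: squared norms 2 and inner product 1.
  have hφ := inner_pentadVector he (a := a 0 - a 1) (b := a 0 - a 2)
    (fun i => by rw [inner_sub_right, hea, hea, sub_self])
    (fun i => by rw [inner_sub_right, hea, hea, sub_self])
    (by simp only [inner_sub_left, inner_sub_right, han, hao 0 1 (by decide),
          hao 1 0 (by decide)]
        norm_num)
    (by simp only [inner_sub_left, inner_sub_right, han, hao 0 2 (by decide),
          hao 2 0 (by decide)]
        norm_num)
    (by simp only [inner_sub_left, inner_sub_right, han, hao 0 2 (by decide),
          hao 1 0 (by decide), hao 1 2 (by decide)]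
        norm_num)
  have h := (represents_lineGraph_completeK hφ).mem_equiangularCards (r := 5) (by
    rw [span_range_edgeVector_completeK (by norm_num),
      finrank_span_eq_card (linearIndependent_of_inner_eq_quarters (by norm_num) hφ),
      Fintype.card_fin])
  rw [card_edgeSet_completeK] at h
  exact_mod_cast h

theorem sixteen_mem_equiangularCards : (16 : ℕ∞) ∈ equiangularCards (1 / 3) 6 := by
  obtain ⟨e, a, he, ha, hea⟩ := exists_orthonormal_pair
  obtain ⟨f⟩ : Nonempty (Fin 6 ≃ Fin 3 × Bool) :=
    ⟨(Fintype.equivFinOfCardEq (by simp)).symm⟩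
  set p : Fin 3 → EuclideanSpace ℝ (Fin 7) := fun k => cubeDiagonal e k.castSucc with hp
  set a' : Fin 3 → EuclideanSpace ℝ (Fin 7) := fun k => a k.castSucc with ha'
  have hφ := inner_halfVector_comp f (p := p) (a := a') (inner_cubeDiagonal_castSucc he)
    (ha.comp _ (Fin.castSucc_injective 3))
    (fun k l => inner_cubeDiagonal_of_orthogonal (fun i => hea i _) _)
  have hR := represents_lineGraph_completeK_sum (p := cubeDiagonal e 3) hφ
    (by rw [inner_cubeDiagonal he, if_pos rfl])
    (fun i => inner_cubeDiagonal_three_halfVector he (fun i k => hea i _) (f i))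
  -- The fourth diagonal is minus the sum of the other three, each a sum of two half vectors, so the
  -- isolated vertex does not raise the rank.
  have hmem : cubeDiagonal e 3 ∈
      Submodule.span ℝ (Set.range fun i => halfVector p a' (f i)) := by
    have hpm : ∀ k, p k ∈ Submodule.span ℝ (Set.range fun i => halfVector p a' (f i)) := by
      intro k
      rw [← halfVector_add_neg p a' k]
      exact Submodule.add_mem _ (Submodule.subset_span ⟨f.symm (k, true), by simp⟩)
        (Submodule.subset_span ⟨f.symm (k, false), by simp⟩)
    have : cubeDiagonal e 3 = -(p 0 + p 1 + p 2) := by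
      change -e 0 - e 1 + e 2 =
        -((e 0 + e 1 + e 2) + (e 0 - e 1 - e 2) + (-e 0 + e 1 - e 2))
      module
    rw [this]
    exact Submodule.neg_mem _ (Submodule.add_mem _ (Submodule.add_mem _ (hpm 0) (hpm 1)) (hpm 2))
  have h := hR.mem_equiangularCards (r := 6) (by
    rw [Set.Sum.elim_range, Submodule.span_union, span_range_edgeVector_completeK (by norm_num),
      sup_eq_left.2 (Submodule.span_le.2 (by rintro _ ⟨_, rfl⟩; exact hmem)),
      finrank_span_eq_card (linearIndependent_of_inner_eq_quarters (by norm_num) hφ),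
      Fintype.card_fin])
  rw [Nat.card_sum, card_edgeSet_completeK] at h
  simpa [Nat.choose] using h

theorem twentyEight_mem_equiangularCards : (28 : ℕ∞) ∈ equiangularCards (1 / 3) 7 := by
  obtain ⟨e, a, he, ha, hea⟩ := exists_orthonormal_pair
  obtain ⟨f⟩ : Nonempty (Fin 8 ≃ Fin 4 × Bool) :=
    ⟨(Fintype.equivFinOfCardEq (by simp)).symm⟩
  have hφ := inner_halfVector_comp f (p := cubeDiagonal e) (inner_cubeDiagonal he) ha
    (fun k l => inner_cubeDiagonal_of_orthogonal (fun i => hea i _) _)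
  have h := (represents_lineGraph_completeK hφ).mem_equiangularCards (r := 7) (by
    rw [span_range_edgeVector_completeK (by norm_num)]
    apply le_antisymm
    · exact (Submodule.finrank_le _).trans (by simp)
    -- All eight vectors are dependent, but any seven are independent, and the ambient dimension is
    -- seven.
    · have hψ : ∀ i j : Fin 7, ⟪halfVector (cubeDiagonal e) a (f i.castSucc),
          halfVector (cubeDiagonal e) a (f j.castSucc)⟫_ℝ = if i = j then 7 / 4 else -1 / 4 := by
        intro i j
        rw [hφ]
        simp only [Fin.castSucc_inj]
      have h7 := finrank_span_eq_card (linearIndependent_of_inner_eq_quarters (by norm_num) hψ)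
      rw [Fintype.card_fin] at h7
      refine h7.ge.trans ?_
      refine Submodule.finrank_mono (Submodule.span_mono ?_)
      rintro _ ⟨i, rfl⟩
      exact ⟨i.castSucc, rfl⟩)
  rw [card_edgeSet_completeK] at h
  exact_mod_cast h

theorem two_mul_mem_equiangularCards {n : ℕ} (hn : 0 < n) :
    ((2 * n : ℕ) : ℕ∞) ∈ equiangularCards (1 / 3) (n + 1) := by
  have hb := (EuclideanSpace.basisFun (Fin (n + 1)) ℝ).orthonormal
  set b := EuclideanSpace.basisFun (Fin (n + 1)) ℝ with hbdef
  have hbn : ∀ i, ⟪b i, b i⟫_ℝ = 1 := fun i => by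
    rw [real_inner_self_eq_norm_mul_norm, hb.1 i, one_mul]
  have hs2 : Real.sqrt 2 * Real.sqrt 2 = 2 := Real.mul_self_sqrt (by norm_num)
  -- The first basis vector is the common axis; the others are scaled to squared norm 2.
  have hR := represents_lineGraph_completeBipartiteK (e := b 0)
    (g := fun j : Fin n => Real.sqrt 2 • b j.succ) (hbn 0)
    (fun j => by rw [real_inner_smul_right, hb.2 (Fin.succ_ne_zero j).symm, mul_zero])
    (fun i j => by
      rw [real_inner_smul_left, real_inner_smul_right]
      split_ifs with h
      · rw [h, hbn, mul_one, hs2]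
      · rw [hb.2 (fun h' => h (Fin.succ_injective _ h')), mul_zero, mul_zero])
  have h := hR.mem_equiangularCards (r := n + 1) (by
    set W := Submodule.span ℝ (Set.range fun x : (completeBipartiteK 2 n).edgeSet =>
      edgeVector (Sum.elim ![b 0, -b 0] fun j : Fin n => Real.sqrt 2 • b j.succ)
        (x : Sym2 (Fin 2 ⊕ Fin n))) with hW
    have hedge : ∀ (k : Fin 2) (j : Fin n),
        (![b 0, -b 0] : Fin 2 → _) k + Real.sqrt 2 • b j.succ ∈ W := by
      intro k j
      refine Submodule.subset_span ⟨⟨s(Sum.inl k, Sum.inr j), ?_⟩, rfl⟩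
      simp
    have h0 : ∀ j : Fin n, b 0 + Real.sqrt 2 • b j.succ ∈ W := fun j => hedge 0 j
    have h1 : ∀ j : Fin n, -b 0 + Real.sqrt 2 • b j.succ ∈ W := fun j => hedge 1 j
    have htop : W = ⊤ := by
      rw [eq_top_iff, ← b.toBasis.span_eq, Submodule.span_le]
      rintro _ ⟨i, rfl⟩
      rw [OrthonormalBasis.coe_toBasis]
      refine Fin.cases ?_ (fun j => ?_) i
      · have : b 0 = (1 / 2 : ℝ) • ((b 0 + Real.sqrt 2 • b (⟨0, hn⟩ : Fin n).succ) -
            (-b 0 + Real.sqrt 2 • b (⟨0, hn⟩ : Fin n).succ)) := by module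
        rw [this]
        exact Submodule.smul_mem _ _ (Submodule.sub_mem _ (h0 _) (h1 _))
      · have : b j.succ = (Real.sqrt 2 / 4) • ((b 0 + Real.sqrt 2 • b j.succ) +
            (-b 0 + Real.sqrt 2 • b j.succ)) := by
          have : (b 0 + Real.sqrt 2 • b j.succ) + (-b 0 + Real.sqrt 2 • b j.succ) =
            (2 * Real.sqrt 2) • b j.succ := by module
          rw [this, smul_smul, show Real.sqrt 2 / 4 * (2 * Real.sqrt 2) = 1 by linarith, one_smul]
        rw [this]
        exact Submodule.smul_mem _ _ (Submodule.add_mem _ (h0 _) (h1 _))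
    rw [htop, finrank_top, finrank_euclideanSpace_fin])
  rw [card_edgeSet_completeBipartiteK] at h
  exact h

end Examples

/-! ### The upper bound and the case of equality. -/

section Classification

variable {E : Type*} [NormedAddCommGroup E] [InnerProductSpace ℝ E]

/-- Negating a vector of the line system flips all three signs. As all four signs of `±a ± b` occur
in the pillar, the sign of `e i` is free too. -/
theorem signed_mem_of_signedSums_subset_pillar {L : Set (Submodule ℝ E)} {e : Fin 3 → E}
    {i : Fin 3} {a b : E} (h : signedSums a b ⊆ pillar L e i) {σ τ : ℝ}
    (hσ : σ = 1 ∨ σ = -1) (hτ : τ = 1 ∨ τ = -1) :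
    e i + σ • a + τ • b ∈ lineVectors L ∧ -e i + σ • a + τ • b ∈ lineVectors L := by
  have hneg : ∀ {c : ℝ}, (c = 1 ∨ c = -1) → (-c = 1 ∨ -c = -1) := by
    rintro c (rfl | rfl) <;> simp
  constructor
  · rw [add_assoc]
    exact (h (smul_add_smul_mem_signedSums hσ hτ)).2
  · have := neg_mem_lineVectors (h (smul_add_smul_mem_signedSums (hneg hσ) (hneg hτ))).2
    convert this using 1
    module

/-- Up to sign, the ten sums of two pentad vectors are the four diagonals and the two vectors from
each of the three pillars. -/
theorem isInduced_of_two [FiniteDimensional ℝ E] {L : Set (Submodule ℝ E)} {e : Fin 3 → E}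
    (he : Orthonormal ℝ e) (hp : ∀ k, cubeDiagonal e k ∈ lineVectors L)
    (hY : IsRootTriple (pillar L e))
    (hs : Module.finrank ℝ (Submodule.span ℝ (⋃ k, pillar L e k)) = 2)
    (hk : ∀ i, Module.finrank ℝ (Submodule.span ℝ (pillar L e i)) ≤ 1)
    (hc : ∀ i, (pillar L e i).encard = 2) (hL : L.encard = 10)
    (hr : Module.finrank ℝ (Submodule.span ℝ (lineVectors L)) = 5) :
    IsInducedBySwitchingClass L (completeK 5).lineGraph := by
  obtain ⟨a, b, haa, hbb, hab, ha, ha', hb, hb', hd, hd'⟩ :=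
    hY.exists_structure_of_two hs hk hc
  have hφ := inner_pentadVector he ha.1 hb.1 haa hbb hab
  have hneg : ∀ {x y : E}, x ∈ lineVectors L → y = -x → y ∈ lineVectors L := by
    rintro x y hx rfl
    exact neg_mem_lineVectors hx
  have heq : ∀ {x y : E}, x ∈ lineVectors L → y = x → y ∈ lineVectors L := by
    rintro x y hx rfl
    exact hx
  have hmem : ∀ i j, i ≠ j → pentadVector e a b i + pentadVector e a b j ∈ lineVectors L := by
    refine forall_ne_fin_five (fun i j h => by rwa [add_comm]) ?_ ?_ ?_ ?_ ?_ ?_ ?_ ?_ ?_ ?_ <;>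
      simp only [pentadVector, Matrix.cons_val]
    · exact heq (hp 0) (by simp only [cubeDiagonal, Matrix.cons_val]; module)
    · exact heq hd.2 (by module)
    · exact hneg (hp 3) (by simp only [cubeDiagonal, Matrix.cons_val]; module)
    · exact heq ha.2 (by module)
    · exact hneg (hp 1) (by simp only [cubeDiagonal, Matrix.cons_val]; module)
    · exact heq hd'.2 (by module)
    · exact heq hb.2 (by module)
    · exact heq (hp 2) (by simp only [cubeDiagonal, Matrix.cons_val]; module)
    · exact hneg ha'.2 (by module)
    · exact hneg hb'.2 (by module)
  have hcard : Nat.card (completeK 5).edgeSet = 10 := by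
    rw [card_edgeSet_completeK]
    rfl
  refine (represents_lineGraph_completeK hφ).isInducedBySwitchingClass
    (edgeVector_mem_of_forall_ne hmem) ?_ ?_
  · rw [hcard, hL]
    rfl
  · rw [hcard, hr]
    norm_num

/-- Half the sum of two of the first three diagonals is `e 0`, `e 1` or `-e 2`, so sums of half
vectors are diagonals or vectors over a pillar. The fourth diagonal is left over and becomes the
isolated vertex. -/
theorem isInduced_of_three [FiniteDimensional ℝ E] {L : Set (Submodule ℝ E)} {e : Fin 3 → E}
    (he : Orthonormal ℝ e) (hp : ∀ k, cubeDiagonal e k ∈ lineVectors L)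
    (hY : IsRootTriple (pillar L e))
    (hs : Module.finrank ℝ (Submodule.span ℝ (⋃ k, pillar L e k)) = 3)
    (hk : ∀ i, Module.finrank ℝ (Submodule.span ℝ (pillar L e i)) ≤ 2)
    (hc : ∀ i, (pillar L e i).encard = 4) (hL : L.encard = 16)
    (hr : Module.finrank ℝ (Submodule.span ℝ (lineVectors L)) = 6) :
    IsInducedBySwitchingClass L ((completeK 6).lineGraph ⊕g completeK 1) := by
  obtain ⟨a, ha, h0, h1, h2⟩ := hY.exists_structure_of_three hs hk hc
  obtain ⟨f⟩ : Nonempty (Fin 6 ≃ Fin 3 × Bool) :=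
    ⟨(Fintype.equivFinOfCardEq (by simp)).symm⟩
  have hea : ∀ i k, ⟪e i, a k⟫_ℝ = 0 := by
    have key : ∀ {j : Fin 3} {x y : E}, signedSums x y ⊆ pillar L e j →
        ∀ i, ⟪e i, x⟫_ℝ = 0 ∧ ⟪e i, y⟫_ℝ = 0 := by
      intro j x y h i
      have e1 := (h (show x + y ∈ signedSums x y by simp [signedSums])).1 i
      have e2 := (h (show x - y ∈ signedSums x y by simp [signedSums])).1 i
      rw [inner_add_right] at e1
      rw [inner_sub_right] at e2
      constructor <;> linarith
    intro i k
    fin_cases k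
    · exact (key h0 i).1
    · exact (key h0 i).2
    · exact (key h1 i).2
  have hφ := inner_halfVector_comp f (p := fun k => cubeDiagonal e k.castSucc) (a := a)
    (inner_cubeDiagonal_castSucc he) ha
    (fun k l => inner_cubeDiagonal_of_orthogonal (fun i => hea i _) _)
  have hR := represents_lineGraph_completeK_sum (p := cubeDiagonal e 3) hφ
    (by rw [inner_cubeDiagonal he, if_pos rfl])
    (fun i => inner_cubeDiagonal_three_halfVector he hea (f i))
  have hmem : ∀ i j, i ≠ j → halfVector (fun k : Fin 3 => cubeDiagonal e k.castSucc) a (f i) +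
      halfVector (fun k : Fin 3 => cubeDiagonal e k.castSucc) a (f j) ∈ lineVectors L := by
    intro i j hij
    refine halfVector_add_mem (fun k => hp _) ?_ (fun h => hij (f.injective h))
    refine forall_ne_fin_three ?_ ?_ ?_ ?_
    · intro k l h σ τ hσ hτ
      convert h τ σ hτ hσ using 1
      module
    · intro σ τ hσ hτ
      convert (signed_mem_of_signedSums_subset_pillar h0 hσ hτ).1 using 3
      change (1 / 2 : ℝ) • ((e 0 + e 1 + e 2) + (e 0 - e 1 - e 2)) = e 0
      module
    · intro σ τ hσ hτ
      convert (signed_mem_of_signedSums_subset_pillar h1 hσ hτ).1 using 3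
      change (1 / 2 : ℝ) • ((e 0 + e 1 + e 2) + (-e 0 + e 1 - e 2)) = e 1
      module
    · intro σ τ hσ hτ
      convert (signed_mem_of_signedSums_subset_pillar h2 hσ hτ).2 using 3
      change (1 / 2 : ℝ) • ((e 0 - e 1 - e 2) + (-e 0 + e 1 - e 2)) = -e 2
      module
  have hcard : Nat.card ((completeK 6).edgeSet ⊕ Fin 1) = 16 := by
    rw [Nat.card_sum, card_edgeSet_completeK, Nat.card_eq_fintype_card, Fintype.card_fin]
    rfl
  refine hR.isInducedBySwitchingClass ?_ ?_ ?_
  · rintro (x | x)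
    · exact edgeVector_mem_of_forall_ne hmem x
    · exact hp 3
  · rw [hcard, hL]
    rfl
  · rw [hcard, hr]
    norm_num

/-- Half-sums of complementary pairs of diagonals are opposite: `±e i`. The three pairings of four
diagonals thus match the three pairings of the axes `a` by which the pillars are described. -/
theorem isInduced_of_four [FiniteDimensional ℝ E] {L : Set (Submodule ℝ E)} {e : Fin 3 → E}
    (he : Orthonormal ℝ e) (hp : ∀ k, cubeDiagonal e k ∈ lineVectors L)
    (hY : IsRootTriple (pillar L e))
    (hs : Module.finrank ℝ (Submodule.span ℝ (⋃ k, pillar L e k)) = 4)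
    (hk : ∀ i, Module.finrank ℝ (Submodule.span ℝ (pillar L e i)) ≤ 4)
    (hc : ∀ i, (pillar L e i).encard = 8) (hL : L.encard = 28)
    (hr : Module.finrank ℝ (Submodule.span ℝ (lineVectors L)) = 7) :
    IsInducedBySwitchingClass L (completeK 8).lineGraph := by
  obtain ⟨a, ha, h0, h1, h2⟩ := hY.exists_structure_of_four hs hk hc
  obtain ⟨h01, h23⟩ := Set.union_subset_iff.1 h0
  obtain ⟨h02, h13⟩ := Set.union_subset_iff.1 h1
  obtain ⟨h03, h12⟩ := Set.union_subset_iff.1 h2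
  obtain ⟨f⟩ : Nonempty (Fin 8 ≃ Fin 4 × Bool) :=
    ⟨(Fintype.equivFinOfCardEq (by simp)).symm⟩
  have hea : ∀ i k, ⟪e i, a k⟫_ℝ = 0 := by
    have key : ∀ {j : Fin 3} {x y : E}, signedSums x y ⊆ pillar L e j →
        ∀ i, ⟪e i, x⟫_ℝ = 0 ∧ ⟪e i, y⟫_ℝ = 0 := by
      intro j x y h i
      have e1 := (h (show x + y ∈ signedSums x y by simp [signedSums])).1 i
      have e2 := (h (show x - y ∈ signedSums x y by simp [signedSums])).1 i
      rw [inner_add_right] at e1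
      rw [inner_sub_right] at e2
      constructor <;> linarith
    intro i k
    fin_cases k
    · exact (key h01 i).1
    · exact (key h01 i).2
    · exact (key h23 i).1
    · exact (key h23 i).2
  have hφ := inner_halfVector_comp f (p := cubeDiagonal e) (inner_cubeDiagonal he) ha
    (fun k l => inner_cubeDiagonal_of_orthogonal (fun i => hea i _) _)
  have hmem : ∀ i j, i ≠ j → halfVector (cubeDiagonal e) a (f i) +
      halfVector (cubeDiagonal e) a (f j) ∈ lineVectors L := by
    intro i j hij
    refine halfVector_add_mem hp ?_ (fun h => hij (f.injective h))
    refine forall_ne_fin_four ?_ ?_ ?_ ?_ ?_ ?_ ?_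
    · intro k l h σ τ hσ hτ
      convert h τ σ hτ hσ using 1
      module
    · intro σ τ hσ hτ
      convert (signed_mem_of_signedSums_subset_pillar h01 hσ hτ).1 using 3
      change (1 / 2 : ℝ) • ((e 0 + e 1 + e 2) + (e 0 - e 1 - e 2)) = e 0
      module
    · intro σ τ hσ hτ
      convert (signed_mem_of_signedSums_subset_pillar h02 hσ hτ).1 using 3
      change (1 / 2 : ℝ) • ((e 0 + e 1 + e 2) + (-e 0 + e 1 - e 2)) = e 1
      module
    · intro σ τ hσ hτ
      convert (signed_mem_of_signedSums_subset_pillar h03 hσ hτ).1 using 3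
      change (1 / 2 : ℝ) • ((e 0 + e 1 + e 2) + (-e 0 - e 1 + e 2)) = e 2
      module
    · intro σ τ hσ hτ
      convert (signed_mem_of_signedSums_subset_pillar h12 hσ hτ).2 using 3
      change (1 / 2 : ℝ) • ((e 0 - e 1 - e 2) + (-e 0 + e 1 - e 2)) = -e 2
      module
    · intro σ τ hσ hτ
      convert (signed_mem_of_signedSums_subset_pillar h13 hσ hτ).2 using 3
      change (1 / 2 : ℝ) • ((e 0 - e 1 - e 2) + (-e 0 - e 1 + e 2)) = -e 1
      module
    · intro σ τ hσ hτ
      convert (signed_mem_of_signedSums_subset_pillar h23 hσ hτ).2 using 3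
      change (1 / 2 : ℝ) • ((-e 0 + e 1 - e 2) + (-e 0 - e 1 + e 2)) = -e 0
      module
  have hcard : Nat.card (completeK 8).edgeSet = 28 := by
    rw [card_edgeSet_completeK]
    rfl
  refine (represents_lineGraph_completeK hφ).isInducedBySwitchingClass
    (edgeVector_mem_of_forall_ne hmem) ?_ ?_
  · rw [hcard, hL]
    rfl
  · rw [hcard, hr]
    norm_num

theorem isInduced_of_orthogonal [FiniteDimensional ℝ E] {L : Set (Submodule ℝ E)} {e : E}
    (he : ⟪e, e⟫_ℝ = 1) {n : ℕ} {G : Finset E} (hG : G.card = n)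
    (hn : ∀ g ∈ G, ⟪g, g⟫_ℝ = 2) (ho : ∀ g ∈ G, ∀ g' ∈ G, g ≠ g' → ⟪g, g'⟫_ℝ = 0)
    (heg : ∀ g ∈ G, ⟪e, g⟫_ℝ = 0)
    (hmem : ∀ g ∈ G, e + g ∈ lineVectors L ∧ e - g ∈ lineVectors L)
    (hL : L.encard = (2 * n : ℕ))
    (hr : Module.finrank ℝ (Submodule.span ℝ (lineVectors L)) < 2 * n) :
    IsInducedBySwitchingClass L (completeBipartiteK 2 n).lineGraph := by
  subst hG
  set g : Fin G.card → E := fun j => G.equivFin.symm j with hg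
  have hgG : ∀ j, g j ∈ G := fun j => (G.equivFin.symm j).2
  have hR := represents_lineGraph_completeBipartiteK (e := e) (g := g) he
    (fun j => heg _ (hgG j)) (fun i j => by
      split_ifs with h
      · rw [h, hn _ (hgG j)]
      · exact ho _ (hgG i) _ (hgG j) fun h' => h (G.equivFin.symm.injective (Subtype.ext h')))
  refine hR.isInducedBySwitchingClass ?_ ?_ ?_
  · rintro ⟨x, hx⟩
    rw [SimpleGraph.edgeSet_completeBipartiteGraph] at hx
    obtain ⟨⟨k, j⟩, rfl⟩ := hx
    dsimp only
    rw [edgeVector_mk, Sum.elim_inl, Sum.elim_inr]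
    fin_cases k
    · exact (hmem _ (hgG j)).1
    · have := neg_mem_lineVectors (hmem _ (hgG j)).2
      rw [neg_sub, sub_eq_neg_add] at this
      exact this
  · rw [card_edgeSet_completeBipartiteK, hL]
  · rwa [card_edgeSet_completeBipartiteK]

/-- Seen from the axis `e i`, the four diagonals are, up to sign, `e i ± (e j + e k)` and `e i ± (e
j - e k)`. They have the same form as the pillar vectors `e i ± f`, so the frame of the pillar grows
by two orthogonal vectors to size `s + 2`. -/
theorem isInduced_of_single [FiniteDimensional ℝ E] {L : Set (Submodule ℝ E)} {e : Fin 3 → E}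
    (he : Orthonormal ℝ e) (hp : ∀ k, cubeDiagonal e k ∈ lineVectors L)
    (hY : IsRootTriple (pillar L e)) {i : Fin 3} {s : ℕ}
    (hs : Module.finrank ℝ (Submodule.span ℝ (pillar L e i)) = s)
    (hc : (pillar L e i).encard = (2 * s : ℕ)) (hL : L.encard = (2 * (s + 2) : ℕ))
    (hr : Module.finrank ℝ (Submodule.span ℝ (lineVectors L)) < 2 * (s + 2)) :
    IsInducedBySwitchingClass L (completeBipartiteK 2 (s + 2)).lineGraph := by
  classical
  have hen : ∀ i, ⟪e i, e i⟫_ℝ = 1 := fun i => by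
    rw [real_inner_self_eq_norm_mul_norm, he.1 i, one_mul]
  have heo : ∀ i j, i ≠ j → ⟪e i, e j⟫_ℝ = 0 := fun i j hij => he.2 hij
  obtain ⟨F, hF, hFY, hneg, ho⟩ := hY.exists_frame_of_encard hs.le hc
  have hsign : ∀ i j k : Fin 3, i ≠ j → i ≠ k → j ≠ k → e i + (e j + e k) ∈ lineVectors L ∧
      e i - (e j + e k) ∈ lineVectors L ∧ e i + (e j - e k) ∈ lineVectors L := by
    have hp0 : e 0 + e 1 + e 2 ∈ lineVectors L := hp 0
    have hp1 : e 0 - e 1 - e 2 ∈ lineVectors L := hp 1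
    have hp2 : -e 0 + e 1 - e 2 ∈ lineVectors L := hp 2
    have hp3 : -e 0 - e 1 + e 2 ∈ lineVectors L := hp 3
    have hn0 := neg_mem_lineVectors hp0
    have hn1 := neg_mem_lineVectors hp1
    have hn2 := neg_mem_lineVectors hp2
    have hn3 := neg_mem_lineVectors hp3
    intro i j k hij hik hjk
    fin_cases i <;> fin_cases j <;> first | exact absurd rfl hij | skip
    all_goals fin_cases k <;> first | exact absurd rfl hik | exact absurd rfl hjk | skip
    all_goals simp only [Fin.zero_eta, Fin.mk_one, Fin.reduceFinMk]
    · exact ⟨by convert hp0 using 1; abel, by convert hp1 using 1; abel,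
        by convert hn3 using 1; abel⟩
    · exact ⟨by convert hp0 using 1; abel, by convert hp1 using 1; abel,
        by convert hn2 using 1; abel⟩
    · exact ⟨by convert hp0 using 1; abel, by convert hp2 using 1; abel,
        by convert hn3 using 1; abel⟩
    · exact ⟨by convert hp0 using 1; abel, by convert hp2 using 1; abel,
        by convert hn1 using 1; abel⟩
    · exact ⟨by convert hp0 using 1; abel, by convert hp3 using 1; abel,
        by convert hn2 using 1; abel⟩
    · exact ⟨by convert hp0 using 1; abel, by convert hp3 using 1; abel,
        by convert hn1 using 1; abel⟩
  have hex : ∀ i : Fin 3, ∃ j k : Fin 3, i ≠ j ∧ i ≠ k ∧ j ≠ k := by decide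
  obtain ⟨j, k, hij, hik, hjk⟩ := hex i
  have hne : ∀ x ∈ F, ∀ c : ℝ, x ≠ e j + c • e k := by
    rintro x hx c rfl
    have := (hFY _ hx).1 j
    rw [inner_add_right, real_inner_smul_right, hen, heo j k hjk] at this
    norm_num at this
  have hg1 : e j + e k ∉ F := fun h => hne _ h 1 (by rw [one_smul])
  have hg2 : e j - e k ∉ F := fun h => hne _ h (-1) (by rw [neg_one_smul, sub_eq_add_neg])
  have hg12 : e j + e k ≠ e j - e k := by
    intro h
    have h1 : ⟪e k, e j + e k⟫_ℝ = ⟪e k, e j - e k⟫_ℝ := by rw [h]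
    rw [inner_add_right, inner_sub_right, hen, heo k j hjk.symm] at h1
    norm_num at h1
  have hFe : ∀ (m : Fin 3) (x : E), x ∈ F → ⟪e m, x⟫_ℝ = 0 := fun m x hx => (hFY x hx).1 m
  have hjk0 : ⟪e j + e k, e j - e k⟫_ℝ = 0 := by
    rw [inner_add_left, inner_sub_right, inner_sub_right, hen, hen, heo j k hjk,
      heo k j hjk.symm]
    norm_num
  have hFe1 : ∀ x ∈ F, ⟪e j + e k, x⟫_ℝ = 0 := fun x hx => by
    rw [inner_add_left, hFe j x hx, hFe k x hx, add_zero]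
  have hFe2 : ∀ x ∈ F, ⟪e j - e k, x⟫_ℝ = 0 := fun x hx => by
    rw [inner_sub_left, hFe j x hx, hFe k x hx, sub_zero]
  obtain ⟨s1, s2, s3⟩ := hsign i j k hij hik hjk
  obtain ⟨-, -, s4⟩ := hsign i k j hik hij hjk.symm
  refine isInduced_of_orthogonal (e := e i) (hen i)
    (G := insert (e j + e k) (insert (e j - e k) F)) ?_ ?_ ?_ ?_ ?_ hL hr
  · rw [Finset.card_insert_of_notMem (by simp [hg12, hg1]), Finset.card_insert_of_notMem hg2, hF]
  · intro g hg
    rcases Finset.mem_insert.1 hg with rfl | hg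
    · rw [inner_add_left, inner_add_right, inner_add_right, hen, hen, heo j k hjk,
        heo k j hjk.symm]
      norm_num
    rcases Finset.mem_insert.1 hg with rfl | hg
    · rw [inner_sub_left, inner_sub_right, inner_sub_right, hen, hen, heo j k hjk,
        heo k j hjk.symm]
      norm_num
    · exact hY.norm i g (hFY g hg)
  · intro g hg g' hg' hgg
    simp only [Finset.mem_insert] at hg hg'
    rcases hg with h | h | h <;> rcases hg' with h' | h' | h'
    · exact absurd (h.trans h'.symm) hgg
    · rw [h, h', hjk0]
    · rw [h, hFe1 g' h']
    · rw [h, h', real_inner_comm, hjk0]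
    · exact absurd (h.trans h'.symm) hgg
    · rw [h, hFe2 g' h']
    · rw [h', real_inner_comm, hFe1 g h]
    · rw [h', real_inner_comm, hFe2 g h]
    · exact ho g h g' h' hgg
  · intro g hg
    simp only [Finset.mem_insert] at hg
    rcases hg with rfl | rfl | h
    · rw [inner_add_right, heo i j hij, heo i k hik, add_zero]
    · rw [inner_sub_right, heo i j hij, heo i k hik, sub_zero]
    · exact hFe i g h
  · intro g hg
    simp only [Finset.mem_insert] at hg
    rcases hg with rfl | rfl | h
    · exact ⟨s1, s2⟩
    · exact ⟨s3, by rwa [← neg_sub (e k), sub_neg_eq_add]⟩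
    · refine ⟨(hFY g h).2, ?_⟩
      rw [sub_eq_add_neg]
      exact (hneg g (hFY g h)).2

/-- The maximum cardinality of a set of equiangular lines of rank `r` and angle `arccos (1/3)`. -/
def maxLines (r : ℕ) : ℕ :=
  if r = 5 then 10 else if r = 6 then 16 else if r = 7 then 28 else 2 * (r - 1)

theorem IsEquiangular.encard_le_maxLines [FiniteDimensional ℝ E] {L : Set (Submodule ℝ E)}
    (hL : IsEquiangular L (Real.arccos (1 / 3))) {r : ℕ} (hr : 3 ≤ r)
    (hrank : Module.finrank ℝ (Submodule.span ℝ (lineVectors L)) = r) :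
    L.encard ≤ maxLines r ∧ (L.encard = maxLines r →
      (r = 5 → IsInducedBySwitchingClass L (completeK 5).lineGraph) ∧
      (r = 6 → IsInducedBySwitchingClass L ((completeK 6).lineGraph ⊕g completeK 1)) ∧
      (r = 7 → IsInducedBySwitchingClass L (completeK 8).lineGraph) ∧
      (r ≠ 5 → r ≠ 6 → r ≠ 7 →
        IsInducedBySwitchingClass L (completeBipartiteK 2 (r - 1)).lineGraph)) := by
  by_cases htri : ∀ x ∈ lineVectors L, ∀ y ∈ lineVectors L, ∀ z ∈ lineVectors L, ⟪x, y⟫_ℝ = -1 →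
      ⟪x, z⟫_ℝ = -1 → ⟪y, z⟫_ℝ = -1 → False
  · have hle := hL.encard_le_finrank htri
    rw [hrank] at hle
    -- Uses `r ≥ 3`: already `2(r - 1) > r`.
    have hlt : r < maxLines r := by
      unfold maxLines
      split_ifs <;> omega
    have hlt' : (r : ℕ∞) < maxLines r := by exact_mod_cast hlt
    exact ⟨(hle.trans_lt hlt').le, fun h => absurd (h ▸ hle) (not_le.2 hlt')⟩
  push Not at htri
  obtain ⟨x, hx, y, hy, z, hz, hxy, hxz, hyz, -⟩ := htri
  obtain ⟨e, he, h₁, h₂, h₃⟩ := exists_cube_frame hx hy hz hxy hxz hyz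
  have hY := hL.isRootTriple_pillar he
  have hfin := hL.finrank_span_eq_add he h₁ h₂ h₃
  obtain ⟨hle4, hle3⟩ := hL.encard_le_pillars he h₁ h₂ h₃
  set s := Module.finrank ℝ (Submodule.span ℝ (⋃ k, pillar L e k)) with hs
  have hn : ∀ i, ∃ n : ℕ, (pillar L e i).encard = n ∧
      n ≤ 2 * Module.finrank ℝ (Submodule.span ℝ (pillar L e i)) := by
    intro i
    have h := hY.encard_le i
    obtain ⟨n, hn⟩ := ENat.ne_top_iff_exists.1 (ne_top_of_le_ne_top (ENat.natCast_ne_top _) h)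
    refine ⟨n, hn.symm, ?_⟩
    rw [← hn] at h
    exact_mod_cast h
  choose n hn hk using hn
  rw [hn 0, hn 1, hn 2] at hle4 hle3
  have hle4' : L.encard ≤ ((4 + (n 0 + n 1 + n 2) : ℕ) : ℕ∞) := by exact_mod_cast hle4
  obtain ⟨m, hm⟩ := ENat.ne_top_iff_exists.1 (ne_top_of_le_ne_top (ENat.natCast_ne_top _) hle4')
  rw [← hm] at hle4' hle3
  have hm4 : m ≤ 4 + (n 0 + n 1 + n 2) := by exact_mod_cast hle4'
  have hm3 : -e 0 - e 1 + e 2 ∉ lineVectors L → m ≤ 3 + (n 0 + n 1 + n 2) := by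
    intro h
    exact_mod_cast hle3 h
  have hrs : r = 3 + s := hrank.symm.trans hfin
  have hdich := hY.dichotomy hs.symm
  have hsingle : ∀ i, (∀ j, j ≠ i → pillar L e j = ∅) → n 0 + n 1 + n 2 = n i := by
    intro i hi
    have h0 : ∀ j, j ≠ i → n j = 0 := by
      intro j hj
      have := hn j
      rw [hi j hj, Set.encard_empty] at this
      exact_mod_cast this.symm
    fin_cases i
    · have a1 := h0 1 (by decide)
      have a2 := h0 2 (by decide)
      simp only [Fin.zero_eta]
      omega
    · have a1 := h0 0 (by decide)
      have a2 := h0 2 (by decide)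
      simp only [Fin.mk_one]
      omega
    · have a1 := h0 0 (by decide)
      have a2 := h0 1 (by decide)
      simp only [Fin.reduceFinMk]
      omega
  -- One pillar gives at most `4 + 2s`, which for `s = 2, 3, 4` is `8, 10, 12`, below the
  -- exceptional values. Several pillars give at most `4 + 6`, `4 + 12`, `4 + 24`.
  have hbound : 4 + (n 0 + n 1 + n 2) ≤ maxLines r := by
    unfold maxLines
    rcases hdich with ⟨i, hi, hi'⟩ | ⟨h, hk'⟩ | ⟨h, hk'⟩ | ⟨h, hk'⟩
    · have := hsingle i hi'
      have := hk i
      split_ifs <;> omega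
    all_goals
      have a0 := hk 0
      have a1 := hk 1
      have a2 := hk 2
      have b0 := hk' 0
      have b1 := hk' 1
      have b2 := hk' 2
      split_ifs <;> omega
  rw [← hm]
  refine ⟨by exact_mod_cast hm4.trans hbound, fun hmeq => ?_⟩
  have hmN : m = maxLines r := by exact_mod_cast hmeq
  -- Without the fourth diagonal the count would be at least one short of the maximum.
  have h₄ : -e 0 - e 1 + e 2 ∈ lineVectors L := by
    by_contra h
    have := hm3 h
    omega
  have hp : ∀ k, cubeDiagonal e k ∈ lineVectors L := by
    intro k
    fin_cases k
    · exact h₁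
    · exact h₂
    · exact h₃
    · exact h₄
  have hsum : 4 + (n 0 + n 1 + n 2) = maxLines r := le_antisymm hbound (hmN ▸ hm4)
  -- The sum attains the total of the three individual bounds, so each pillar attains its own.
  have hall : ∀ {c : ℕ}, (∀ i, n i ≤ c) → n 0 + n 1 + n 2 = 3 * c → ∀ i, n i = c := by
    intro c hc hcs i
    have a0 := hc 0
    have a1 := hc 1
    have a2 := hc 2
    fin_cases i
    · simp only [Fin.zero_eta]
      omega
    · simp only [Fin.mk_one]
      omega
    · simp only [Fin.reduceFinMk]
      omega
  rw [hmN] at hm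
  refine ⟨fun h5 => ?_, fun h6 => ?_, fun h7 => ?_, fun h5 h6 h7 => ?_⟩
  · have hN : maxLines r = 10 := by rw [h5]; rfl
    rcases hdich with ⟨i, hi, hi'⟩ | ⟨h, hk'⟩ | ⟨h, hk'⟩ | ⟨h, hk'⟩
    · have := hsingle i hi'
      have := hk i
      omega
    · have hc := hall (c := 2) (fun i => by have := hk i; have := hk' i; omega) (by omega)
      refine isInduced_of_two he hp hY (hs.symm.trans h) hk' (fun i => by rw [hn, hc]; rfl)
        (by rw [← hm, hN]; rfl) (hrank.trans h5)
    · omega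
    · omega
  · have hN : maxLines r = 16 := by rw [h6]; rfl
    rcases hdich with ⟨i, hi, hi'⟩ | ⟨h, hk'⟩ | ⟨h, hk'⟩ | ⟨h, hk'⟩
    · have := hsingle i hi'
      have := hk i
      omega
    · omega
    · have hc := hall (c := 4) (fun i => by have := hk i; have := hk' i; omega) (by omega)
      refine isInduced_of_three he hp hY (hs.symm.trans h) hk' (fun i => by rw [hn, hc]; rfl)
        (by rw [← hm, hN]; rfl) (hrank.trans h6)
    · omega
  · have hN : maxLines r = 28 := by rw [h7]; rfl
    rcases hdich with ⟨i, hi, hi'⟩ | ⟨h, hk'⟩ | ⟨h, hk'⟩ | ⟨h, hk'⟩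
    · have := hsingle i hi'
      have := hk i
      omega
    · omega
    · omega
    · have hc := hall (c := 8) (fun i => by have := hk i; have := hk' i; omega) (by omega)
      refine isInduced_of_four he hp hY (hs.symm.trans h) hk' (fun i => by rw [hn, hc]; rfl)
        (by rw [← hm, hN]; rfl) (hrank.trans h7)
  · have hN : maxLines r = 2 * (s + 2) := by
      unfold maxLines
      rw [if_neg h5, if_neg h6, if_neg h7]
      omega
    rcases hdich with ⟨i, hi, hi'⟩ | ⟨h, hk'⟩ | ⟨h, hk'⟩ | ⟨h, hk'⟩
    · have h1 := hsingle i hi'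
      have h2 := hk i
      have h3 : n i = 2 * s := by omega
      rw [show r - 1 = s + 2 by omega]
      exact isInduced_of_single he hp hY hi (by rw [hn, h3]) (by rw [← hm, hN])
        (by rw [hrank]; omega)
    all_goals omega

theorem maxLines_mem_equiangularCards {r : ℕ} (hr : 3 ≤ r) :
    (maxLines r : ℕ∞) ∈ equiangularCards (1 / 3) r := by
  unfold maxLines
  split_ifs with h5 h6 h7
  · subst h5
    exact ten_mem_equiangularCards
  · subst h6
    exact sixteen_mem_equiangularCards
  · subst h7
    exact twentyEight_mem_equiangularCards
  · obtain ⟨n, rfl⟩ : ∃ n, r = n + 1 := ⟨r - 1, by omega⟩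
    rw [Nat.add_sub_cancel]
    exact two_mul_mem_equiangularCards (by omega)

theorem IsEquiangular.finrank_span_lineVectors [FiniteDimensional ℝ E] {L : Set (Submodule ℝ E)}
    {θ : ℝ} (hL : IsEquiangular L θ) :
    Module.finrank ℝ (Submodule.span ℝ (lineVectors L)) = lineRank L := by
  rw [lineRank_eq_finrank_span, hL.span_lineVectors]

theorem isGreatest_maxLines {r : ℕ} (hr : 3 ≤ r) :
    IsGreatest (equiangularCards (1 / 3) r) (maxLines r : ℕ∞) := by
  refine ⟨maxLines_mem_equiangularCards hr, ?_⟩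
  rintro _ ⟨d, L, hL, hrank, rfl⟩
  exact (hL.encard_le_maxLines hr (hL.finrank_span_lineVectors.trans hrank)).1

end Classification

theorem corollary3p2 (r : ℕ) (hr : 3 ≤ r) :
    IsGreatest (equiangularCards (1 / 3) r) (maxEquiangular (1 / 3) r) ∧
    maxEquiangular (1 / 3) r =
      ((if r = 5 then 10 else if r = 6 then 16 else if r = 7 then 28 else 2 * (r - 1) : ℕ) : ℕ∞) ∧
    ∀ (d : ℕ) (L : Set (Submodule ℝ (EuclideanSpace ℝ (Fin d)))),
      IsEquiangular L (Real.arccos (1 / 3)) → lineRank L = r →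
      L.encard = maxEquiangular (1 / 3) r →
        (r = 5 → IsInducedBySwitchingClass L (completeK 5).lineGraph) ∧
        (r = 6 → IsInducedBySwitchingClass L ((completeK 6).lineGraph ⊕g completeK 1)) ∧
        (r = 7 → IsInducedBySwitchingClass L (completeK 8).lineGraph) ∧
        (r ≠ 5 → r ≠ 6 → r ≠ 7 →
          IsInducedBySwitchingClass L (completeBipartiteK 2 (r - 1)).lineGraph) := by
  have hmax : maxEquiangular (1 / 3) r = maxLines r := (isGreatest_maxLines hr).isLUB.sSup_eq
  rw [hmax]
  refine ⟨isGreatest_maxLines hr, rfl, fun d L hL hrank hcard => ?_⟩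
  exact (hL.encard_le_maxLines hr (hL.finrank_span_lineVectors.trans hrank)).2 hcard
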